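/- Let $\Psi\colon[0,\infty)\to[0,\infty)$ be an Orlicz function, i.e. $\Psi$ is non-decreasing, strictly convex, continuous at $0$, $\Psi(0)=0$ and $\Psi(x)/x\to\infty$ as $x\to\infty$. Let $m$ be the normalized Lebesgue measure on the unit circle $\mathbb T$ and $\mathbb D$ the open unit disk. Let $L^\Psi(\mathbb T)$ be the space of (classes of) measurable $f\colon\mathbb T\to\mathbb C$ with $\int_{\mathbb T}\Psi(|f|/C)\,dm<\infty$ for some $C>0$, with the Luxemburg norm $\|f\|_\Psi=\inf\{C>0:\int_{\mathbb T}\Psi(|f|/C)\,dm\le 1\}$, and $M^\Psi(\mathbb T)$ the subspace of those $f$ for which this integral is finite for every $C>0$. Let $H^\Psi$ be the space of analytic functions $f(z)=\sum_{n\ge0}\widehat{f^*}(n)z^n$ on $\mathbb D$ with boundary function $f^*\in L^\Psi(\mathbb T)$ such that $\widehat{f^*}(n)=0$ for $n<0$, normed by $\|f\|=\|f^*\|_\Psi$. Assume that $\Psi\in\Delta^2$: there is $\alpha>1$ such that $\Psi(x)^2\le\Psi(\alpha x)$ for all $x$ large enough. Then there is an analytic map $\phi\colon\mathbb D\to\mathbb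 D$ such that the composition operator $C_\phi\colon f\mapsto f\circ\phi$ is a bounded operator $H^\Psi\to H^\Psi$ with the following properties: 1. $C_\phi$ is order bounded into $M^\Psi(\mathbb T)$: there is $y\ge0$ in $M^\Psi(\mathbb T)$ such that $|(f\circ\phi)^*|\le y$ a.e. on $\mathbb T$ for every $f\in H^\Psi$ with $\|f\|\le1$; 2. $C_\phi$ is compact; 3. for no real $p\ge1$ is $C_\phi$ $p$-summing, i.e. for no $p\ge 1$ is there a constant $C>0$ such that $$\sum_{k=1}^n\|C_\phi f_k\|^p\le C^p\sup_{\xi\in (H^\Psi)^*,\ \|\xi\|\le1}\ \sum_{k=1}^n|\xi(f_k)|^p$$ for all $n$ and all $f_1,\dots,f_n\in H^\Psi$. Moreover, $\phi$ can be taken to be an outer function with piecewise constant modulus, $$\phi(z)=\exp\Big(\int_{\mathbb T}\frac{u+z}{u-z}\,\log h(u)\,dm(u)\Big),\qquad h=\sum_{n}r_n\mathbf 1_{B_n},\quad \log h\in L^1(\mathbb T),$$ where $(B_n)$ is a countable partition of $\mathbb T$ into measurable sets and $0<r_n<1$. -/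

import Mathlib

noncomputable section

open MeasureTheory Set Filter Topology

namespace HardyOrlicz

/-! ### Orlicz functions -/

/-- An Orlicz function: a non-decreasing, strictly convex `Ψ : [0, ∞) → [0, ∞)`, continuous at `0`,
with `Ψ 0 = 0` and `Ψ x / x → ∞` as `x → ∞`. Only the values on `[0, ∞)` matter; they are
nonnegative because `Ψ` is non-decreasing and `Ψ 0 = 0`. -/
structure OrliczFunction where
  /-- the underlying function -/
  toFun : ℝ → ℝ
  map_zero : toFun 0 = 0
  monotoneOn : MonotoneOn toFun (Ici 0)
  continuousWithinAt_zero : ContinuousWithinAt toFun (Ici 0) 0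
  strictConvexOn : StrictConvexOn ℝ (Ici 0) toFun
  tendsto_div_atTop : Tendsto (fun x => toFun x / x) atTop atTop

instance : CoeFun OrliczFunction (fun _ => ℝ → ℝ) := ⟨OrliczFunction.toFun⟩

namespace OrliczFunction

/-- The fast growth condition `Δ²`: for some `α > 1`, `Ψ(x)² ≤ Ψ(α x)` for all large `x`. -/
def DeltaSupTwo (Ψ : OrliczFunction) : Prop :=
  ∃ α : ℝ, 1 < α ∧ ∀ᶠ x in atTop, (Ψ x) ^ 2 ≤ Ψ (α * x)

theorem nonneg (Ψ : OrliczFunction) {x : ℝ} (hx : 0 ≤ x) : 0 ≤ Ψ x := by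
  have h := Ψ.monotoneOn (mem_Ici.2 le_rfl) (mem_Ici.2 hx) hx
  rwa [Ψ.map_zero] at h

theorem convex_comb (Ψ : OrliczFunction) {x y a b : ℝ} (hx : 0 ≤ x) (hy : 0 ≤ y) (ha : 0 ≤ a)
    (hb : 0 ≤ b) (hab : a + b = 1) : Ψ (a * x + b * y) ≤ a * Ψ x + b * Ψ y := by
  have h := Ψ.strictConvexOn.convexOn.2 (mem_Ici.2 hx) (mem_Ici.2 hy) ha hb hab
  simpa [smul_eq_mul] using h

theorem mul_le (Ψ : OrliczFunction) {x a : ℝ} (hx : 0 ≤ x) (ha : 0 ≤ a) (ha1 : a ≤ 1) :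
    Ψ (a * x) ≤ a * Ψ x := by
  have h := Ψ.convex_comb hx le_rfl ha (sub_nonneg.2 ha1) (by ring)
  simpa [Ψ.map_zero] using h

theorem pos (Ψ : OrliczFunction) {x : ℝ} (hx : 0 < x) : 0 < Ψ x := by
  have h := Ψ.strictConvexOn.2 (mem_Ici.2 le_rfl) (mem_Ici.2 hx.le) hx.ne
    (by norm_num : (0 : ℝ) < 1 / 2) (by norm_num : (0 : ℝ) < 1 / 2) (by norm_num)
  simp only [smul_eq_mul, Ψ.map_zero, mul_zero, zero_add] at h
  have h0 : 0 ≤ Ψ (1 / 2 * x) := Ψ.nonneg (by positivity)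
  linarith

theorem measurable_max (Ψ : OrliczFunction) : Measurable fun x : ℝ => Ψ (max x 0) :=
  Monotone.measurable fun _ _ hxy =>
    Ψ.monotoneOn (mem_Ici.2 (le_max_right _ _)) (mem_Ici.2 (le_max_right _ _))
      (max_le_max hxy le_rfl)

end OrliczFunction

/-! ### Orlicz spaces and Morse–Transue spaces -/

section Orlicz

variable {Ω : Type*} [MeasurableSpace Ω]

/-- `∫ Ψ(|f| / C) dμ`, as an element of `[0, ∞]`. -/
def modular (Ψ : OrliczFunction) (μ : Measure Ω) (f : Ω → ℂ) (C : ℝ) : ENNReal :=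
  ∫⁻ t, ENNReal.ofReal (Ψ (‖f t‖ / C)) ∂μ

/-- The Luxemburg norm: the infimum of all `C > 0` with `∫ Ψ(|f| / C) dμ ≤ 1`. -/
def luxemburgNorm (Ψ : OrliczFunction) (μ : Measure Ω) (f : Ω → ℂ) : ℝ :=
  sInf {C : ℝ | 0 < C ∧ modular Ψ μ f C ≤ 1}

variable {Ψ : OrliczFunction} {μ : Measure Ω}

theorem modular_congr {f g : Ω → ℂ} (h : f =ᵐ[μ] g) (C : ℝ) :
    modular Ψ μ f C = modular Ψ μ g C :=
  lintegral_congr_ae (by filter_upwards [h] with t ht; rw [ht])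

theorem luxemburgNorm_congr {f g : Ω → ℂ} (h : f =ᵐ[μ] g) :
    luxemburgNorm Ψ μ f = luxemburgNorm Ψ μ g := by
  simp only [luxemburgNorm, modular_congr h]

theorem aemeasurable_modular {f : Ω → ℂ} (hf : AEStronglyMeasurable f μ) {C : ℝ} (hC : 0 < C) :
    AEMeasurable (fun t => ENNReal.ofReal (Ψ (‖f t‖ / C))) μ := by
  have h : AEMeasurable (fun t => ENNReal.ofReal (Ψ (max (‖f t‖ / C) 0))) μ :=
    (Ψ.measurable_max.comp_aemeasurable (hf.norm.aemeasurable.div_const C)).ennreal_ofReal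
  refine h.congr (Eventually.of_forall fun t => ?_)
  have : (0 : ℝ) ≤ ‖f t‖ / C := by positivity
  simp only [max_eq_left this]

theorem modular_zero (C : ℝ) : modular Ψ μ (0 : Ω → ℂ) C = 0 := by
  simp [modular, Ψ.map_zero]

theorem modular_add_le {f g : Ω → ℂ} (hf : AEStronglyMeasurable f μ) {a b : ℝ}
    (ha : 0 < a) (hb : 0 < b) :
    modular Ψ μ (f + g) (a + b) ≤
      ENNReal.ofReal (a / (a + b)) * modular Ψ μ f a +
        ENNReal.ofReal (b / (a + b)) * modular Ψ μ g b := by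
  have hab : 0 < a + b := by positivity
  unfold modular
  rw [← lintegral_const_mul' _ _ ENNReal.ofReal_ne_top,
    ← lintegral_const_mul' _ _ ENNReal.ofReal_ne_top,
    ← lintegral_add_left' ((aemeasurable_modular hf ha).const_mul _)]
  refine lintegral_mono fun t => ?_
  have hfa : 0 ≤ ‖f t‖ / a := by positivity
  have hgb : 0 ≤ ‖g t‖ / b := by positivity
  have h1 : ‖(f + g) t‖ / (a + b) ≤ a / (a + b) * (‖f t‖ / a) + b / (a + b) * (‖g t‖ / b) := by
    have : a / (a + b) * (‖f t‖ / a) + b / (a + b) * (‖g t‖ / b) = (‖f t‖ + ‖g t‖) / (a + b) := by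
      field_simp
    rw [this]
    gcongr
    exact norm_add_le _ _
  have h2 := Ψ.monotoneOn (mem_Ici.2 (by positivity)) (mem_Ici.2 (by positivity)) h1
  have h3 := Ψ.convex_comb hfa hgb (by positivity : 0 ≤ a / (a + b))
    (by positivity : 0 ≤ b / (a + b)) (by field_simp)
  rw [← ENNReal.ofReal_mul (by positivity), ← ENNReal.ofReal_mul (by positivity),
    ← ENNReal.ofReal_add (mul_nonneg (by positivity) (Ψ.nonneg hfa))
      (mul_nonneg (by positivity) (Ψ.nonneg hgb))]
  exact ENNReal.ofReal_le_ofReal (h2.trans h3)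

theorem modular_mul_le (f : Ω → ℂ) {C K : ℝ} (hC : 0 < C) (hK : 1 ≤ K) :
    modular Ψ μ f (K * C) ≤ ENNReal.ofReal K⁻¹ * modular Ψ μ f C := by
  have hK0 : 0 < K := by linarith
  unfold modular
  rw [← lintegral_const_mul' _ _ ENNReal.ofReal_ne_top]
  refine lintegral_mono fun t => ?_
  rw [← ENNReal.ofReal_mul (by positivity)]
  refine ENNReal.ofReal_le_ofReal ?_
  have h := Ψ.mul_le (x := ‖f t‖ / C) (a := K⁻¹) (by positivity) (by positivity)
    (inv_le_one_of_one_le₀ hK)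
  have he : ‖f t‖ / (K * C) = K⁻¹ * (‖f t‖ / C) := by field_simp
  rwa [he]

theorem modular_smul (f : Ω → ℂ) {c : ℂ} (hc : c ≠ 0) (C : ℝ) :
    modular Ψ μ (c • f) (‖c‖ * C) = modular Ψ μ f C := by
  have hc' : ‖c‖ ≠ 0 := norm_ne_zero_iff.2 hc
  unfold modular
  congr 1 with t
  rw [Pi.smul_apply, norm_smul, mul_div_mul_left _ _ hc']

variable (Ψ μ)

/-- The Orlicz space `L^Ψ(μ)`: classes of measurable functions `f` such that
`∫ Ψ(|f| / C) dμ < ∞` for some `C > 0`. -/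
def orliczSpace : Submodule ℂ (Ω →ₘ[μ] ℂ) where
  carrier := {f | ∃ C : ℝ, 0 < C ∧ modular Ψ μ f C < ⊤}
  zero_mem' := ⟨1, one_pos, by
    rw [modular_congr (g := 0) AEEqFun.coeFn_zero, modular_zero]; exact ENNReal.zero_lt_top⟩
  add_mem' := by
    rintro f g ⟨a, ha, hfa⟩ ⟨b, hb, hgb⟩
    refine ⟨a + b, by positivity, ?_⟩
    rw [modular_congr (AEEqFun.coeFn_add f g)]
    exact (modular_add_le f.aestronglyMeasurable ha hb).trans_lt (ENNReal.add_lt_top.2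
      ⟨ENNReal.mul_lt_top ENNReal.ofReal_lt_top hfa, ENNReal.mul_lt_top ENNReal.ofReal_lt_top hgb⟩)
  smul_mem' := by
    rintro c f ⟨a, ha, hfa⟩
    by_cases hc : c = 0
    · refine ⟨1, one_pos, ?_⟩
      rw [hc, zero_smul, modular_congr (g := 0) AEEqFun.coeFn_zero, modular_zero]
      exact ENNReal.zero_lt_top
    · refine ⟨‖c‖ * a, mul_pos (norm_pos_iff.2 hc) ha, ?_⟩
      rw [modular_congr (AEEqFun.coeFn_smul c f), modular_smul _ hc]
      exact hfa

/-- The Morse–Transue space `M^Ψ(μ)`: those `f ∈ L^Ψ(μ)` with `∫ Ψ(|f| / C) dμ < ∞` for every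
`C > 0`. -/
def morseTransue : Submodule ℂ (orliczSpace Ψ μ) where
  carrier := {f | ∀ C : ℝ, 0 < C → modular Ψ μ f.1 C < ⊤}
  zero_mem' := fun C _ => by
    have h : ((0 : orliczSpace Ψ μ).1 : Ω → ℂ) =ᵐ[μ] 0 := AEEqFun.coeFn_zero
    rw [modular_congr h, modular_zero]; exact ENNReal.zero_lt_top
  add_mem' := by
    intro f g hf hg C hC
    have h : ((f + g).1 : Ω → ℂ) =ᵐ[μ] f.1 + g.1 := AEEqFun.coeFn_add f.1 g.1
    rw [modular_congr h, ← add_halves C]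
    exact (modular_add_le f.1.aestronglyMeasurable (half_pos hC) (half_pos hC)).trans_lt
      (ENNReal.add_lt_top.2
        ⟨ENNReal.mul_lt_top ENNReal.ofReal_lt_top (hf _ (half_pos hC)),
          ENNReal.mul_lt_top ENNReal.ofReal_lt_top (hg _ (half_pos hC))⟩)
  smul_mem' := by
    intro c f hf C hC
    have h : ((c • f).1 : Ω → ℂ) =ᵐ[μ] c • f.1 := AEEqFun.coeFn_smul c f.1
    rw [modular_congr h]
    by_cases hc : c = 0
    · rw [hc, zero_smul, modular_zero]; exact ENNReal.zero_lt_top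
    · have hc' : 0 < ‖c‖ := norm_pos_iff.2 hc
      have := modular_smul (Ψ := Ψ) (μ := μ) f.1 hc (C / ‖c‖)
      rw [mul_div_cancel₀ _ hc'.ne'] at this
      rw [this]
      exact hf _ (div_pos hC hc')

variable {Ψ μ}

theorem exists_modular_le_one (f : orliczSpace Ψ μ) : ∃ C : ℝ, 0 < C ∧ modular Ψ μ f.1 C ≤ 1 := by
  obtain ⟨C, hC, hfin⟩ := f.2
  set M : ℝ := (modular Ψ μ f.1 C).toReal with hM
  have hM0 : 0 ≤ M := ENNReal.toReal_nonneg
  refine ⟨(1 + M) * C, by positivity, (modular_mul_le _ hC (by linarith)).trans ?_⟩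
  rw [← ENNReal.ofReal_toReal hfin.ne, ← hM, ← ENNReal.ofReal_mul (by positivity),
    ENNReal.ofReal_le_one, inv_mul_le_iff₀ (by positivity)]
  linarith

theorem luxemburgNorm_set_bddBelow (f : Ω → ℂ) :
    BddBelow {C : ℝ | 0 < C ∧ modular Ψ μ f C ≤ 1} := ⟨0, fun _ hC => hC.1.le⟩

theorem luxemburgNorm_nonneg (f : Ω → ℂ) : 0 ≤ luxemburgNorm Ψ μ f :=
  Real.sInf_nonneg fun _ hC => hC.1.le

theorem luxemburgNorm_zero : luxemburgNorm Ψ μ (0 : Ω → ℂ) = 0 := by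
  refine le_antisymm (le_of_forall_pos_le_add fun ε hε => ?_) (luxemburgNorm_nonneg _)
  rw [zero_add]
  exact csInf_le (luxemburgNorm_set_bddBelow _) ⟨hε, by rw [modular_zero]; exact zero_le_one⟩

theorem luxemburgNorm_add_le (f g : orliczSpace Ψ μ) :
    luxemburgNorm Ψ μ (f + g).1 ≤ luxemburgNorm Ψ μ f.1 + luxemburgNorm Ψ μ g.1 := by
  refine le_of_forall_pos_le_add fun ε hε => ?_
  obtain ⟨a, ⟨ha, hfa⟩, hae⟩ := Real.lt_sInf_add_pos (exists_modular_le_one f) (half_pos hε)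
  obtain ⟨b, ⟨hb, hgb⟩, hbe⟩ := Real.lt_sInf_add_pos (exists_modular_le_one g) (half_pos hε)
  have h : ((f + g).1 : Ω → ℂ) =ᵐ[μ] f.1 + g.1 := AEEqFun.coeFn_add f.1 g.1
  have hab : modular Ψ μ (f + g).1 (a + b) ≤ 1 := by
    rw [modular_congr h]
    calc _ ≤ _ := modular_add_le f.1.aestronglyMeasurable ha hb
      _ ≤ ENNReal.ofReal (a / (a + b)) * 1 + ENNReal.ofReal (b / (a + b)) * 1 := by gcongr
      _ = 1 := by
        rw [mul_one, mul_one, ← ENNReal.ofReal_add (by positivity) (by positivity), ← add_div,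
          div_self (by positivity), ENNReal.ofReal_one]
  have h1 : luxemburgNorm Ψ μ (f + g).1 ≤ a + b :=
    csInf_le (luxemburgNorm_set_bddBelow _) ⟨by positivity, hab⟩
  have h2 : a < luxemburgNorm Ψ μ f.1 + ε / 2 := hae
  have h3 : b < luxemburgNorm Ψ μ g.1 + ε / 2 := hbe
  linarith

theorem luxemburgNorm_smul_le (c : ℂ) (f : orliczSpace Ψ μ) :
    luxemburgNorm Ψ μ (c • f).1 ≤ ‖c‖ * luxemburgNorm Ψ μ f.1 := by
  have h : ((c • f).1 : Ω → ℂ) =ᵐ[μ] c • f.1 := AEEqFun.coeFn_smul c f.1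
  rw [luxemburgNorm_congr h]
  by_cases hc : c = 0
  · rw [hc, zero_smul, luxemburgNorm_zero, norm_zero, zero_mul]
  · have hc' : 0 < ‖c‖ := norm_pos_iff.2 hc
    rw [← div_le_iff₀' hc']
    refine le_csInf (exists_modular_le_one f) fun a ha => ?_
    rw [div_le_iff₀' hc']
    exact csInf_le (luxemburgNorm_set_bddBelow _)
      ⟨mul_pos hc' ha.1, by rw [modular_smul _ hc]; exact ha.2⟩

theorem luxemburgNorm_neg (f : orliczSpace Ψ μ) :
    luxemburgNorm Ψ μ (-f).1 = luxemburgNorm Ψ μ f.1 := by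
  have h : ((-f).1 : Ω → ℂ) =ᵐ[μ] -f.1 := AEEqFun.coeFn_neg f.1
  rw [luxemburgNorm_congr h]
  simp only [luxemburgNorm, modular, Pi.neg_apply, norm_neg]

theorem eq_zero_of_luxemburgNorm_eq_zero (f : orliczSpace Ψ μ)
    (hf : luxemburgNorm Ψ μ f.1 = 0) : f = 0 := by
  have key : ∀ ε : ℝ, 0 < ε → ε ≤ 1 → modular Ψ μ f.1 1 ≤ ENNReal.ofReal ε := by
    intro ε hε hε1
    obtain ⟨a, ⟨ha, hfa⟩, hae⟩ := Real.lt_sInf_add_pos (exists_modular_le_one f) hε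
    have h0 : sInf {C : ℝ | 0 < C ∧ modular Ψ μ f.1 C ≤ 1} = 0 := hf
    replace hae : a < ε := by
      have : a < sInf {C : ℝ | 0 < C ∧ modular Ψ μ f.1 C ≤ 1} + ε := hae
      rwa [h0, zero_add] at this
    have h1 := modular_mul_le (Ψ := Ψ) (μ := μ) f.1 ha (K := a⁻¹)
      ((one_le_inv₀ ha).2 (hae.le.trans hε1))
    rw [inv_mul_cancel₀ ha.ne', inv_inv] at h1
    calc _ ≤ _ := h1
      _ ≤ ENNReal.ofReal ε * 1 := by gcongr
      _ = _ := mul_one _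
  have hz : modular Ψ μ f.1 1 = 0 := by
    refine le_antisymm (le_of_forall_pos_le_add fun ε hε => ?_) zero_le
    rw [zero_add]
    by_cases ht : min ε 1 = ⊤
    · simp at ht
    have hm : 0 < min ε 1 := lt_min hε one_pos
    have h1 : (min ε 1).toReal ≤ 1 := by
      have := ENNReal.toReal_mono ENNReal.one_ne_top (min_le_right ε 1)
      simpa using this
    have := key _ (ENNReal.toReal_pos hm.ne' ht) h1
    rw [ENNReal.ofReal_toReal ht] at this
    exact this.trans (min_le_left _ _)
  have hae := (lintegral_eq_zero_iff'
    (aemeasurable_modular (Ψ := Ψ) f.1.aestronglyMeasurable one_pos)).1 hz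
  have h0 : (f.1 : Ω → ℂ) =ᵐ[μ] (0 : Ω →ₘ[μ] ℂ) := by
    filter_upwards [hae, AEEqFun.coeFn_zero (α := Ω) (μ := μ) (β := ℂ)] with t ht ht0
    rw [ht0]
    by_contra hne
    have hpos : 0 < ‖f.1 t‖ / 1 := by
      rw [div_one]; exact norm_pos_iff.2 hne
    have := Ψ.pos hpos
    simp only [Pi.zero_apply, ENNReal.ofReal_eq_zero] at ht
    linarith
  exact Subtype.ext (AEEqFun.ext h0)

/-- `L^Ψ(μ)` is normed by the Luxemburg norm. -/
instance : NormedAddCommGroup (orliczSpace Ψ μ) :=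
  AddGroupNorm.toNormedAddCommGroup
    { toFun := fun f => luxemburgNorm Ψ μ f.1
      map_zero' := by
        have h : ((0 : orliczSpace Ψ μ).1 : Ω → ℂ) =ᵐ[μ] 0 := AEEqFun.coeFn_zero
        rw [luxemburgNorm_congr h, luxemburgNorm_zero]
      add_le' := luxemburgNorm_add_le
      neg' := luxemburgNorm_neg
      eq_zero_of_map_eq_zero' := eq_zero_of_luxemburgNorm_eq_zero }

theorem norm_def (f : orliczSpace Ψ μ) : ‖f‖ = luxemburgNorm Ψ μ f.1 := rfl

instance : NormedSpace ℂ (orliczSpace Ψ μ) where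
  norm_smul_le := luxemburgNorm_smul_le

theorem integrable_of_mem_orliczSpace [IsFiniteMeasure μ] (f : orliczSpace Ψ μ) :
    Integrable f.1 μ := by
  obtain ⟨C, hC, hfin⟩ := f.2
  obtain ⟨x₀, hx₀⟩ := eventually_atTop.1 (Ψ.tendsto_div_atTop.eventually_ge_atTop 1)
  refine ⟨f.1.aestronglyMeasurable, ?_⟩
  set K : ℝ := max x₀ 1 with hK
  have hK0 : 0 < K := lt_max_of_lt_right one_pos
  have hpt : ∀ t, ‖f.1 t‖ₑ ≤
      ENNReal.ofReal (C * K) + ENNReal.ofReal C * ENNReal.ofReal (Ψ (‖f.1 t‖ / C)) := by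
    intro t
    have hx : 0 ≤ ‖f.1 t‖ / C := by positivity
    rw [← ENNReal.ofReal_mul hC.le, ← ENNReal.ofReal_add (by positivity)
      (mul_nonneg hC.le (Ψ.nonneg hx)), ← ofReal_norm]
    refine ENNReal.ofReal_le_ofReal ?_
    have hle : ‖f.1 t‖ / C ≤ K + Ψ (‖f.1 t‖ / C) := by
      rcases le_total (‖f.1 t‖ / C) K with h | h
      · linarith [Ψ.nonneg hx]
      · have hp : 0 < ‖f.1 t‖ / C := hK0.trans_le h
        have := hx₀ _ ((le_max_left _ _).trans h)
        rw [le_div_iff₀ hp, one_mul] at this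
        exact this.trans (le_add_of_nonneg_left hK0.le)
    rw [div_le_iff₀ hC] at hle
    linarith
  refine (lintegral_mono hpt).trans_lt ?_
  rw [lintegral_add_left measurable_const, lintegral_const,
    lintegral_const_mul' _ _ ENNReal.ofReal_ne_top]
  exact ENNReal.add_lt_top.2 ⟨ENNReal.mul_lt_top ENNReal.ofReal_lt_top (measure_lt_top _ _),
    ENNReal.mul_lt_top ENNReal.ofReal_lt_top hfin⟩

end Orlicz

/-! ### Hardy–Orlicz spaces on the unit disk -/

instance two_pi_pos_fact : Fact (0 < 2 * Real.pi) := ⟨Real.two_pi_pos⟩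

/-- The unit circle `𝕋`, parametrised by the angle `t ∈ ℝ / 2πℤ`; the point of `ℂ` with angle `t`
is `AddCircle.toCircle t = exp (i t)`. -/
abbrev Torus : Type := AddCircle (2 * Real.pi)

/-- The normalised Haar measure `m = dt / 2π` on `𝕋`. -/
abbrev haarT : Measure Torus := AddCircle.haarAddCircle

/-- The open unit disk. -/
abbrev disk : Set ℂ := Metric.ball 0 1

/-- The Hardy–Orlicz space `H^Ψ`, given by its boundary functions: the subspace of `L^Ψ(𝕋)` of the
functions whose Fourier coefficients of negative index vanish, with the norm of `L^Ψ(𝕋)`. The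
analytic function on the disk that belongs to `f` is `diskExt f`. -/
def hardyOrlicz (Ψ : OrliczFunction) : Submodule ℂ (orliczSpace Ψ haarT) where
  carrier := {f | ∀ n : ℤ, n < 0 → fourierCoeff (f.1 : Torus → ℂ) n = 0}
  zero_mem' := fun n _ => by
    have h : ((0 : orliczSpace Ψ haarT).1 : Torus → ℂ) =ᵐ[haarT] 0 := AEEqFun.coeFn_zero
    rw [fourierCoeff_congr_ae h]
    simp [fourierCoeff]
  add_mem' := by
    intro f g hf hg n hn
    have h : ((f + g).1 : Torus → ℂ) =ᵐ[haarT] f.1 + g.1 := AEEqFun.coeFn_add f.1 g.1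
    rw [fourierCoeff_congr_ae h, fourierCoeff.add (integrable_of_mem_orliczSpace f)
      (integrable_of_mem_orliczSpace g), Pi.add_apply, hf n hn, hg n hn, add_zero]
  smul_mem' := by
    intro c f hf n hn
    have h : ((c • f).1 : Torus → ℂ) =ᵐ[haarT] c • f.1 := AEEqFun.coeFn_smul c f.1
    rw [fourierCoeff_congr_ae h, fourierCoeff.const_smul, hf n hn, smul_zero]

/-- The boundary function of an element of `H^Ψ`. -/
def boundary {Ψ : OrliczFunction} (f : hardyOrlicz Ψ) : Torus → ℂ := f.1.1

/-- The analytic function `z ↦ ∑_{n ≥ 0} f̂(n) zⁿ` on the unit disk that belongs to `f ∈ H^Ψ`. -/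
def diskExt {Ψ : OrliczFunction} (f : hardyOrlicz Ψ) (z : ℂ) : ℂ :=
  ∑' n : ℕ, fourierCoeff (boundary f) (n : ℤ) * z ^ n

/-- `T` is the composition operator `C_φ : f ↦ f ∘ φ` on `H^Ψ`. -/
def IsCompositionOperator {Ψ : OrliczFunction} (φ : ℂ → ℂ)
    (T : hardyOrlicz Ψ →L[ℂ] hardyOrlicz Ψ) : Prop :=
  ∀ f : hardyOrlicz Ψ, ∀ z ∈ disk, diskExt (T f) z = diskExt f (φ z)

/-- `T : H^Ψ → H^Ψ` is order bounded into `M^Ψ(𝕋)`: there is `y ≥ 0` in `M^Ψ(𝕋)` such that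
`|T f| ≤ y` almost everywhere on `𝕋`, for every `f` in the unit ball of `H^Ψ`. -/
def IsOrderBoundedIntoMorseTransue {Ψ : OrliczFunction}
    (T : hardyOrlicz Ψ →L[ℂ] hardyOrlicz Ψ) : Prop :=
  ∃ y ∈ morseTransue Ψ haarT,
    (∀ᵐ t ∂haarT, 0 ≤ (y.1 t).re ∧ (y.1 t).im = 0) ∧
      ∀ f : hardyOrlicz Ψ, ‖f‖ ≤ 1 → ∀ᵐ t ∂haarT, ‖boundary (T f) t‖ ≤ (y.1 t).re

/-- `T : X → Y` is `p`-summing: there is `C > 0` such that, for all `x₁, …, xₙ` in `X`,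
`∑ ‖T x_k‖^p ≤ C^p sup_{‖x*‖ ≤ 1} ∑ |x*(x_k)|^p`. (The supremum is over a nonempty set, bounded
above by `∑ ‖x_k‖^p`.) -/
def IsPSumming {X Y : Type*} [NormedAddCommGroup X] [NormedSpace ℂ X]
    [NormedAddCommGroup Y] [NormedSpace ℂ Y] (p : ℝ) (T : X →L[ℂ] Y) : Prop :=
  ∃ C : ℝ, 0 < C ∧ ∀ (n : ℕ) (x : Fin n → X),
    ∑ k, ‖T (x k)‖ ^ p ≤
      C ^ p * ⨆ ξ : {ξ : StrongDual ℂ X // ‖ξ‖ ≤ 1}, ∑ k, ‖ξ.1 (x k)‖ ^ p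

/-- `h : 𝕋 → ℝ` is piecewise constant, `h = ∑_n r_n 𝟙_{B_n}` for a partition of `𝕋` into
measurable sets `B_n`, with values `r_n ∈ (0, 1)`. -/
def IsPiecewiseConstant (h : Torus → ℝ) : Prop :=
  ∃ (r : ℕ → ℝ) (B : ℕ → Set Torus), (∀ n, 0 < r n ∧ r n < 1) ∧
    (∀ n, MeasurableSet (B n)) ∧ Pairwise (Function.onFun Disjoint B) ∧ (⋃ n, B n) = univ ∧
      ∀ n, ∀ t ∈ B n, h t = r n

/-- On the unit disk, `φ` is the outer function with boundary modulus `h`, where `log h ∈ L¹(𝕋)`: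
`φ(z) = exp ∫ (u + z) / (u - z) log h(u) dm(u)`. -/
def IsOuterWithModulus (φ : ℂ → ℂ) (h : Torus → ℝ) : Prop :=
  Integrable (fun t => Real.log (h t)) haarT ∧
    ∀ z ∈ disk, φ z = Complex.exp (∫ t : Torus,
      ((AddCircle.toCircle t : ℂ) + z) / ((AddCircle.toCircle t : ℂ) - z) * (Real.log (h t) : ℂ)
        ∂haarT)

end HardyOrlicz

end

/-!
Functions of norm at most `1` in `H^Ψ` are bounded by a constant times `s` on the disk of radius
`1 - 2 / Ψ(s)`. Along a geometric sequence `s n` with `Ψ(s n)² ≤ Ψ(s (n + 1))`, the symbol has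
modulus `1 - 2 / Ψ(s n)` on an arc of length `1 / Ψ(s (2n))`. The majorant equal to `s n` on the
`n`-th arc is in `M^Ψ` because `Ψ(s (2n))` outgrows `Ψ(C s n)` for every `C`. This makes `C_φ` order
bounded, and dominated convergence along coordinatewise convergent sequences of Taylor coefficients
makes it compact.

The jump of the modulus across the `n`-th arc turns the argument of the symbol, along the middle of
the arc, by at least some `δ > 0` that does not depend on `n`. Hence, at about `Ψ(s n)` equally
spaced points, peak functions of degree about `Ψ(s n)`, whose moduli add up to at most `1`, have
compositions with the symbol that are at least `1 / 16` in modulus on a set of measure greater than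
`1 / Ψ(s (2n + 2))`, hence of norm at least `1 / (16 s (2n + 2))`. If `C_φ` were `p`-summing, then
`Ψ(s n)` would be `O(s (2n + 2) ^ p)`, but the left side grows doubly exponentially and the right
side only exponentially.
-/

noncomputable section

open MeasureTheory Set Filter Topology

namespace HardyOrlicz

/-- The point `exp (i t)` of the unit circle in `ℂ`. -/
def circlePoint (t : Torus) : ℂ := (AddCircle.toCircle t : ℂ)

@[simp]
theorem norm_circlePoint (t : Torus) : ‖circlePoint t‖ = 1 := Circle.norm_coe _

@[fun_prop]
theorem continuous_circlePoint : Continuous circlePoint :=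
  continuous_subtype_val.comp AddCircle.continuous_toCircle

theorem injective_circlePoint : Function.Injective circlePoint := fun _ _ h =>
  AddCircle.injective_toCircle Real.two_pi_pos.ne' (Subtype.ext h)

theorem circlePoint_ne_zero (t : Torus) : circlePoint t ≠ 0 := by
  simp [← norm_pos_iff]

theorem conj_circlePoint (t : Torus) : starRingEnd ℂ (circlePoint t) = (circlePoint t)⁻¹ := by
  rw [Complex.inv_def, Complex.normSq_eq_norm_sq, norm_circlePoint]
  simp

theorem circlePoint_sub_ne_zero {w : ℂ} (hw : w ∈ disk) (t : Torus) : circlePoint t - w ≠ 0 := by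
  rintro h
  rw [← sub_eq_zero.1 h, mem_ball_zero_iff, norm_circlePoint] at hw
  exact lt_irrefl _ hw

theorem fourier_natCast_apply (n : ℕ) (t : Torus) : fourier (n : ℤ) t = circlePoint t ^ n := by
  rw [fourier_apply, natCast_zsmul, AddCircle.toCircle_nsmul, Circle.coe_pow, circlePoint]

theorem norm_fourier_apply (n : ℤ) (t : Torus) : ‖fourier n t‖ = 1 := by
  rw [fourier_apply]
  exact Circle.norm_coe _

theorem norm_fourierCoeff_le (g : Torus → ℂ) (n : ℤ) : ‖fourierCoeff g n‖ ≤ ∫ t, ‖g t‖ ∂haarT := by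
  refine (norm_integral_le_integral_norm _).trans_eq ?_
  simp only [norm_smul, norm_fourier_apply, one_mul]

theorem tendsto_fourierCoeff_of_dominated {g : ℕ → Torus → ℂ} {g' : Torus → ℂ} {y : Torus → ℝ}
    (hg : ∀ j, AEStronglyMeasurable (g j) haarT) (hy : Integrable y haarT)
    (hle : ∀ j, ∀ᵐ t ∂haarT, ‖g j t‖ ≤ y t)
    (hlim : ∀ᵐ t ∂haarT, Tendsto (fun j => g j t) atTop (𝓝 (g' t))) (n : ℤ) :
    Tendsto (fun j => fourierCoeff (g j) n) atTop (𝓝 (fourierCoeff g' n)) := by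
  refine tendsto_integral_of_dominated_convergence y
    (fun j => (map_continuous (fourier (-n))).aestronglyMeasurable.smul (hg j)) hy (fun j => ?_) ?_
  · filter_upwards [hle j] with t ht
    rwa [norm_smul, norm_fourier_apply, one_mul]
  · filter_upwards [hlim] with t ht
    exact ht.const_smul _

section PowerSum

/-- The sum of the power series `∑ a n * w ^ n`. -/
def powerSum (a : ℕ → ℂ) (w : ℂ) : ℂ := ∑' n : ℕ, a n * w ^ n

variable {a : ℕ → ℂ} {M : ℝ} {w : ℂ}

theorem norm_mul_pow_le (hM : ∀ n, ‖a n‖ ≤ M) {ρ : ℝ} (hw : ‖w‖ ≤ ρ) (n : ℕ) :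
    ‖a n * w ^ n‖ ≤ M * ρ ^ n := by
  have hM0 : 0 ≤ M := (norm_nonneg _).trans (hM 0)
  rw [norm_mul, norm_pow]
  gcongr
  exact hM n

theorem hasSum_powerSum (hM : ∀ n, ‖a n‖ ≤ M) (hw : w ∈ disk) :
    HasSum (fun n => a n * w ^ n) (powerSum a w) :=
  (Summable.of_norm_bounded
    ((summable_geometric_of_lt_one (norm_nonneg w) (mem_ball_zero_iff.1 hw)).mul_left M)
    (norm_mul_pow_le hM le_rfl)).hasSum

theorem norm_powerSum_le (hM : ∀ n, ‖a n‖ ≤ M) {ρ : ℝ} (hw : ‖w‖ ≤ ρ) (hρ : ρ < 1) :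
    ‖powerSum a w‖ ≤ M * (1 - ρ)⁻¹ :=
  tsum_of_norm_bounded ((hasSum_geometric_of_lt_one ((norm_nonneg w).trans hw) hρ).mul_left M)
    (norm_mul_pow_le hM hw)

theorem tendsto_powerSum {a : ℕ → ℕ → ℂ} {a' : ℕ → ℂ} (hM : ∀ j n, ‖a j n‖ ≤ M)
    (ha : ∀ n, Tendsto (fun j => a j n) atTop (𝓝 (a' n))) (hw : w ∈ disk) :
    Tendsto (fun j => powerSum (a j) w) atTop (𝓝 (powerSum a' w)) :=
  tendsto_tsum_of_dominated_convergence
    ((summable_geometric_of_lt_one (norm_nonneg w) (mem_ball_zero_iff.1 hw)).mul_left M)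
    (fun n => (ha n).mul_const _)
    (Eventually.of_forall fun j => norm_mul_pow_le (hM j) le_rfl)

theorem differentiableOn_powerSum (hM : ∀ n, ‖a n‖ ≤ M) : DifferentiableOn ℂ (powerSum a) disk := by
  intro z hz
  obtain ⟨ρ, hzρ, hρ⟩ := exists_between (mem_ball_zero_iff.1 hz)
  have hdiff : DifferentiableOn ℂ (powerSum a) (Metric.ball 0 ρ) :=
    Complex.differentiableOn_tsum_of_summable_norm
      ((summable_geometric_of_lt_one ((norm_nonneg z).trans hzρ.le) hρ).mul_left M)
      (fun n => by fun_prop) Metric.isOpen_ball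
      fun n w hw => norm_mul_pow_le hM (mem_ball_zero_iff.1 hw).le n
  exact (hdiff.differentiableAt
    (Metric.isOpen_ball.mem_nhds (by simpa using hzρ))).differentiableWithinAt

theorem continuousAt_powerSum (hM : ∀ n, ‖a n‖ ≤ M) (hw : w ∈ disk) :
    ContinuousAt (powerSum a) w :=
  ((differentiableOn_powerSum hM).differentiableAt (Metric.isOpen_ball.mem_nhds hw)).continuousAt

theorem fourierCoeff_powerSum_circlePoint (ha : Summable fun n => ‖a n‖) (m : ℤ) :
    fourierCoeff (fun t => powerSum a (circlePoint t)) m =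
      ∑' n : ℕ, a n * (Pi.single (n : ℤ) (1 : ℂ) : ℤ → ℂ) m := by
  have hterm (n : ℕ) : ∫ t, (fourier (-m) t : ℂ) • (a n * circlePoint t ^ n) ∂haarT =
      a n * (Pi.single (n : ℤ) (1 : ℂ) : ℤ → ℂ) m := by
    rw [← fourierCoeff_fourier (T := 2 * Real.pi) (n : ℤ), ← fourierCoeff.const_mul]
    simp only [fourier_natCast_apply, fourierCoeff]
  have hnorm (n : ℕ) (t : Torus) :
      ‖(fourier (-m) t : ℂ) • (a n * circlePoint t ^ n)‖ = ‖a n‖ := by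
    rw [norm_smul, norm_fourier_apply, norm_mul, norm_pow, norm_circlePoint, one_pow, mul_one,
      one_mul]
  have hsum := hasSum_integral_of_summable_integral_norm (μ := haarT)
    (F := fun n t => (fourier (-m) t : ℂ) • (a n * circlePoint t ^ n))
    (fun n => ((map_continuous (fourier (-m))).smul
      (continuous_const.mul (continuous_circlePoint.pow n))).integrable_of_hasCompactSupport
        (HasCompactSupport.of_compactSpace _))
    (by simpa only [hnorm, integral_const, probReal_univ, one_smul] using ha)
  simp only [← hterm]
  rw [hsum.tsum_eq]
  simp only [fourierCoeff, powerSum, smul_eq_mul, tsum_mul_left]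

end PowerSum

section HasDiskExt

/-- `g ∈ L¹(𝕋)` has vanishing Fourier coefficients of negative index and `G` is the sum of the
power series `∑ ĝ(n) zⁿ` on the disk. -/
structure HasDiskExt (g : Torus → ℂ) (G : ℂ → ℂ) : Prop where
  integrable : Integrable g haarT
  fourierCoeff_eq_zero : ∀ n : ℤ, n < 0 → fourierCoeff g n = 0
  hasSum : ∀ z ∈ disk, HasSum (fun n : ℕ => fourierCoeff g (n : ℤ) * z ^ n) (G z)

variable {g g' : Torus → ℂ} {G G' : ℂ → ℂ}

theorem HasDiskExt.congr (h : HasDiskExt g G) (hg : g =ᵐ[haarT] g') (hG : EqOn G G' disk) :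
    HasDiskExt g' G' where
  integrable := h.integrable.congr hg
  fourierCoeff_eq_zero n hn := by rw [← fourierCoeff_congr_ae hg, h.fourierCoeff_eq_zero n hn]
  hasSum z hz := by simpa only [← fourierCoeff_congr_ae hg, ← hG hz] using h.hasSum z hz

theorem HasDiskExt.eq_powerSum (h : HasDiskExt g G) {z : ℂ} (hz : z ∈ disk) :
    G z = powerSum (fun n => fourierCoeff g n) z :=
  (h.hasSum z hz).tsum_eq.symm

theorem hasDiskExt_powerSum {a : ℕ → ℂ} (ha : Summable fun n => ‖a n‖) :
    HasDiskExt (fun t => powerSum a (circlePoint t)) (powerSum a) where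
  integrable := (continuous_tsum (fun n => continuous_const.mul (continuous_circlePoint.pow n)) ha
    fun n t => by simp).integrable_of_hasCompactSupport (HasCompactSupport.of_compactSpace _)
  fourierCoeff_eq_zero n hn := by
    rw [fourierCoeff_powerSum_circlePoint ha]
    refine (tsum_congr fun k => ?_).trans tsum_zero
    rw [Pi.single_eq_of_ne (by omega), mul_zero]
  hasSum z hz := by
    have hcoeff (n : ℕ) : fourierCoeff (fun t => powerSum a (circlePoint t)) n = a n := by
      rw [fourierCoeff_powerSum_circlePoint ha, tsum_eq_single n fun k hk => ?_]
      · simp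
      · rw [Pi.single_eq_of_ne (by exact_mod_cast hk.symm), mul_zero]
    simp only [hcoeff]
    exact hasSum_powerSum (fun n => ha.le_tsum n fun _ _ => norm_nonneg _) hz

theorem hasDiskExt_of_tendsto {g : ℕ → Torus → ℂ} {G : ℕ → ℂ → ℂ} {y : Torus → ℝ}
    (h : ∀ j, HasDiskExt (g j) (G j)) (hy : Integrable y haarT)
    (hle : ∀ j, ∀ᵐ t ∂haarT, ‖g j t‖ ≤ y t)
    (hg : ∀ᵐ t ∂haarT, Tendsto (fun j => g j t) atTop (𝓝 (g' t)))
    (hG : ∀ z ∈ disk, Tendsto (fun j => G j z) atTop (𝓝 (G' z))) : HasDiskExt g' G' := by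
  have hcoeff := tendsto_fourierCoeff_of_dominated
    (fun j => (h j).integrable.aestronglyMeasurable) hy hle hg
  refine ⟨?_, fun n hn => ?_, fun z hz => ?_⟩
  · refine hy.mono' (aestronglyMeasurable_of_tendsto_ae atTop
      (fun j => (h j).integrable.aestronglyMeasurable) hg) ?_
    filter_upwards [hg, ae_all_iff.2 hle] with t ht hle
    exact le_of_tendsto ht.norm (Eventually.of_forall hle)
  · refine tendsto_nhds_unique (hcoeff n) ?_
    simp only [(h _).fourierCoeff_eq_zero n hn, tendsto_const_nhds]
  · have hbound (j : ℕ) (n : ℕ) : ‖fourierCoeff (g j) n‖ ≤ ∫ t, y t ∂haarT :=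
      (norm_fourierCoeff_le _ _).trans (integral_mono_ae (h j).integrable.norm hy (hle j))
    have hlim := tendsto_powerSum hbound (fun n => hcoeff n) hz
    simp only [← (h _).eq_powerSum hz] at hlim
    rw [tendsto_nhds_unique (hG z hz) hlim]
    exact hasSum_powerSum (fun n => norm_fourierCoeff_le _ _) hz

/-- A sequence of radii increasing to `1`, along which radial limits are taken. -/
def radius (j : ℕ) : ℝ := 1 - 1 / ((j : ℝ) + 1)

theorem radius_nonneg (j : ℕ) : 0 ≤ radius j := by
  rw [radius, sub_nonneg, div_le_one (by positivity)]
  exact le_add_of_nonneg_left j.cast_nonneg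

theorem radius_lt_one (j : ℕ) : radius j < 1 :=
  sub_lt_self _ (by positivity)

theorem tendsto_radius : Tendsto radius atTop (𝓝 1) := by
  unfold radius
  simpa only [sub_zero] using (tendsto_one_div_add_atTop_nhds_zero_nat (𝕜 := ℝ)).const_sub (1 : ℝ)

theorem norm_radius_mul (j : ℕ) (z : ℂ) : ‖(radius j : ℂ) * z‖ = radius j * ‖z‖ := by
  rw [norm_mul, Complex.norm_real, Real.norm_of_nonneg (radius_nonneg j)]

theorem radius_mul_mem_disk (j : ℕ) {z : ℂ} (hz : ‖z‖ ≤ 1) : (radius j : ℂ) * z ∈ disk := by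
  rw [mem_ball_zero_iff, norm_radius_mul]
  exact (mul_le_of_le_one_right (radius_nonneg j) hz).trans_lt (radius_lt_one j)

theorem tendsto_radius_mul (z : ℂ) : Tendsto (fun j => (radius j : ℂ) * z) atTop (𝓝 z) := by
  simpa using ((Complex.continuous_ofReal.tendsto 1).comp tendsto_radius).mul_const z

theorem hasDiskExt_dilate (hG : DifferentiableOn ℂ G disk) {ρ : ℝ} (h0 : 0 ≤ ρ) (h1 : ρ < 1) :
    HasDiskExt (fun t => G (ρ * circlePoint t)) (fun z => G (ρ * z)) := by
  set a : ℕ → ℂ := fun n => (n.factorial : ℂ)⁻¹ * iteratedDeriv n G 0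
  have hmem {z : ℂ} (hz : ‖z‖ ≤ 1) : (ρ : ℂ) * z ∈ disk := by
    rw [mem_ball_zero_iff, norm_mul, Complex.norm_real, Real.norm_of_nonneg h0]
    exact (mul_le_of_le_one_right h0 hz).trans_lt h1
  have htaylor {z : ℂ} (hz : ‖z‖ ≤ 1) : HasSum (fun n => a n * ρ ^ n * z ^ n) (G (ρ * z)) := by
    have := Complex.hasSum_taylorSeries_on_ball hG (hmem hz)
    simp only [sub_zero, smul_eq_mul] at this
    exact this.congr_fun fun n => by ring
  have hsum : Summable fun n => ‖a n * (ρ : ℂ) ^ n‖ := by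
    simpa using (htaylor (z := 1) (by simp)).summable.norm
  exact (hasDiskExt_powerSum hsum).congr
    (Eventually.of_forall fun t => (htaylor (norm_circlePoint t).le).tsum_eq)
    fun z hz => (htaylor (mem_ball_zero_iff.1 hz).le).tsum_eq

theorem hasDiskExt_of_bounded (hG : DifferentiableOn ℂ G disk) {M : ℝ}
    (hM : ∀ z ∈ disk, ‖G z‖ ≤ M)
    (hg : ∀ᵐ t ∂haarT, Tendsto (fun j => G (radius j * circlePoint t)) atTop (𝓝 (g t))) :
    HasDiskExt g G :=
  hasDiskExt_of_tendsto (fun j => hasDiskExt_dilate hG (radius_nonneg j) (radius_lt_one j))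
    (integrable_const M)
    (fun j => Eventually.of_forall fun t => hM _ (radius_mul_mem_disk j (norm_circlePoint t).le))
    hg fun z hz =>
      ((hG.differentiableAt (Metric.isOpen_ball.mem_nhds hz)).continuousAt.tendsto).comp
        (tendsto_radius_mul z)

theorem hasDiskExt_one : HasDiskExt (fun _ => 1) (fun _ => 1) :=
  hasDiskExt_of_bounded (differentiableOn_const _) (M := 1) (by simp) (by simp)

end HasDiskExt

section GeometricKernel

variable {X : Type*} [MeasurableSpace X] {μ : Measure X} {e g : X → ℂ} {r : ℝ}

theorem integrable_inv_one_sub_mul (he : AEStronglyMeasurable e μ) (hg : Integrable g μ)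
    (hr : r < 1) (her : ∀ x, ‖e x‖ ≤ r) : Integrable (fun x => (1 - e x)⁻¹ * g x) μ := by
  refine hg.bdd_mul (aestronglyMeasurable_const.sub he).inv₀ (c := (1 - r)⁻¹)
    (Eventually.of_forall fun x => ?_)
  rw [norm_inv]
  refine inv_anti₀ (sub_pos.2 hr) ?_
  linarith [norm_sub_norm_le (1 : ℂ) (e x), her x, norm_one (α := ℂ)]

theorem hasSum_integral_pow_mul (he : AEStronglyMeasurable e μ) (hg : Integrable g μ)
    (hr : r < 1) (her : ∀ x, ‖e x‖ ≤ r) :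
    HasSum (fun n : ℕ => ∫ x, e x ^ n * g x ∂μ) (∫ x, (1 - e x)⁻¹ * g x ∂μ) := by
  have hgeo {x : X} : Summable fun n => r ^ n * ‖g x‖ :=
    (summable_geometric_of_lt_one ((norm_nonneg _).trans (her x)) hr).mul_right _
  refine MeasureTheory.hasSum_integral_of_dominated_convergence (fun n x => r ^ n * ‖g x‖)
    (fun n => (he.pow n).mul hg.aestronglyMeasurable)
    (fun n => Eventually.of_forall fun x => ?_) (Eventually.of_forall fun x => hgeo) ?_
    (Eventually.of_forall fun x =>
      (hasSum_geometric_of_norm_lt_one ((her x).trans_lt hr)).mul_right _)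
  · rw [norm_mul, norm_pow]
    gcongr
    exact her x
  · simp only [tsum_mul_right]
    exact hg.norm.const_mul _

end GeometricKernel

section Kernels

variable {g : Torus → ℂ} {G : ℂ → ℂ} {w : ℂ}

theorem continuous_mul_conj_circlePoint (w : ℂ) :
    Continuous fun t => w * starRingEnd ℂ (circlePoint t) :=
  continuous_const.mul (Complex.continuous_conj.comp continuous_circlePoint)

theorem integrable_inv_one_sub_mul_conj (hg : Integrable g haarT) (hw : w ∈ disk) :
    Integrable (fun t => (1 - w * starRingEnd ℂ (circlePoint t))⁻¹ * g t) haarT :=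
  integrable_inv_one_sub_mul (continuous_mul_conj_circlePoint w).aestronglyMeasurable hg
    (mem_ball_zero_iff.1 hw) (by simp)

theorem integral_inv_one_sub_mul_conj (hg : Integrable g haarT) (hw : w ∈ disk) :
    ∫ t, (1 - w * starRingEnd ℂ (circlePoint t))⁻¹ * g t ∂haarT =
      powerSum (fun n => fourierCoeff g n) w := by
  rw [powerSum, ← (hasSum_integral_pow_mul (continuous_mul_conj_circlePoint w).aestronglyMeasurable
    hg (mem_ball_zero_iff.1 hw) (by simp)).tsum_eq]
  refine tsum_congr fun n => ?_
  simp only [fourierCoeff, fourier_neg, fourier_natCast_apply, map_pow, smul_eq_mul]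
  simp only [mul_pow, mul_assoc, integral_const_mul]
  exact mul_comm _ _

theorem integrable_inv_one_sub_conj_mul (hg : Integrable g haarT) (hw : w ∈ disk) :
    Integrable (fun t => (1 - starRingEnd ℂ w * circlePoint t)⁻¹ * g t) haarT :=
  integrable_inv_one_sub_mul (by fun_prop) hg (mem_ball_zero_iff.1 hw) (by simp)

theorem integral_inv_one_sub_conj_mul (hg : Integrable g haarT) (hw : w ∈ disk) :
    ∫ t, (1 - starRingEnd ℂ w * circlePoint t)⁻¹ * g t ∂haarT =
      powerSum (fun n => fourierCoeff g (-n)) (starRingEnd ℂ w) := by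
  rw [powerSum, ← (hasSum_integral_pow_mul (e := fun t => starRingEnd ℂ w * circlePoint t)
    (by fun_prop) hg (mem_ball_zero_iff.1 hw) (by simp)).tsum_eq]
  refine tsum_congr fun n => ?_
  simp only [fourierCoeff, neg_neg, fourier_natCast_apply, smul_eq_mul]
  simp only [mul_pow, mul_assoc, integral_const_mul]
  exact mul_comm _ _

theorem add_div_sub_circlePoint (hw : w ∈ disk) (t : Torus) :
    (circlePoint t + w) / (circlePoint t - w) =
      2 * (1 - w * starRingEnd ℂ (circlePoint t))⁻¹ - 1 := by
  have h := circlePoint_sub_ne_zero hw t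
  have h0 := circlePoint_ne_zero t
  rw [conj_circlePoint]
  field_simp
  ring

theorem poissonKernel_circlePoint (hw : w ∈ disk) (t : Torus) :
    (poissonKernel 0 w (circlePoint t) : ℂ) = (1 - w * starRingEnd ℂ (circlePoint t))⁻¹ +
      (1 - starRingEnd ℂ w * circlePoint t)⁻¹ - 1 := by
  rw [poissonKernel_eq_re_herglotzRieszKernel, Function.comp_apply, herglotzRieszKernel, sub_zero,
    sub_zero, add_div_sub_circlePoint hw, Complex.re_eq_add_conj]
  simp only [map_sub, map_mul, map_inv₀, map_one, map_ofNat, Complex.conj_conj]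
  ring

theorem HasDiskExt.eq_integral_poissonKernel (h : HasDiskExt g G) (hw : w ∈ disk) :
    G w = ∫ t, (poissonKernel 0 w (circlePoint t) : ℂ) * g t ∂haarT := by
  have hcoeff : powerSum (fun n => fourierCoeff g (-n)) (starRingEnd ℂ w) = fourierCoeff g 0 := by
    rw [powerSum, tsum_eq_single 0 fun n hn => ?_]
    · simp
    · rw [h.fourierCoeff_eq_zero _ (by omega), zero_mul]
  have hmean : ∫ t, g t ∂haarT = fourierCoeff g 0 := by simp [fourierCoeff]
  have hcauchy := integrable_inv_one_sub_mul_conj h.integrable hw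
  have hconj := integrable_inv_one_sub_conj_mul h.integrable hw
  simp only [poissonKernel_circlePoint hw, sub_mul, add_mul, one_mul]
  rw [integral_sub (hcauchy.fun_add hconj) h.integrable, integral_add hcauchy hconj,
    integral_inv_one_sub_mul_conj h.integrable hw, integral_inv_one_sub_conj_mul h.integrable hw,
    hcoeff, hmean, add_sub_cancel_right, h.eq_powerSum hw]

theorem continuous_poissonKernel_circlePoint (hw : w ∈ disk) :
    Continuous fun t => poissonKernel 0 w (circlePoint t) := by
  simp only [poissonKernel_def, sub_zero]
  exact (by fun_prop : Continuous fun t => ‖circlePoint t‖ ^ 2 - ‖w‖ ^ 2).div (by fun_prop)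
    fun t => pow_ne_zero _ (norm_ne_zero_iff.2 (circlePoint_sub_ne_zero hw t))

theorem integral_poissonKernel (hw : w ∈ disk) :
    ∫ t, poissonKernel 0 w (circlePoint t) ∂haarT = 1 := by
  have h := hasDiskExt_one.eq_integral_poissonKernel hw
  simp only [mul_one, integral_complex_ofReal] at h
  exact_mod_cast h.symm

theorem poissonKernel_circlePoint_le (hw : w ∈ disk) (t : Torus) :
    poissonKernel 0 w (circlePoint t) ≤ (1 + ‖w‖) / (1 - ‖w‖) := by
  rw [poissonKernel_eq_re_herglotzRieszKernel]
  simpa [herglotzRieszKernel] using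
    re_herglotzRieszKernel_le (c := 0) (R := 1) (z := circlePoint t) (by simp) hw

theorem poissonKernel_circlePoint_pos (hw : w ∈ disk) (t : Torus) :
    0 < poissonKernel 0 w (circlePoint t) := by
  have hw' := mem_ball_zero_iff.1 hw
  rw [poissonKernel_def, sub_zero, sub_zero, norm_circlePoint]
  have := circlePoint_sub_ne_zero hw t
  have : ‖w‖ ^ 2 < 1 := by nlinarith [norm_nonneg w]
  exact div_pos (by linarith) (by positivity)

end Kernels

namespace OrliczFunction

variable (Ψ : OrliczFunction)

theorem mono {x y : ℝ} (hx : 0 ≤ x) (hxy : x ≤ y) : Ψ x ≤ Ψ y :=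
  Ψ.monotoneOn (mem_Ici.2 hx) (mem_Ici.2 (hx.trans hxy)) hxy

theorem mul_le_mul_add {k s x : ℝ} (hk : 0 ≤ k) (hs : 0 ≤ s) (hks : k ≤ Ψ s) (hx : 0 ≤ x) :
    k * x ≤ s * (k + Ψ x) := by
  have hΨx := Ψ.nonneg hx
  rcases le_total x s with hxs | hsx
  · nlinarith [mul_nonneg hs hΨx, mul_le_mul_of_nonneg_left hxs hk]
  rcases hx.eq_or_lt with rfl | hx0
  · nlinarith [mul_nonneg hs hk, mul_nonneg hs hΨx]
  have hconv : Ψ s ≤ s / x * Ψ x := by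
    simpa [div_mul_cancel₀ _ hx0.ne'] using
      Ψ.mul_le hx (a := s / x) (by positivity) ((div_le_one hx0).2 hsx)
  calc k * x ≤ s / x * Ψ x * x := by gcongr; exact hks.trans hconv
    _ = s * Ψ x := by field_simp
    _ ≤ s * (k + Ψ x) := by gcongr; linarith

theorem tendsto_atTop : Tendsto Ψ atTop atTop := by
  refine tendsto_atTop_mono' atTop ?_ tendsto_id
  filter_upwards [Ψ.tendsto_div_atTop.eventually_ge_atTop 1, eventually_gt_atTop 0] with x hx hx0
  rwa [le_div_iff₀ hx0, one_mul] at hx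

end OrliczFunction

section LuxemburgNorm

variable {Ω : Type*} [MeasurableSpace Ω] {Ψ : OrliczFunction} {μ : Measure Ω}

theorem modular_mono {f g : Ω → ℂ} {C D : ℝ} (hC : 0 < C)
    (h : ∀ᵐ t ∂μ, ‖f t‖ / C ≤ ‖g t‖ / D) : modular Ψ μ f C ≤ modular Ψ μ g D := by
  refine lintegral_mono_ae ?_
  filter_upwards [h] with t ht
  exact ENNReal.ofReal_le_ofReal (Ψ.mono (by positivity) ht)

theorem modular_le_one_of_norm_lt {f : orliczSpace Ψ μ} {C : ℝ} (h : ‖f‖ < C) :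
    modular Ψ μ f.1 C ≤ 1 := by
  obtain ⟨a, ⟨ha, hfa⟩, haC⟩ := exists_lt_of_csInf_lt (exists_modular_le_one f) h
  refine (modular_mono (ha.trans haC) (Eventually.of_forall fun t => ?_)).trans hfa
  gcongr

theorem norm_le_of_modular_le_one {f : orliczSpace Ψ μ} {C : ℝ} (hC : 0 < C)
    (h : modular Ψ μ f.1 C ≤ 1) : ‖f‖ ≤ C :=
  csInf_le (luxemburgNorm_set_bddBelow _) ⟨hC, h⟩

theorem norm_le_norm_of_ae_le {f g : orliczSpace Ψ μ} (h : ∀ᵐ t ∂μ, ‖f.1 t‖ ≤ ‖g.1 t‖) :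
    ‖f‖ ≤ ‖g‖ := by
  refine le_of_forall_gt_imp_ge_of_dense fun C hC => ?_
  have hC0 : 0 < C := (norm_nonneg g).trans_lt hC
  refine norm_le_of_modular_le_one hC0 ((modular_mono hC0 ?_).trans (modular_le_one_of_norm_lt hC))
  filter_upwards [h] with t ht
  gcongr

theorem div_le_norm_of_le_on {f : orliczSpace Ψ μ} {S : Set Ω} {b x : ℝ} (hb : 0 < b) (hx : 0 < x)
    (hS : ENNReal.ofReal (1 / Ψ x) < μ S) (hf : ∀ᵐ t ∂μ, t ∈ S → b ≤ ‖f.1 t‖) :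
    b / x ≤ ‖f‖ := by
  by_contra! hlt
  have hΨx := Ψ.pos hx
  have hsub : μ S ≤ μ {t | ENNReal.ofReal (Ψ x) ≤ ENNReal.ofReal (Ψ (‖f.1 t‖ / (b / x)))} := by
    refine measure_mono_ae ?_
    filter_upwards [hf] with t ht htS
    refine ENNReal.ofReal_le_ofReal (Ψ.mono hx.le ?_)
    rw [le_div_iff₀ (by positivity), mul_div_cancel₀ _ hx.ne']
    exact ht htS
  refine lt_irrefl (1 : ENNReal) ?_
  calc (1 : ENNReal) = ENNReal.ofReal (Ψ x) * ENNReal.ofReal (1 / Ψ x) := by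
        rw [← ENNReal.ofReal_mul hΨx.le, mul_one_div_cancel hΨx.ne', ENNReal.ofReal_one]
    _ < ENNReal.ofReal (Ψ x) * μ S :=
        ENNReal.mul_lt_mul_right (by simpa using hΨx) ENNReal.ofReal_ne_top hS
    _ ≤ ENNReal.ofReal (Ψ x) *
          μ {t | ENNReal.ofReal (Ψ x) ≤ ENNReal.ofReal (Ψ (‖f.1 t‖ / (b / x)))} := by gcongr
    _ ≤ modular Ψ μ f.1 (b / x) := mul_meas_ge_le_lintegral₀
        (aemeasurable_modular f.1.aestronglyMeasurable (by positivity)) _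
    _ ≤ 1 := modular_le_one_of_norm_lt hlt

theorem integrable_orlicz_comp {f : Ω → ℂ} (hf : AEStronglyMeasurable f μ) {C : ℝ} (hC : 0 < C)
    (h : modular Ψ μ f C ≠ ⊤) : Integrable (fun t => Ψ (‖f t‖ / C)) μ := by
  refine (integrable_toReal_of_lintegral_ne_top (aemeasurable_modular hf hC) h).congr
    (Eventually.of_forall fun t => ?_)
  exact ENNReal.toReal_ofReal (Ψ.nonneg (by positivity))

theorem integral_mul_norm_le {k : Ω → ℝ} {s : ℝ} (hk : Integrable k μ) (hs : 0 ≤ s)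
    (hk0 : ∀ t, 0 ≤ k t) (hks : ∀ t, k t ≤ Ψ s) (f : orliczSpace Ψ μ) :
    ∫ t, k t * ‖f.1 t‖ ∂μ ≤ s * (1 + ∫ t, k t ∂μ) * ‖f‖ := by
  have hlim : Tendsto (fun C => s * (1 + ∫ t, k t ∂μ) * C) (𝓝[>] ‖f‖)
      (𝓝 (s * (1 + ∫ t, k t ∂μ) * ‖f‖)) :=
    tendsto_const_nhds.mul (tendsto_id.mono_left nhdsWithin_le_nhds)
  refine ge_of_tendsto hlim (eventually_mem_nhdsWithin.mono ?_)
  intro C hC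
  have hC0 : 0 < C := (norm_nonneg f).trans_lt hC
  have hmod := modular_le_one_of_norm_lt hC
  have hΨ := integrable_orlicz_comp f.1.aestronglyMeasurable hC0
    (hmod.trans_lt ENNReal.one_lt_top).ne
  have hΨ1 : ∫ t, Ψ (‖f.1 t‖ / C) ∂μ ≤ 1 := by
    rw [integral_eq_lintegral_of_nonneg_ae
      (Eventually.of_forall fun t => Ψ.nonneg (by positivity)) hΨ.aestronglyMeasurable]
    exact ENNReal.toReal_le_of_le_ofReal zero_le_one (by simpa [modular] using hmod)
  calc ∫ t, k t * ‖f.1 t‖ ∂μ ≤ ∫ t, C * (s * (k t + Ψ (‖f.1 t‖ / C))) ∂μ := by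
        refine integral_mono_of_nonneg (Eventually.of_forall fun t => by have := hk0 t; positivity)
          (((hk.add hΨ).const_mul s).const_mul C) (Eventually.of_forall fun t => ?_)
        calc k t * ‖f.1 t‖ = C * (k t * (‖f.1 t‖ / C)) := by field_simp
          _ ≤ C * (s * (k t + Ψ (‖f.1 t‖ / C))) := mul_le_mul_of_nonneg_left
              (Ψ.mul_le_mul_add (hk0 t) hs (hks t) (by positivity)) hC0.le
    _ = C * (s * (∫ t, k t ∂μ + ∫ t, Ψ (‖f.1 t‖ / C) ∂μ)) := by
        rw [integral_const_mul, integral_const_mul, integral_add hk hΨ]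
    _ ≤ C * (s * (∫ t, k t ∂μ + 1)) := by gcongr
    _ = s * (1 + ∫ t, k t ∂μ) * C := by ring

end LuxemburgNorm

section PointEvaluation

variable {Ψ : OrliczFunction}

theorem mem_disk_of_norm_le {s : ℝ} (hs : 0 < s) {w : ℂ} (hw : ‖w‖ ≤ 1 - 2 / Ψ s) : w ∈ disk := by
  rw [mem_ball_zero_iff]
  exact hw.trans_lt (sub_lt_self _ (div_pos two_pos (Ψ.pos hs)))

theorem integrable_boundary (f : hardyOrlicz Ψ) : Integrable (boundary f) haarT :=
  integrable_of_mem_orliczSpace f.1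

theorem hasDiskExt_boundary (f : hardyOrlicz Ψ) : HasDiskExt (boundary f) (diskExt f) where
  integrable := integrable_boundary f
  fourierCoeff_eq_zero := f.2
  hasSum _ hz := hasSum_powerSum (fun n => norm_fourierCoeff_le (boundary f) n) hz

theorem poissonKernel_circlePoint_le_orlicz {s : ℝ} (hs : 0 < s) {w : ℂ}
    (hw : ‖w‖ ≤ 1 - 2 / Ψ s) (t : Torus) : poissonKernel 0 w (circlePoint t) ≤ Ψ s := by
  have hwd := mem_disk_of_norm_le hs hw
  have hw1 := mem_ball_zero_iff.1 hwd
  have hΨs := Ψ.pos hs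
  calc poissonKernel 0 w (circlePoint t) ≤ (1 + ‖w‖) / (1 - ‖w‖) :=
        poissonKernel_circlePoint_le hwd t
    _ ≤ 2 / (2 / Ψ s) := by gcongr <;> linarith
    _ = Ψ s := by field_simp

theorem norm_diskExt_le (f : hardyOrlicz Ψ) {s : ℝ} (hs : 0 < s) {w : ℂ}
    (hw : ‖w‖ ≤ 1 - 2 / Ψ s) : ‖diskExt f w‖ ≤ 2 * s * ‖f‖ := by
  have hwd := mem_disk_of_norm_le hs hw
  have hpos := poissonKernel_circlePoint_pos hwd
  have hint : Integrable (fun t => poissonKernel 0 w (circlePoint t)) haarT :=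
    (continuous_poissonKernel_circlePoint hwd).integrable_of_hasCompactSupport
      (HasCompactSupport.of_compactSpace _)
  calc ‖diskExt f w‖ ≤ ∫ t, ‖(poissonKernel 0 w (circlePoint t) : ℂ) * boundary f t‖ ∂haarT := by
        rw [(hasDiskExt_boundary f).eq_integral_poissonKernel hwd]
        exact norm_integral_le_integral_norm _
    _ = ∫ t, poissonKernel 0 w (circlePoint t) * ‖boundary f t‖ ∂haarT := by
        simp only [norm_mul, Complex.norm_real, Real.norm_of_nonneg (hpos _).le]
    _ ≤ s * (1 + ∫ t, poissonKernel 0 w (circlePoint t) ∂haarT) * ‖f‖ :=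
        integral_mul_norm_le hint hs.le (fun t => (hpos t).le)
          (poissonKernel_circlePoint_le_orlicz hs hw) f.1
    _ = 2 * s * ‖f‖ := by rw [integral_poissonKernel hwd]; ring

theorem norm_fourierCoeff_boundary_le (f : hardyOrlicz Ψ) {s : ℝ} (hs : 0 ≤ s) (hΨs : 1 ≤ Ψ s)
    (n : ℤ) : ‖fourierCoeff (boundary f) n‖ ≤ 2 * s * ‖f‖ := by
  have h := integral_mul_norm_le (integrable_const 1) hs (fun _ => zero_le_one)
    (fun _ => hΨs) f.1
  simp only [one_mul, integral_const, probReal_univ, one_smul] at h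
  calc ‖fourierCoeff (boundary f) n‖ ≤ s * (1 + 1) * ‖f‖ := (norm_fourierCoeff_le _ n).trans h
    _ = 2 * s * ‖f‖ := by ring

end PointEvaluation

/-- The Herglotz integral `∫ (u + z) / (u - z) g(u) dm(u)` of `g`. -/
def herglotz (g : Torus → ℝ) (z : ℂ) : ℂ :=
  ∫ t : Torus, (circlePoint t + z) / (circlePoint t - z) * (g t : ℂ) ∂haarT

/-- The boundary values of `herglotz g` at the points near which `g` is constant; subtracting
`g t₀` makes the integral converge there. -/
def herglotzBoundary (g : Torus → ℝ) (t₀ : Torus) : ℂ :=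
  (g t₀ : ℂ) + ∫ t : Torus, (circlePoint t + circlePoint t₀) / (circlePoint t - circlePoint t₀) *
    ((g t - g t₀ : ℝ) : ℂ) ∂haarT

section Herglotz

variable {g : Torus → ℝ} {z : ℂ}

theorem integrable_herglotz (hg : Integrable g haarT) (hz : z ∈ disk) :
    Integrable (fun t : Torus => (circlePoint t + z) / (circlePoint t - z) * (g t : ℂ)) haarT := by
  simp only [add_div_sub_circlePoint hz, sub_mul, one_mul, mul_assoc]
  exact ((integrable_inv_one_sub_mul_conj hg.ofReal hz).const_mul 2).sub hg.ofReal

theorem herglotz_eq_powerSum (hg : Integrable g haarT) (hz : z ∈ disk) :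
    herglotz g z = 2 * powerSum (fun n => fourierCoeff (fun t => (g t : ℂ)) n) z -
      ∫ t, (g t : ℂ) ∂haarT := by
  simp only [herglotz, add_div_sub_circlePoint hz, sub_mul, one_mul, mul_assoc]
  have hgC : Integrable (fun t => (g t : ℂ)) haarT := hg.ofReal
  rw [integral_sub ((integrable_inv_one_sub_mul_conj hgC hz).const_mul 2) hgC,
    integral_const_mul, integral_inv_one_sub_mul_conj hgC hz]

theorem differentiableOn_herglotz (hg : Integrable g haarT) :
    DifferentiableOn ℂ (herglotz g) disk :=
  (((differentiableOn_powerSum fun n => norm_fourierCoeff_le (fun t => (g t : ℂ)) n).const_mul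
    2).sub_const _).congr fun _ hz => herglotz_eq_powerSum hg hz

theorem re_herglotz (hg : Integrable g haarT) (hz : z ∈ disk) :
    (herglotz g z).re = ∫ t, poissonKernel 0 z (circlePoint t) * g t ∂haarT := by
  have h := integral_re (𝕜 := ℂ) (integrable_herglotz hg hz)
  simp only [RCLike.re_to_complex, Complex.re_mul_ofReal] at h
  simp only [herglotz, poissonKernel_eq_re_herglotzRieszKernel, herglotzRieszKernel, sub_zero,
    Function.comp_apply, h]

theorem re_herglotz_neg (hg : Integrable g haarT) (hneg : ∀ t, g t < 0) (hz : z ∈ disk) :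
    (herglotz g z).re < 0 := by
  have hpos (t : Torus) : 0 < -(poissonKernel 0 z (circlePoint t) * g t) :=
    neg_pos.2 (mul_neg_of_pos_of_neg (poissonKernel_circlePoint_pos hz t) (hneg t))
  have hint : Integrable (fun t => poissonKernel 0 z (circlePoint t) * g t) haarT :=
    hg.bdd_mul (continuous_poissonKernel_circlePoint hz).aestronglyMeasurable
      (Eventually.of_forall fun t => by
        rw [Real.norm_of_nonneg (poissonKernel_circlePoint_pos hz t).le]
        exact poissonKernel_circlePoint_le hz t)
  rw [re_herglotz hg hz, ← neg_pos, ← integral_neg,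
    integral_pos_iff_support_of_nonneg (fun t => (hpos t).le) hint.neg]
  simp [Function.support_eq_univ fun t => (hpos t).ne']

theorem integral_add_div_sub_circlePoint (hz : z ∈ disk) :
    ∫ t : Torus, (circlePoint t + z) / (circlePoint t - z) ∂haarT = 1 := by
  have h := herglotz_eq_powerSum (g := fun _ => 1) (integrable_const 1) hz
  simp only [herglotz, Complex.ofReal_one, mul_one, integral_const, probReal_univ, one_smul,
    ← hasDiskExt_one.eq_powerSum hz] at h
  rw [h]
  norm_num

theorem herglotz_eq_add (hg : Integrable g haarT) (hz : z ∈ disk) (c : ℝ) :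
    herglotz g z = c + ∫ t : Torus, (circlePoint t + z) / (circlePoint t - z) *
      ((g t - c : ℝ) : ℂ) ∂haarT := by
  have hsplit := integral_add (integrable_herglotz (integrable_const c) hz)
    (integrable_herglotz (hg.sub (integrable_const c)) hz)
  rw [integral_mul_const, integral_add_div_sub_circlePoint hz, one_mul] at hsplit
  refine Eq.trans ?_ hsplit
  rw [herglotz]
  congr 1 with t
  rw [Pi.sub_apply, ← mul_add, ← Complex.ofReal_add, add_sub_cancel]

theorem exists_pos_forall_notMem_le_norm_circlePoint_sub {t₀ : Torus} {U : Set Torus}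
    (hU : U ∈ 𝓝 t₀) : ∃ δ > 0, ∀ t ∉ U, δ ≤ ‖circlePoint t - circlePoint t₀‖ := by
  obtain ⟨V, hVU, hV, htV⟩ := mem_nhds_iff.1 hU
  rcases Vᶜ.eq_empty_or_nonempty with hempty | hne
  · exact ⟨1, one_pos, fun t ht => absurd (hVU (compl_empty_iff.1 hempty ▸ mem_univ t)) ht⟩
  · obtain ⟨t, ht, hmin⟩ := hV.isClosed_compl.isCompact.exists_isMinOn hne
      (continuous_circlePoint.sub continuous_const).norm.continuousOn
    exact ⟨_, norm_pos_iff.2 (sub_ne_zero.2 fun h => ht (by rwa [injective_circlePoint h])),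
      fun s hs => hmin fun hsV => hs (hVU hsV)⟩

theorem norm_add_div_sub_circlePoint_le {t t₀ : Torus} {δ : ℝ} (hδ : 0 < δ)
    (ht : δ ≤ ‖circlePoint t - circlePoint t₀‖) (hz : ‖z‖ ≤ 1)
    (hzt₀ : ‖z - circlePoint t₀‖ ≤ δ / 2) :
    ‖(circlePoint t + z) / (circlePoint t - z)‖ ≤ 4 / δ := by
  have hden : δ / 2 ≤ ‖circlePoint t - z‖ := by
    linarith [norm_sub_le_norm_sub_add_norm_sub (circlePoint t) z (circlePoint t₀)]
  have hnum : ‖circlePoint t + z‖ ≤ 2 := by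
    linarith [norm_add_le (circlePoint t) z, norm_circlePoint t]
  calc ‖(circlePoint t + z) / (circlePoint t - z)‖ ≤ 2 / (δ / 2) := by rw [norm_div]; gcongr
    _ = 4 / δ := by ring

theorem tendsto_herglotz (hg : Integrable g haarT) {t₀ : Torus} (ht₀ : ∀ᶠ t in 𝓝 t₀, g t = g t₀) :
    Tendsto (herglotz g) (𝓝[disk] circlePoint t₀) (𝓝 (herglotzBoundary g t₀)) := by
  obtain ⟨δ, hδ, hfar⟩ := exists_pos_forall_notMem_le_norm_circlePoint_sub ht₀
  have hdiff : Integrable (fun t => g t - g t₀) haarT := hg.sub (integrable_const _)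
  refine Tendsto.congr' (f₁ := fun z => (g t₀ : ℂ) + ∫ t : Torus,
    (circlePoint t + z) / (circlePoint t - z) * ((g t - g t₀ : ℝ) : ℂ) ∂haarT)
    (eventually_mem_nhdsWithin.mono fun z hz => (herglotz_eq_add hg hz _).symm) ?_
  refine tendsto_const_nhds.add (tendsto_integral_filter_of_dominated_convergence
    (fun t => 4 / δ * |g t - g t₀|)
    (eventually_mem_nhdsWithin.mono fun z hz => (integrable_herglotz hdiff hz).aestronglyMeasurable)
    ?_ (hdiff.abs.const_mul _) (Eventually.of_forall fun t => ?_))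
  · filter_upwards [self_mem_nhdsWithin,
      mem_nhdsWithin_of_mem_nhds (Metric.closedBall_mem_nhds _ (half_pos hδ))] with z hz hzt₀
    refine Eventually.of_forall fun t => ?_
    rw [norm_mul, Complex.norm_real, Real.norm_eq_abs]
    by_cases ht : g t = g t₀
    · simp [ht]
    · gcongr
      exact norm_add_div_sub_circlePoint_le hδ (hfar t ht) (mem_ball_zero_iff.1 hz).le
        (by simpa [dist_eq_norm] using hzt₀)
  · by_cases ht : g t = g t₀
    · simpa [ht] using tendsto_const_nhds
    · refine ContinuousAt.continuousWithinAt ?_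
      have : circlePoint t - circlePoint t₀ ≠ 0 := norm_pos_iff.1 (hδ.trans_le (hfar t ht))
      fun_prop (disch := assumption)

theorem re_add_div_sub_circlePoint (t t₀ : Torus) :
    ((circlePoint t + circlePoint t₀) / (circlePoint t - circlePoint t₀)).re = 0 := by
  have h := congrFun (poissonKernel_eq_re_herglotzRieszKernel (c := 0) (w := circlePoint t₀))
    (circlePoint t)
  simp only [poissonKernel, herglotzRieszKernel, Function.comp_apply, sub_zero,
    norm_circlePoint, sub_self, zero_div] at h
  exact h.symm

theorem re_herglotzBoundary (g : Torus → ℝ) (t₀ : Torus) :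
    (herglotzBoundary g t₀).re = g t₀ := by
  rw [herglotzBoundary, Complex.add_re, Complex.ofReal_re, add_eq_left]
  by_cases hint : Integrable (fun t : Torus => (circlePoint t + circlePoint t₀) /
    (circlePoint t - circlePoint t₀) * ((g t - g t₀ : ℝ) : ℂ)) haarT
  · have h := integral_re (𝕜 := ℂ) hint
    simp only [RCLike.re_to_complex, Complex.re_mul_ofReal, re_add_div_sub_circlePoint, zero_mul,
      integral_zero] at h
    exact h.symm
  · rw [integral_undef hint, Complex.zero_re]

end Herglotz

section DominatedConvergence

variable {Ω : Type*} [MeasurableSpace Ω] {Ψ : OrliczFunction} {μ : Measure Ω}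

theorem mk_mem_orliczSpace_of_ae_le {g : Ω → ℂ} (hg : AEStronglyMeasurable g μ)
    (y : orliczSpace Ψ μ) (hle : ∀ᵐ t ∂μ, ‖g t‖ ≤ ‖y.1 t‖) : AEEqFun.mk g hg ∈ orliczSpace Ψ μ := by
  obtain ⟨C, hC, hy⟩ := y.2
  refine ⟨C, hC, ?_⟩
  rw [modular_congr (AEEqFun.coeFn_mk _ _)]
  refine (modular_mono hC ?_).trans_lt hy
  filter_upwards [hle] with t ht
  gcongr

theorem tendsto_modular_of_dominated {f : ℕ → Ω → ℂ} {y : Ω → ℂ} {C : ℝ} (hC : 0 < C)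
    (hf : ∀ j, AEStronglyMeasurable (f j) μ) (hy : modular Ψ μ y C < ⊤)
    (hle : ∀ j, ∀ᵐ t ∂μ, ‖f j t‖ ≤ ‖y t‖)
    (hlim : ∀ᵐ t ∂μ, Tendsto (fun j => f j t) atTop (𝓝 0)) :
    Tendsto (fun j => modular Ψ μ (f j) C) atTop (𝓝 0) := by
  rw [← lintegral_zero (μ := μ)]
  refine tendsto_lintegral_of_dominated_convergence' _
    (fun j => aemeasurable_modular (hf j) hC) (fun j => ?_) hy.ne ?_
  · filter_upwards [hle j] with t ht
    refine ENNReal.ofReal_le_ofReal (Ψ.mono (by positivity) ?_)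
    gcongr
  · filter_upwards [hlim] with t ht
    have hdiv : Tendsto (fun j => ‖f j t‖ / C) atTop (𝓝[≥] 0) :=
      tendsto_nhdsWithin_iff.2 ⟨by simpa using ht.norm.div_const C,
        Eventually.of_forall fun j => mem_Ici.2 (by positivity)⟩
    simpa [Ψ.map_zero, Function.comp_def] using
      ENNReal.tendsto_ofReal (Ψ.continuousWithinAt_zero.tendsto.comp hdiv)

theorem tendsto_orliczSpace_of_dominated {f : ℕ → orliczSpace Ψ μ} {f' y : orliczSpace Ψ μ}
    (hy : y ∈ morseTransue Ψ μ) (hle : ∀ j, ∀ᵐ t ∂μ, ‖(f j).1 t‖ ≤ ‖y.1 t‖)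
    (hlim : ∀ᵐ t ∂μ, Tendsto (fun j => (f j).1 t) atTop (𝓝 (f'.1 t))) :
    Tendsto f atTop (𝓝 f') := by
  have hsub (j : ℕ) : (f j - f').1 =ᵐ[μ] ⇑(f j).1 - ⇑f'.1 := AEEqFun.coeFn_sub _ _
  have htwo : ((2 : ℂ) • y).1 =ᵐ[μ] (2 : ℂ) • y.1 := AEEqFun.coeFn_smul _ _
  have hle' : ∀ᵐ t ∂μ, ‖f'.1 t‖ ≤ ‖y.1 t‖ := by
    filter_upwards [ae_all_iff.2 hle, hlim] with t ht htlim
    exact le_of_tendsto htlim.norm (Eventually.of_forall ht)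
  rw [tendsto_iff_norm_sub_tendsto_zero, Metric.tendsto_nhds]
  intro ε hε
  have hmod := tendsto_modular_of_dominated (half_pos hε)
    (fun j => (f j - f').1.aestronglyMeasurable)
    ((morseTransue Ψ μ).smul_mem 2 hy _ (half_pos hε)) (fun j => by
      filter_upwards [hsub j, htwo, hle j, hle'] with t hsubt htwot hjt ht
      rw [hsubt, htwot, Pi.sub_apply, Pi.smul_apply, norm_smul, Complex.norm_two, two_mul]
      exact (norm_sub_le _ _).trans (add_le_add hjt ht)) (by
      filter_upwards [ae_all_iff.2 hsub, hlim] with t hsubt ht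
      simp only [hsubt, Pi.sub_apply]
      simpa only [sub_self] using ht.sub_const (f'.1 t))
  filter_upwards [hmod.eventually (ge_mem_nhds one_pos)] with j hj
  rw [Real.dist_eq, sub_zero, abs_norm]
  exact (norm_le_of_modular_le_one (half_pos hε) hj).trans_lt (half_lt_self hε)

end DominatedConvergence

section Boundary

variable {Ψ : OrliczFunction} {g : Torus → ℂ} {G : ℂ → ℂ}

/-- The element of `H^Ψ` with boundary function `g`, when `g ∈ L^Ψ` is the boundary function of an
analytic function `G` on the disk. -/
def HasDiskExt.toHardyOrlicz (h : HasDiskExt g G)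
    (hg : AEEqFun.mk g h.integrable.aestronglyMeasurable ∈ orliczSpace Ψ haarT) : hardyOrlicz Ψ :=
  ⟨⟨_, hg⟩, (h.congr (AEEqFun.coeFn_mk _ _).symm fun _ _ => rfl).fourierCoeff_eq_zero⟩

theorem HasDiskExt.boundary_toHardyOrlicz (h : HasDiskExt g G)
    (hg : AEEqFun.mk g h.integrable.aestronglyMeasurable ∈ orliczSpace Ψ haarT) :
    boundary (h.toHardyOrlicz hg) =ᵐ[haarT] g :=
  AEEqFun.coeFn_mk _ _

theorem HasDiskExt.diskExt_eq {f : hardyOrlicz Ψ} (h : HasDiskExt g G)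
    (hf : boundary f =ᵐ[haarT] g) {z : ℂ} (hz : z ∈ disk) : diskExt f z = G z :=
  ((h.congr hf.symm fun _ _ => rfl).hasSum z hz).tsum_eq

theorem eq_of_boundary_ae_eq {f g : hardyOrlicz Ψ} (h : boundary f =ᵐ[haarT] boundary g) : f = g :=
  Subtype.ext (Subtype.ext (AEEqFun.ext h))

theorem boundary_add (f g : hardyOrlicz Ψ) :
    boundary (f + g) =ᵐ[haarT] boundary f + boundary g :=
  AEEqFun.coeFn_add f.1.1 g.1.1

theorem boundary_smul (c : ℂ) (f : hardyOrlicz Ψ) : boundary (c • f) =ᵐ[haarT] c • boundary f :=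
  AEEqFun.coeFn_smul c f.1.1

end Boundary

section Growth

/-- The bounds shared by the Taylor coefficients and the values of all functions of norm at most `M`
in `H^Ψ`, up to a constant. The point of the definition is that the sequences `a` satisfying it form
a compact set for coordinatewise convergence. -/
def HasGrowth (Ψ : OrliczFunction) (M : ℝ) (a : ℕ → ℂ) : Prop :=
  (∀ n, ‖a n‖ ≤ M) ∧ ∀ s : ℝ, 0 < s → ∀ w : ℂ, ‖w‖ ≤ 1 - 2 / Ψ s → ‖powerSum a w‖ ≤ M * s

variable {Ψ : OrliczFunction} {M N : ℝ} {a b : ℕ → ℂ} {w : ℂ}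

theorem powerSum_add (ha : ∀ n, ‖a n‖ ≤ M) (hb : ∀ n, ‖b n‖ ≤ N) (hw : w ∈ disk) :
    powerSum (a + b) w = powerSum a w + powerSum b w := by
  simp only [powerSum, Pi.add_apply, add_mul]
  exact (hasSum_powerSum ha hw).summable.tsum_add (hasSum_powerSum hb hw).summable

theorem powerSum_smul (c : ℂ) (a : ℕ → ℂ) (w : ℂ) : powerSum (c • a) w = c * powerSum a w := by
  simp only [powerSum, Pi.smul_apply, smul_eq_mul, mul_assoc, tsum_mul_left]

theorem HasGrowth.nonneg (h : HasGrowth Ψ M a) : 0 ≤ M := (norm_nonneg _).trans (h.1 0)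

theorem HasGrowth.mono (h : HasGrowth Ψ M a) (hMN : M ≤ N) : HasGrowth Ψ N a :=
  ⟨fun n => (h.1 n).trans hMN, fun s hs w hw =>
    (h.2 s hs w hw).trans (mul_le_mul_of_nonneg_right hMN hs.le)⟩

theorem HasGrowth.add (ha : HasGrowth Ψ M a) (hb : HasGrowth Ψ N b) :
    HasGrowth Ψ (M + N) (a + b) := by
  refine ⟨fun n => (norm_add_le _ _).trans (add_le_add (ha.1 n) (hb.1 n)), fun s hs w hw => ?_⟩
  rw [powerSum_add ha.1 hb.1 (mem_disk_of_norm_le hs hw), add_mul]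
  exact (norm_add_le _ _).trans (add_le_add (ha.2 s hs w hw) (hb.2 s hs w hw))

theorem HasGrowth.smul (ha : HasGrowth Ψ M a) (c : ℂ) : HasGrowth Ψ (‖c‖ * M) (c • a) := by
  refine ⟨fun n => ?_, fun s hs w hw => ?_⟩
  · rw [Pi.smul_apply, norm_smul]
    exact mul_le_mul_of_nonneg_left (ha.1 n) (norm_nonneg c)
  · rw [powerSum_smul, norm_mul, mul_assoc]
    exact mul_le_mul_of_nonneg_left (ha.2 s hs w hw) (norm_nonneg c)

theorem isCompact_setOf_hasGrowth (Ψ : OrliczFunction) (M : ℝ) :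
    IsCompact {a : ℕ → ℂ | HasGrowth Ψ M a} := by
  refine (isCompact_univ_pi fun _ => isCompact_closedBall (0 : ℂ) M).of_isClosed_subset
    (IsSeqClosed.isClosed fun a a' ha hlim => ?_)
    fun a ha n _ => mem_closedBall_zero_iff.2 (ha.1 n)
  rw [tendsto_pi_nhds] at hlim
  exact ⟨fun n => le_of_tendsto' (hlim n).norm fun j => (ha j).1 n, fun s hs w hw => le_of_tendsto'
    (tendsto_powerSum (fun j => (ha j).1) hlim (mem_disk_of_norm_le hs hw)).norm
    fun j => (ha j).2 s hs w hw⟩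

theorem exists_hasGrowth (Ψ : OrliczFunction) : ∃ K : ℝ, 0 ≤ K ∧ ∀ f : hardyOrlicz Ψ,
    HasGrowth Ψ (K * ‖f‖) fun n : ℕ => fourierCoeff (boundary f) n := by
  obtain ⟨s, hΨs, hs⟩ :=
    ((Ψ.tendsto_atTop.eventually_ge_atTop 1).and (eventually_ge_atTop 1)).exists
  have hs0 : 0 ≤ s := zero_le_one.trans hs
  refine ⟨2 * s, by positivity, fun f =>
    ⟨fun n => norm_fourierCoeff_boundary_le f hs0 hΨs n, fun x hx w hw => ?_⟩⟩
  calc ‖diskExt f w‖ ≤ 2 * x * ‖f‖ := norm_diskExt_le f hx hw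
    _ = 2 * 1 * ‖f‖ * x := by ring
    _ ≤ 2 * s * ‖f‖ * x := by gcongr

/-- The coefficient sequences with the growth of those of some function in `H^Ψ`, with the topology
of coordinatewise convergence. -/
def growthSpace (Ψ : OrliczFunction) : Submodule ℂ (ℕ → ℂ) where
  carrier := {a | ∃ M, HasGrowth Ψ M a}
  zero_mem' := ⟨0, by simp [HasGrowth, powerSum]⟩
  add_mem' := fun ⟨_, ha⟩ ⟨_, hb⟩ => ⟨_, ha.add hb⟩
  smul_mem' := fun c _ ⟨_, ha⟩ => ⟨_, ha.smul c⟩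

/-- The Taylor coefficients of the functions in `H^Ψ`. -/
def taylorCoeff (Ψ : OrliczFunction) : hardyOrlicz Ψ →ₗ[ℂ] growthSpace Ψ where
  toFun f := ⟨fun n => fourierCoeff (boundary f) n,
    let ⟨K, _, hK⟩ := exists_hasGrowth Ψ; ⟨K * ‖f‖, hK f⟩⟩
  map_add' f g := Subtype.ext <| funext fun n => by
    simp only [fourierCoeff_congr_ae (boundary_add f g),
      fourierCoeff.add (integrable_boundary f) (integrable_boundary g), Pi.add_apply,
      Submodule.coe_add]
  map_smul' c f := Subtype.ext <| funext fun n => by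
    simp only [fourierCoeff_congr_ae (boundary_smul c f), fourierCoeff.const_smul,
      RingHom.id_apply, Submodule.coe_smul, Pi.smul_apply]

end Growth

/-- `φ` is an analytic self map of the disk with radial limits `b`, whose distance to the unit
circle is controlled by the function `y` in the Morse–Transue space. -/
structure ControlledSymbol (Ψ : OrliczFunction) (φ : ℂ → ℂ) (b : Torus → ℂ) (y : Torus → ℝ) :
    Prop where
  differentiableOn : DifferentiableOn ℂ φ disk
  mapsTo : MapsTo φ disk disk
  tendsto : ∀ᵐ t ∂haarT, Tendsto (fun j => φ (radius j * circlePoint t)) atTop (𝓝 (b t))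
  measurable : Measurable y
  pos : ∀ t, 0 < y t
  norm_le : ∀ᵐ t ∂haarT, ‖b t‖ ≤ 1 - 2 / Ψ (y t)
  modular_lt_top : ∀ C : ℝ, 0 < C → modular Ψ haarT (fun t => (y t : ℂ)) C < ⊤

namespace ControlledSymbol

variable {Ψ : OrliczFunction} {φ : ℂ → ℂ} {b : Torus → ℂ} {y : Torus → ℝ}

theorem mem_disk (H : ControlledSymbol Ψ φ b y) : ∀ᵐ t ∂haarT, b t ∈ disk := by
  filter_upwards [H.norm_le] with t ht
  exact mem_disk_of_norm_le (H.pos t) ht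

/-- The function `y` as an element of `L^Ψ`. -/
def majorant (H : ControlledSymbol Ψ φ b y) : orliczSpace Ψ haarT :=
  ⟨AEEqFun.mk (fun t => (y t : ℂ))
    (Complex.measurable_ofReal.comp H.measurable).aestronglyMeasurable, 1, one_pos, by
      rw [modular_congr (AEEqFun.coeFn_mk _ _)]
      exact H.modular_lt_top 1 one_pos⟩

theorem coeFn_majorant (H : ControlledSymbol Ψ φ b y) :
    H.majorant.1 =ᵐ[haarT] fun t => (y t : ℂ) :=
  AEEqFun.coeFn_mk _ _

theorem majorant_mem_morseTransue (H : ControlledSymbol Ψ φ b y) :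
    H.majorant ∈ morseTransue Ψ haarT := fun C hC => by
  rw [modular_congr H.coeFn_majorant]
  exact H.modular_lt_top C hC

theorem integrable (H : ControlledSymbol Ψ φ b y) : Integrable y haarT := by
  simpa using ((integrable_of_mem_orliczSpace H.majorant).congr H.coeFn_majorant).re

section Comp

variable {a : ℕ → ℂ} {M : ℝ}

theorem norm_powerSum_le (H : ControlledSymbol Ψ φ b y) (ha : HasGrowth Ψ M a) :
    ∀ᵐ t ∂haarT, ‖powerSum a (b t)‖ ≤ M * y t := by
  filter_upwards [H.norm_le] with t ht
  exact ha.2 _ (H.pos t) _ ht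

theorem norm_powerSum_le_majorant (H : ControlledSymbol Ψ φ b y) (ha : HasGrowth Ψ M a) :
    ∀ᵐ t ∂haarT, ‖powerSum a (b t)‖ ≤ ‖((M : ℂ) • H.majorant).1 t‖ := by
  have hsmul : ((M : ℂ) • H.majorant).1 =ᵐ[haarT] (M : ℂ) • H.majorant.1 := AEEqFun.coeFn_smul _ _
  filter_upwards [H.norm_powerSum_le ha, H.coeFn_majorant, hsmul] with t ht hy hsmul
  rw [hsmul, Pi.smul_apply, hy, norm_smul, Complex.norm_of_nonneg ha.nonneg,
    Complex.norm_of_nonneg (H.pos t).le]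
  exact ht

theorem hasDiskExt_powerSum_dilate (H : ControlledSymbol Ψ φ b y) (ha : HasGrowth Ψ M a) (j : ℕ) :
    HasDiskExt (fun t => powerSum a (radius j * b t)) (fun z => powerSum a (radius j * φ z)) := by
  have hmem {z : ℂ} (hz : z ∈ disk) : (radius j : ℂ) * z ∈ disk :=
    radius_mul_mem_disk j (mem_ball_zero_iff.1 hz).le
  refine hasDiskExt_of_bounded (M := M * (1 - radius j)⁻¹) ?_ (fun z hz => ?_) ?_
  · exact (differentiableOn_powerSum ha.1).comp (H.differentiableOn.const_mul _)
      fun z hz => hmem (H.mapsTo hz)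
  · refine HardyOrlicz.norm_powerSum_le ha.1 ?_ (radius_lt_one j)
    rw [norm_radius_mul]
    exact mul_le_of_le_one_right (radius_nonneg j) (mem_ball_zero_iff.1 (H.mapsTo hz)).le
  · filter_upwards [H.tendsto, H.mem_disk] with t ht htd
    exact (continuousAt_powerSum ha.1 (hmem htd)).tendsto.comp (ht.const_mul _)

theorem hasDiskExt_powerSum (H : ControlledSymbol Ψ φ b y) (ha : HasGrowth Ψ M a) :
    HasDiskExt (fun t => powerSum a (b t)) (fun z => powerSum a (φ z)) := by
  refine hasDiskExt_of_tendsto (H.hasDiskExt_powerSum_dilate ha) (H.integrable.const_mul M)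
    (fun j => ?_) ?_ fun z hz => ?_
  · filter_upwards [H.norm_le] with t ht
    refine ha.2 _ (H.pos t) _ (le_trans ?_ ht)
    rw [norm_radius_mul]
    exact mul_le_of_le_one_left (norm_nonneg _) (radius_lt_one j).le
  · filter_upwards [H.mem_disk] with t ht
    exact (continuousAt_powerSum ha.1 ht).tendsto.comp (tendsto_radius_mul _)
  · exact (continuousAt_powerSum ha.1 (H.mapsTo hz)).tendsto.comp (tendsto_radius_mul _)

end Comp

theorem exists_hasDiskExt_mem (H : ControlledSymbol Ψ φ b y) (a : growthSpace Ψ) :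
    ∃ h : HasDiskExt (fun t => powerSum a (b t)) (fun z => powerSum a (φ z)),
      AEEqFun.mk _ h.integrable.aestronglyMeasurable ∈ orliczSpace Ψ haarT :=
  let ⟨_, ha⟩ := a.2
  ⟨H.hasDiskExt_powerSum ha, mk_mem_orliczSpace_of_ae_le _ _ (H.norm_powerSum_le_majorant ha)⟩

/-- The composition with `φ`, as a map from coefficient sequences to `H^Ψ`. -/
def comp (H : ControlledSymbol Ψ φ b y) : growthSpace Ψ →ₗ[ℂ] hardyOrlicz Ψ where
  toFun a :=
    (H.exists_hasDiskExt_mem a).choose.toHardyOrlicz (H.exists_hasDiskExt_mem a).choose_spec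
  map_add' a a' := eq_of_boundary_ae_eq <| by
    obtain ⟨M, ha⟩ := a.2
    obtain ⟨M', ha'⟩ := a'.2
    filter_upwards [boundary_add _ _, HasDiskExt.boundary_toHardyOrlicz _ _,
      HasDiskExt.boundary_toHardyOrlicz _ _, HasDiskExt.boundary_toHardyOrlicz _ _, H.mem_disk]
      with t hadd hsum hat hat' ht
    rw [hadd, Pi.add_apply, hsum, hat, hat', Submodule.coe_add, powerSum_add ha.1 ha'.1 ht]
  map_smul' c a := eq_of_boundary_ae_eq <| by
    filter_upwards [boundary_smul _ _, HasDiskExt.boundary_toHardyOrlicz _ _,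
      HasDiskExt.boundary_toHardyOrlicz _ _] with t hsmul hcat hat
    rw [RingHom.id_apply, hsmul, Pi.smul_apply, hcat, hat, Submodule.coe_smul, powerSum_smul,
      smul_eq_mul]

theorem boundary_comp (H : ControlledSymbol Ψ φ b y) (a : growthSpace Ψ) :
    boundary (H.comp a) =ᵐ[haarT] fun t => powerSum a (b t) :=
  (H.exists_hasDiskExt_mem a).choose.boundary_toHardyOrlicz
    (H.exists_hasDiskExt_mem a).choose_spec

theorem norm_comp_le (H : ControlledSymbol Ψ φ b y) {a : growthSpace Ψ} {M : ℝ}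
    (ha : HasGrowth Ψ M a) : ‖H.comp a‖ ≤ M * ‖H.majorant‖ := by
  have hle : ‖(H.comp a).1‖ ≤ ‖(M : ℂ) • H.majorant‖ := by
    refine norm_le_norm_of_ae_le ?_
    filter_upwards [H.boundary_comp a, H.norm_powerSum_le_majorant ha] with t hbd ht
    exact (congrArg norm hbd).trans_le ht
  rwa [norm_smul, Complex.norm_of_nonneg ha.nonneg] at hle

theorem continuousOn_comp (H : ControlledSymbol Ψ φ b y) (M : ℝ) :
    ContinuousOn H.comp {a | HasGrowth Ψ M a} := by
  rw [continuousOn_iff_continuous_domRestrict, continuous_iff_seqContinuous]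
  intro a a' hlim
  have hcoord : ∀ n, Tendsto (fun j => (a j).1.1 n) atTop (𝓝 (a'.1.1 n)) := tendsto_pi_nhds.1 <|
    ((continuous_subtype_val.comp continuous_subtype_val).tendsto a').comp hlim
  refine tendsto_subtype_rng.2 (tendsto_orliczSpace_of_dominated
    ((morseTransue Ψ haarT).smul_mem (M : ℂ) H.majorant_mem_morseTransue) (fun j => ?_) ?_)
  · filter_upwards [H.boundary_comp (a j).1, H.norm_powerSum_le_majorant (a j).2] with t hbd ht
    exact (congrArg norm hbd).trans_le ht
  · filter_upwards [ae_all_iff.2 fun j => H.boundary_comp (a j).1, H.boundary_comp a'.1, H.mem_disk]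
      with t hbd hbd' ht
    have hpow := tendsto_powerSum (fun j => (a j).2.1) hcoord ht
    rw [← hbd'] at hpow
    exact hpow.congr fun j => (hbd j).symm

/-- The composition operator `C_φ`. -/
def compositionOperator (H : ControlledSymbol Ψ φ b y) : hardyOrlicz Ψ →L[ℂ] hardyOrlicz Ψ :=
  (H.comp ∘ₗ taylorCoeff Ψ).mkContinuousOfExistsBound <| by
    obtain ⟨K, -, hK⟩ := exists_hasGrowth Ψ
    refine ⟨K * ‖H.majorant‖, fun f => ?_⟩
    rw [mul_right_comm]
    exact H.norm_comp_le (hK f)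

theorem boundary_compositionOperator (H : ControlledSymbol Ψ φ b y) (f : hardyOrlicz Ψ) :
    boundary (H.compositionOperator f) =ᵐ[haarT] fun t => diskExt f (b t) :=
  H.boundary_comp (taylorCoeff Ψ f)

theorem isCompositionOperator (H : ControlledSymbol Ψ φ b y) :
    IsCompositionOperator φ H.compositionOperator := fun f _ hz =>
  let ⟨_, ha⟩ := (taylorCoeff Ψ f).2
  (H.hasDiskExt_powerSum ha).diskExt_eq (H.boundary_compositionOperator f) hz

theorem isOrderBoundedIntoMorseTransue (H : ControlledSymbol Ψ φ b y) :
    IsOrderBoundedIntoMorseTransue H.compositionOperator := by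
  obtain ⟨K, hK0, hK⟩ := exists_hasGrowth Ψ
  have hY : ((K : ℂ) • H.majorant).1 =ᵐ[haarT] fun t => ((K * y t : ℝ) : ℂ) := by
    have hsmul : ((K : ℂ) • H.majorant).1 =ᵐ[haarT] (K : ℂ) • H.majorant.1 :=
      AEEqFun.coeFn_smul _ _
    filter_upwards [hsmul, H.coeFn_majorant] with t hsmul hy
    rw [hsmul, Pi.smul_apply, hy, smul_eq_mul, Complex.ofReal_mul]
  refine ⟨(K : ℂ) • H.majorant, Submodule.smul_mem _ _ H.majorant_mem_morseTransue, ?_,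
    fun f hf => ?_⟩
  · filter_upwards [hY] with t ht
    rw [ht]
    exact ⟨mul_nonneg hK0 (H.pos t).le, Complex.ofReal_im _⟩
  · filter_upwards [H.boundary_compositionOperator f, H.norm_powerSum_le (hK f), hY]
      with t hbd hle ht
    have hy := H.pos t
    rw [hbd, ht, Complex.ofReal_re]
    exact hle.trans (by gcongr; exact mul_le_of_le_one_right hK0 hf)

theorem isCompactOperator (H : ControlledSymbol Ψ φ b y) :
    IsCompactOperator H.compositionOperator := by
  obtain ⟨K, hK0, hK⟩ := exists_hasGrowth Ψ
  have hsub : {a | HasGrowth Ψ K a} ⊆ range ((↑) : growthSpace Ψ → ℕ → ℂ) :=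
    fun a ha => ⟨⟨a, K, ha⟩, rfl⟩
  have hcompact : IsCompact {a : growthSpace Ψ | HasGrowth Ψ K a} :=
    (Topology.IsInducing.subtypeVal.isCompact_preimage_iff hsub).2 (isCompact_setOf_hasGrowth Ψ K)
  refine ⟨_, hcompact.image_of_continuousOn (H.continuousOn_comp K), ?_⟩
  filter_upwards [Metric.closedBall_mem_nhds (0 : hardyOrlicz Ψ) one_pos] with f hf
  have hf1 : K * ‖f‖ ≤ K := mul_le_of_le_one_right hK0 (mem_closedBall_zero_iff.1 hf)
  exact ⟨taylorCoeff Ψ f, (hK f).mono hf1, rfl⟩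

end ControlledSymbol

section BoundedElements

variable {Ω : Type*} [MeasurableSpace Ω] {Ψ : OrliczFunction} {μ : Measure Ω}

theorem modular_le_of_norm_le {g : Ω → ℂ} {B C : ℝ} (hC : 0 < C) (hB : ∀ᵐ t ∂μ, ‖g t‖ ≤ B) :
    modular Ψ μ g C ≤ ENNReal.ofReal (Ψ (B / C)) * μ univ := by
  rw [← lintegral_const]
  refine lintegral_mono_ae ?_
  filter_upwards [hB] with t ht
  exact ENNReal.ofReal_le_ofReal (Ψ.mono (by positivity) (by gcongr))

theorem mk_mem_orliczSpace_of_bounded [IsFiniteMeasure μ] {g : Ω → ℂ}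
    (hg : AEStronglyMeasurable g μ) {B : ℝ} (hB : ∀ᵐ t ∂μ, ‖g t‖ ≤ B) :
    AEEqFun.mk g hg ∈ orliczSpace Ψ μ := by
  refine ⟨1, one_pos, ?_⟩
  rw [modular_congr (AEEqFun.coeFn_mk _ _)]
  exact (modular_le_of_norm_le one_pos hB).trans_lt
    (ENNReal.mul_lt_top ENNReal.ofReal_lt_top (measure_lt_top μ _))

theorem norm_le_max_of_norm_le_one [IsProbabilityMeasure μ] {f : orliczSpace Ψ μ}
    (hf : ∀ᵐ t ∂μ, ‖f.1 t‖ ≤ 1) : ‖f‖ ≤ max 1 (Ψ 1) := by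
  have hC : 0 < max 1 (Ψ 1) := one_pos.trans_le (le_max_left _ _)
  have hΨ : Ψ (1 / max 1 (Ψ 1)) ≤ 1 :=
    calc Ψ (1 / max 1 (Ψ 1)) = Ψ ((max 1 (Ψ 1))⁻¹ * 1) := by rw [one_div, mul_one]
      _ ≤ (max 1 (Ψ 1))⁻¹ * Ψ 1 := Ψ.mul_le zero_le_one (inv_nonneg.2 hC.le)
          (inv_le_one_of_one_le₀ (le_max_left _ _))
      _ ≤ 1 := by
          rw [inv_mul_le_iff₀ hC, mul_one]
          exact le_max_right _ _
  refine norm_le_of_modular_le_one hC ((modular_le_of_norm_le hC hf).trans ?_)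
  rwa [measure_univ, mul_one, ENNReal.ofReal_le_one]

end BoundedElements

section EntireElement

variable {Ψ : OrliczFunction} {G : ℂ → ℂ}

theorem exists_norm_entire_le (hG : Differentiable ℂ G) : ∃ B, ∀ z, ‖z‖ ≤ 1 → ‖G z‖ ≤ B := by
  obtain ⟨B, hB⟩ := (isCompact_closedBall (0 : ℂ) 1).exists_bound_of_continuousOn
    hG.continuous.continuousOn
  exact ⟨B, fun z hz => hB z (mem_closedBall_zero_iff.2 hz)⟩

theorem hasDiskExt_of_entire (hG : Differentiable ℂ G) :
    HasDiskExt (fun t => G (circlePoint t)) G := by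
  obtain ⟨B, hB⟩ := exists_norm_entire_le hG
  exact hasDiskExt_of_bounded hG.differentiableOn (fun z hz => hB z (mem_ball_zero_iff.1 hz).le)
    (Eventually.of_forall fun t => (hG.continuous.tendsto _).comp (tendsto_radius_mul _))

theorem mk_entire_mem_orliczSpace (hG : Differentiable ℂ G) :
    AEEqFun.mk _ (hasDiskExt_of_entire hG).integrable.aestronglyMeasurable ∈
      orliczSpace Ψ haarT := by
  obtain ⟨B, hB⟩ := exists_norm_entire_le hG
  exact mk_mem_orliczSpace_of_bounded _
    (Eventually.of_forall fun t => hB _ (norm_circlePoint t).le)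

variable (Ψ) in
/-- The restriction of an entire function to the disk, as an element of the Hardy–Orlicz space. -/
def entireElement (hG : Differentiable ℂ G) : hardyOrlicz Ψ :=
  (hasDiskExt_of_entire hG).toHardyOrlicz (mk_entire_mem_orliczSpace hG)

theorem boundary_entireElement (hG : Differentiable ℂ G) :
    boundary (entireElement Ψ hG) =ᵐ[haarT] fun t => G (circlePoint t) :=
  (hasDiskExt_of_entire hG).boundary_toHardyOrlicz (mk_entire_mem_orliczSpace hG)

theorem diskExt_entireElement (hG : Differentiable ℂ G) {z : ℂ} (hz : z ∈ disk) :
    diskExt (entireElement Ψ hG) z = G z :=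
  (hasDiskExt_of_entire hG).diskExt_eq (boundary_entireElement hG) hz

end EntireElement

section Summing

theorem sum_rpow_le_rpow {ι : Type*} {s : Finset ι} {a : ι → ℝ} {B p : ℝ} (hp : 1 ≤ p)
    (ha : ∀ k ∈ s, 0 ≤ a k) (hB : ∑ k ∈ s, a k ≤ B) : ∑ k ∈ s, a k ^ p ≤ B ^ p := by
  have hB0 : 0 ≤ B := (Finset.sum_nonneg ha).trans hB
  have hterm : ∀ k ∈ s, a k ^ p ≤ a k * B ^ (p - 1) := fun k hk => by
    have hle : a k ≤ B := (Finset.single_le_sum ha hk).trans hB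
    calc a k ^ p = a k * a k ^ (p - 1) := by
          rw [← Real.rpow_one_add' (ha k hk) (by linarith), add_sub_cancel]
      _ ≤ a k * B ^ (p - 1) := mul_le_mul_of_nonneg_left
          (Real.rpow_le_rpow (ha k hk) hle (by linarith)) (ha k hk)
  calc ∑ k ∈ s, a k ^ p ≤ (∑ k ∈ s, a k) * B ^ (p - 1) := by
        rw [Finset.sum_mul]
        exact Finset.sum_le_sum hterm
    _ ≤ B * B ^ (p - 1) := by gcongr
    _ = B ^ p := by rw [← Real.rpow_one_add' hB0 (by linarith), add_sub_cancel]

variable {X Y : Type*} [NormedAddCommGroup X] [NormedSpace ℂ X] [NormedAddCommGroup Y]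
  [NormedSpace ℂ Y]

theorem sum_norm_apply_le {ι : Type*} {s : Finset ι} {x : ι → X} {B : ℝ}
    (hx : ∀ u : ι → ℂ, (∀ k, ‖u k‖ = 1) → ‖∑ k ∈ s, u k • x k‖ ≤ B) {ξ : StrongDual ℂ X}
    (hξ : ‖ξ‖ ≤ 1) : ∑ k ∈ s, ‖ξ (x k)‖ ≤ B := by
  choose u hu hval using fun k => Complex.exists_norm_eq_mul_self (ξ (x k))
  have hsum : ξ (∑ k ∈ s, u k • x k) = ((∑ k ∈ s, ‖ξ (x k)‖ : ℝ) : ℂ) := by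
    rw [map_sum, Complex.ofReal_sum]
    exact Finset.sum_congr rfl fun k _ => by rw [map_smul, smul_eq_mul, hval]
  calc ∑ k ∈ s, ‖ξ (x k)‖ = ‖ξ (∑ k ∈ s, u k • x k)‖ := by
        rw [hsum, Complex.norm_of_nonneg (Finset.sum_nonneg fun _ _ => norm_nonneg _)]
    _ ≤ 1 * ‖∑ k ∈ s, u k • x k‖ := ξ.le_of_opNorm_le hξ _
    _ ≤ B := by
        rw [one_mul]
        exact hx u hu

theorem IsPSumming.exists_card_mul_le {T : X →L[ℂ] Y} {p : ℝ} (hp : 1 ≤ p) (hT : IsPSumming p T)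
    (B : ℝ) : ∃ D : ℝ, ∀ (n : ℕ) (x : Fin n → X) (β : ℝ),
      (∀ u : Fin n → ℂ, (∀ k, ‖u k‖ = 1) → ‖∑ k, u k • x k‖ ≤ B) → 0 ≤ β →
        (∀ k, β ≤ ‖T (x k)‖) → n * β ^ p ≤ D := by
  obtain ⟨C, hC, hsum⟩ := hT
  refine ⟨C ^ p * B ^ p, fun n x β hx hβ hle => ?_⟩
  have : Nonempty {ξ : StrongDual ℂ X // ‖ξ‖ ≤ 1} := ⟨⟨0, norm_zero.trans_le zero_le_one⟩⟩
  calc (n : ℝ) * β ^ p = ∑ _k : Fin n, β ^ p := by simp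
    _ ≤ ∑ k, ‖T (x k)‖ ^ p :=
        Finset.sum_le_sum fun k _ => Real.rpow_le_rpow hβ (hle k) (by linarith)
    _ ≤ C ^ p * ⨆ ξ : {ξ : StrongDual ℂ X // ‖ξ‖ ≤ 1}, ∑ k, ‖ξ.1 (x k)‖ ^ p := hsum n x
    _ ≤ C ^ p * B ^ p := by
        gcongr
        exact ciSup_le fun ξ => sum_rpow_le_rpow hp (fun _ _ => norm_nonneg _)
          (sum_norm_apply_le hx ξ.2)

variable {Ψ : OrliczFunction}

theorem boundary_sum_smul {ι : Type*} (s : Finset ι) (u : ι → ℂ) (x : ι → hardyOrlicz Ψ) :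
    boundary (∑ k ∈ s, u k • x k) =ᵐ[haarT] fun t => ∑ k ∈ s, u k * boundary (x k) t := by
  classical
  induction s using Finset.induction_on with
  | empty => exact AEEqFun.coeFn_zero
  | insert k s hk ih =>
    simp only [Finset.sum_insert hk]
    filter_upwards [ih, boundary_add (u k • x k) (∑ k ∈ s, u k • x k), boundary_smul (u k) (x k)]
      with t hs hadd hsmul
    rw [hadd, Pi.add_apply, hs, hsmul, Pi.smul_apply, smul_eq_mul]

theorem norm_sum_smul_le {ι : Type*} {s : Finset ι} {x : ι → hardyOrlicz Ψ}
    (hx : ∀ᵐ t ∂haarT, ∑ k ∈ s, ‖boundary (x k) t‖ ≤ 1) {u : ι → ℂ} (hu : ∀ k, ‖u k‖ = 1) :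
    ‖∑ k ∈ s, u k • x k‖ ≤ max 1 (Ψ 1) := by
  refine norm_le_max_of_norm_le_one (f := (∑ k ∈ s, u k • x k).1) ?_
  filter_upwards [hx, boundary_sum_smul s u x] with t ht hsum
  calc ‖boundary (∑ k ∈ s, u k • x k) t‖ = ‖∑ k ∈ s, u k * boundary (x k) t‖ := by rw [hsum]
    _ ≤ ∑ k ∈ s, ‖u k * boundary (x k) t‖ := norm_sum_le _ _
    _ = ∑ k ∈ s, ‖boundary (x k) t‖ := by simp only [norm_mul, hu, one_mul]
    _ ≤ 1 := ht

end Summing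

section FejerPeak

theorem sum_pow_mul_conj_pow {N : ℕ} {η : ℂ} (hη : IsPrimitiveRoot η N) {j l : ℕ} (hj : j < N)
    (hl : l < N) : ∑ k ∈ Finset.range N, η ^ (k * j) * starRingEnd ℂ (η ^ (k * l)) =
      if j = l then (N : ℂ) else 0 := by
  have hN : N ≠ 0 := (Nat.zero_le j).trans_lt hj |>.ne'
  have hη0 : η ≠ 0 := hη.ne_zero hN
  have hterm (k : ℕ) : η ^ (k * j) * starRingEnd ℂ (η ^ (k * l)) = (η ^ j * η⁻¹ ^ l) ^ k := by
    rw [map_pow, ← Complex.inv_eq_conj (hη.norm'_eq_one hN), mul_pow, ← pow_mul, ← pow_mul,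
      mul_comm j, mul_comm l]
  simp only [hterm]
  split_ifs with hjl
  · simp [hjl, mul_inv_cancel₀ (pow_ne_zero l hη0)]
  · have hne : η ^ j * η⁻¹ ^ l ≠ 1 := fun h => by
      rw [inv_pow, ← div_eq_mul_inv, div_eq_one_iff_eq (pow_ne_zero _ hη0)] at h
      exact hjl (hη.pow_inj hj hl h)
    have hpow : (η ^ j * η⁻¹ ^ l) ^ N = 1 := by
      rw [mul_pow, pow_right_comm, pow_right_comm η⁻¹, inv_pow, hη.pow_eq_one, inv_one, one_pow,
        one_pow, mul_one]
    rw [geom_sum_eq hne, hpow, sub_self, zero_div]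

theorem sum_norm_sq_sum_mul_pow {N : ℕ} {η : ℂ} (hη : IsPrimitiveRoot η N) (c : ℕ → ℂ) :
    ∑ k ∈ Finset.range N, ‖∑ j ∈ Finset.range N, c j * η ^ (k * j)‖ ^ 2 =
      N * ∑ j ∈ Finset.range N, ‖c j‖ ^ 2 := by
  rw [← Complex.ofReal_inj]
  push_cast
  simp only [← Complex.mul_conj', map_sum, map_mul, Finset.sum_mul_sum]
  rw [Finset.sum_comm, Finset.mul_sum]
  refine Finset.sum_congr rfl fun j hj => ?_
  rw [Finset.sum_comm]
  calc _ = ∑ l ∈ Finset.range N, c j * starRingEnd ℂ (c l) *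
        ∑ k ∈ Finset.range N, η ^ (k * j) * starRingEnd ℂ (η ^ (k * l)) := by
        simp only [Finset.mul_sum]
        exact Finset.sum_congr rfl fun l _ => Finset.sum_congr rfl fun k _ => by ring
    _ = ∑ l ∈ Finset.range N, if j = l then c j * starRingEnd ℂ (c l) * N else 0 :=
        Finset.sum_congr rfl fun l hl => by
          rw [sum_pow_mul_conj_pow hη (Finset.mem_range.1 hj) (Finset.mem_range.1 hl), mul_ite,
            mul_zero]
    _ = N * (c j * starRingEnd ℂ (c j)) := by
        rw [Finset.sum_ite_eq, if_pos hj, mul_comm]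

/-- An analytic version of the Fejér kernel of order `N`, with a peak at `exp (i x)`. -/
def fejerPeak (N : ℕ) (x : ℝ) (z : ℂ) : ℂ :=
  ((N : ℂ)⁻¹ * ∑ j ∈ Finset.range N, (Complex.exp (-(x : ℂ) * Complex.I) * z) ^ j) ^ 2

theorem differentiable_fejerPeak (N : ℕ) (x : ℝ) : Differentiable ℂ (fejerPeak N x) := by
  unfold fejerPeak
  fun_prop

theorem norm_fejerPeak (N : ℕ) (x : ℝ) (z : ℂ) : ‖fejerPeak N x z‖ =
    ((N : ℝ)⁻¹ * ‖∑ j ∈ Finset.range N, (Complex.exp (-(x : ℂ) * Complex.I) * z) ^ j‖) ^ 2 := by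
  rw [fejerPeak, norm_pow, norm_mul, norm_inv, Complex.norm_natCast]

theorem exp_neg_add_mul_I (N k : ℕ) (x : ℝ) :
    Complex.exp (-((x + 2 * Real.pi * k / N : ℝ) : ℂ) * Complex.I) =
      Complex.exp (-(x : ℂ) * Complex.I) * (Complex.exp (2 * Real.pi * Complex.I / N))⁻¹ ^ k := by
  rw [← Complex.exp_neg, ← Complex.exp_nat_mul, ← Complex.exp_add]
  congr 1
  push_cast
  ring

theorem sum_norm_fejerPeak_le {M N : ℕ} (hMN : M ≤ N) (hN : N ≠ 0) (x : ℝ) {z : ℂ} (hz : ‖z‖ ≤ 1) :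
    ∑ k : Fin M, ‖fejerPeak N (x + 2 * Real.pi * k / N) z‖ ≤ 1 := by
  set η : ℂ := (Complex.exp (2 * Real.pi * Complex.I / N))⁻¹
  set c : ℕ → ℂ := fun j => (Complex.exp (-(x : ℂ) * Complex.I) * z) ^ j with hc
  have hη : IsPrimitiveRoot η N := (Complex.isPrimitiveRoot_exp N hN).inv
  have hc1 (j : ℕ) : ‖c j‖ ≤ 1 := by
    rw [hc, norm_pow, norm_mul, ← Complex.ofReal_neg, Complex.norm_exp_ofReal_mul_I, one_mul]
    exact pow_le_one₀ (norm_nonneg _) hz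
  have hpeak (k : ℕ) : ‖fejerPeak N (x + 2 * Real.pi * k / N) z‖ =
      ((N : ℝ) ^ 2)⁻¹ * ‖∑ j ∈ Finset.range N, c j * η ^ (k * j)‖ ^ 2 := by
    rw [norm_fejerPeak, mul_pow, inv_pow, exp_neg_add_mul_I]
    simp only [hc, mul_right_comm _ _ z, mul_pow _ (_ ^ k), ← pow_mul, η]
  calc _ = ∑ k ∈ Finset.range M, ‖fejerPeak N (x + 2 * Real.pi * k / N) z‖ :=
        Fin.sum_univ_eq_sum_range (fun k => ‖fejerPeak N (x + 2 * Real.pi * k / N) z‖) M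
    _ ≤ ∑ k ∈ Finset.range N, ‖fejerPeak N (x + 2 * Real.pi * k / N) z‖ :=
        Finset.sum_le_sum_of_subset_of_nonneg (Finset.range_mono hMN) fun _ _ _ => norm_nonneg _
    _ = ((N : ℝ) ^ 2)⁻¹ * (N * ∑ j ∈ Finset.range N, ‖c j‖ ^ 2) := by
        simp only [hpeak]
        rw [← Finset.mul_sum, sum_norm_sq_sum_mul_pow hη]
    _ ≤ ((N : ℝ) ^ 2)⁻¹ * (N * ∑ _j ∈ Finset.range N, 1) := by
        gcongr with j _
        exact pow_le_one₀ (norm_nonneg _) (hc1 j)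
    _ = 1 := by
        simp only [Finset.sum_const, Finset.card_range, nsmul_eq_mul, mul_one]
        field_simp

theorem quarter_le_re_pow {N j : ℕ} (hj : j ≤ N) {r x v : ℝ} (hr0 : 0 ≤ r) (hr1 : r ≤ 1)
    (hr : 1 / 2 ≤ r ^ N) (hv : N * |v - x| ≤ 1 / 2) : 1 / 4 ≤
      ((Complex.exp (-(x : ℂ) * Complex.I) * (r * Complex.exp (v * Complex.I))) ^ j).re := by
  have hpow : (Complex.exp (-(x : ℂ) * Complex.I) * (r * Complex.exp (v * Complex.I))) ^ j =
      ((r ^ j : ℝ) : ℂ) * Complex.exp ((j * (v - x) : ℝ) * Complex.I) := by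
    rw [mul_left_comm, ← Complex.exp_add, mul_pow, ← Complex.exp_nat_mul]
    push_cast
    congr 2
    ring
  have hrj : 1 / 2 ≤ r ^ j := hr.trans (pow_le_pow_of_le_one hr0 hr1 hj)
  have hangle : |j * (v - x)| ≤ 1 / 2 := by
    rw [abs_mul, Nat.abs_cast]
    exact (mul_le_mul_of_nonneg_right (Nat.cast_le.2 hj) (abs_nonneg _)).trans hv
  have hcos : 1 / 2 ≤ Real.cos (j * (v - x)) := by
    have hsq : (j * (v - x)) ^ 2 ≤ (1 / 2) ^ 2 := sq_le_sq' (neg_le_of_abs_le hangle)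
      (le_of_abs_le hangle)
    linarith [Real.one_sub_sq_div_two_le_cos (x := j * (v - x))]
  rw [hpow, Complex.re_ofReal_mul, Complex.exp_ofReal_mul_I_re]
  calc (1 / 4 : ℝ) = 1 / 2 * (1 / 2) := by norm_num
    _ ≤ r ^ j * Real.cos (j * (v - x)) := by gcongr

theorem le_norm_fejerPeak {N : ℕ} (hN : N ≠ 0) {r x v : ℝ} (hr0 : 0 ≤ r) (hr1 : r ≤ 1)
    (hr : 1 / 2 ≤ r ^ N) (hv : N * |v - x| ≤ 1 / 2) :
    1 / 16 ≤ ‖fejerPeak N x (r * Complex.exp (v * Complex.I))‖ := by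
  have hNpos : (0 : ℝ) < N := Nat.cast_pos.2 (Nat.pos_of_ne_zero hN)
  have hsum : N * (1 / 4 : ℝ) ≤ ‖∑ j ∈ Finset.range N,
      (Complex.exp (-(x : ℂ) * Complex.I) * (r * Complex.exp (v * Complex.I))) ^ j‖ := by
    refine le_trans ?_ (Complex.re_le_norm _)
    rw [Complex.re_sum, ← nsmul_eq_mul, ← Finset.card_range N, ← Finset.sum_const,
      Finset.card_range]
    exact Finset.sum_le_sum fun j hj =>
      quarter_le_re_pow (Finset.mem_range.1 hj).le hr0 hr1 hr hv
  rw [norm_fejerPeak]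
  calc (1 / 16 : ℝ) = (1 / 4) ^ 2 := by norm_num
    _ ≤ _ := by
        gcongr
        rwa [le_inv_mul_iff₀ hNpos]

end FejerPeak

section Angle

/-- The angle in `[0, 2π)` of a point of the circle. -/
def angle (t : Torus) : ℝ := (AddCircle.equivIco (2 * Real.pi) 0 t : ℝ)

theorem angle_nonneg (t : Torus) : 0 ≤ angle t := (AddCircle.equivIco (2 * Real.pi) 0 t).2.1

theorem angle_lt (t : Torus) : angle t < 2 * Real.pi :=
  (AddCircle.equivIco (2 * Real.pi) 0 t).2.2.trans_eq (zero_add _)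

theorem coe_angle (t : Torus) : ((angle t : ℝ) : Torus) = t := AddCircle.coe_equivIco

theorem angle_coe {x : ℝ} (h0 : 0 ≤ x) (h1 : x < 2 * Real.pi) : angle (x : Torus) = x :=
  AddCircle.equivIco_coe_of_mem ⟨h0, by rwa [zero_add]⟩

theorem circlePoint_eq_exp (t : Torus) : circlePoint t = Complex.exp (angle t * Complex.I) := by
  conv_lhs => rw [← coe_angle t]
  rw [circlePoint, AddCircle.toCircle_apply_mk, div_self Real.two_pi_pos.ne', one_mul,
    Circle.coe_exp]

theorem measurable_angle : Measurable angle :=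
  measurable_subtype_coe.comp (AddCircle.measurableEquivIco (2 * Real.pi) 0).measurable

theorem continuousAt_angle {t : Torus} (ht : angle t ≠ 0) : ContinuousAt angle t := by
  have h : t ≠ ((0 : ℝ) : Torus) := fun h => ht (by rw [h, angle_coe le_rfl Real.two_pi_pos])
  exact continuousAt_subtype_val.comp (AddCircle.continuousAt_equivIco _ _ h)

theorem haarT_preimage_angle {S : Set ℝ} (hS : MeasurableSet S) :
    haarT (angle ⁻¹' S) = volume (S ∩ Ioo 0 (2 * Real.pi)) / ENNReal.ofReal (2 * Real.pi) := by
  have hset : (QuotientAddGroup.mk ⁻¹' (angle ⁻¹' S) : Set ℝ) ∩ Ioo 0 (2 * Real.pi) =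
      S ∩ Ioo 0 (2 * Real.pi) := by
    ext x
    refine and_congr_left fun hx => ?_
    change angle (x : Torus) ∈ S ↔ x ∈ S
    rw [angle_coe hx.1.le hx.2]
  have hvol := AddCircle.add_projection_respects_measure (T := 2 * Real.pi) 0 (measurable_angle hS)
  rw [zero_add, measure_congr ((ae_eq_refl _).inter Ioo_ae_eq_Ioc.symm), hset,
    AddCircle.volume_eq_smul_haarAddCircle, Measure.smul_apply, smul_eq_mul] at hvol
  rwa [ENNReal.eq_div_iff (ENNReal.ofReal_pos.2 Real.two_pi_pos).ne' ENNReal.ofReal_ne_top]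

theorem haarT_preimage_Ioo {x y : ℝ} (hx : 0 ≤ x) (hy : y ≤ 2 * Real.pi) :
    haarT (angle ⁻¹' Ioo x y) = ENNReal.ofReal ((y - x) / (2 * Real.pi)) := by
  rw [haarT_preimage_angle measurableSet_Ioo, inter_eq_left.2 (Ioo_subset_Ioo hx hy),
    Real.volume_Ioo, ENNReal.ofReal_div_of_pos Real.two_pi_pos]

theorem ae_angle_notMem {Z : Set ℝ} (hZ : Z.Countable) : ∀ᵐ t ∂haarT, angle t ∉ Z := by
  have hnull : haarT (angle ⁻¹' Z) = 0 := by
    rw [haarT_preimage_angle hZ.measurableSet, (hZ.mono inter_subset_left).measure_zero,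
      ENNReal.zero_div]
  exact measure_eq_zero_iff_ae_notMem.1 hnull

end Angle

section ConjugateIntegral

theorem exp_add_div_exp_sub (α θ : ℝ) :
    (Complex.exp (α * Complex.I) + Complex.exp (θ * Complex.I)) /
      (Complex.exp (α * Complex.I) - Complex.exp (θ * Complex.I)) =
      -(Real.cot ((α - θ) / 2) : ℂ) * Complex.I := by
  set z : ℂ := (α - θ) / 2
  have hα : (α : ℂ) * Complex.I = (α + θ) / 2 * Complex.I + z * Complex.I := by ring
  have hθ : (θ : ℂ) * Complex.I = (α + θ) / 2 * Complex.I + -z * Complex.I := by ring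
  have hsin : Complex.exp (z * Complex.I) - Complex.exp (-z * Complex.I) =
      2 * (Complex.sin z * Complex.I) := by
    rw [← mul_assoc, Complex.two_sin, mul_assoc, Complex.I_mul_I, mul_neg_one, neg_sub]
  rw [hα, hθ, Complex.exp_add, Complex.exp_add, ← mul_add, ← mul_sub,
    mul_div_mul_left _ _ (Complex.exp_ne_zero _), ← Complex.two_cos, hsin,
    mul_div_mul_left _ _ two_ne_zero, ← div_div, Complex.div_I, ← Complex.cot_eq_cos_div_sin,
    neg_mul, Complex.ofReal_cot]
  push_cast
  rfl

/-- The argument at the angle `θ` of the outer function with modulus `exp g`, provided that `g = R`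
near `θ`. -/
def conjugateIntegral (g : Torus → ℝ) (R θ : ℝ) : ℝ :=
  ∫ t, Real.cot ((angle t - θ) / 2) * (R - g t) ∂haarT

theorem herglotzBoundary_eq (g : Torus → ℝ) (t₀ : Torus) :
    herglotzBoundary g t₀ =
      (g t₀ : ℂ) + (conjugateIntegral g (g t₀) (angle t₀) : ℂ) * Complex.I := by
  unfold herglotzBoundary conjugateIntegral
  congr 1
  rw [← integral_complex_ofReal, ← integral_mul_const]
  congr 1 with t
  rw [circlePoint_eq_exp, circlePoint_eq_exp, exp_add_div_exp_sub]
  push_cast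
  ring

theorem mul_le_sin_of_le_pi_div_two {x : ℝ} (hx : 0 ≤ x) (hx' : x ≤ Real.pi / 2) :
    3 / 5 * x ≤ Real.sin x := by
  refine le_trans ?_ (Real.mul_le_sin hx hx')
  refine mul_le_mul_of_nonneg_right ?_ hx
  rw [le_div_iff₀ Real.pi_pos]
  linarith [Real.pi_lt_d2]

theorem cot_sub_cot {x y : ℝ} (hx : Real.sin x ≠ 0) (hy : Real.sin y ≠ 0) :
    Real.cot x - Real.cot y = Real.sin (y - x) / (Real.sin x * Real.sin y) := by
  rw [Real.cot_eq_cos_div_sin, Real.cot_eq_cos_div_sin, Real.sin_sub]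
  field_simp

/-- The angles in `(a, a + c)` form a short arc near `1`, whose distance from `1` exceeds its
length. -/
structure IsShortArc (a c : ℝ) : Prop where
  pos : 0 < c
  two_mul_le : 2 * c ≤ a
  le_half : a ≤ 1 / 2

/-- The middle of the arc of angles in `(a, a + c)`. -/
def arcMiddle (a c : ℝ) : Set ℝ := Icc (a + c / 6) (a + 5 * c / 6)

variable {a c : ℝ}

namespace IsShortArc

theorem third_mem_arcMiddle (h : IsShortArc a c) : a + c / 3 ∈ arcMiddle a c := by
  constructor <;> linarith [h.pos]

theorem two_thirds_mem_arcMiddle (h : IsShortArc a c) : a + 2 * c / 3 ∈ arcMiddle a c := by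
  constructor <;> linarith [h.pos]

theorem le_sin_half_sub (h : IsShortArc a c) {θ : ℝ} (hθ : θ ∈ arcMiddle a c) {α : ℝ}
    (hα : a + c ≤ α) (hα' : α < 2 * Real.pi) : c / 20 ≤ Real.sin ((α - θ) / 2) := by
  obtain ⟨hc, hca, _⟩ := h
  have hle {x : ℝ} (hx : c / 12 ≤ x) (hx' : x ≤ Real.pi / 2) : c / 20 ≤ Real.sin x := by
    linarith [mul_le_sin_of_le_pi_div_two (by linarith) hx']
  rcases le_total ((α - θ) / 2) (Real.pi / 2) with hαθ | hαθ
  · exact hle (by linarith [hθ.2]) hαθ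
  · rw [← Real.sin_pi_sub]
    exact hle (by linarith [hθ.1]) (by linarith)

theorem sin_half_sub_le (h : IsShortArc a c) {θ : ℝ} (hθ : θ ∈ arcMiddle a c) {α : ℝ}
    (hα0 : 0 ≤ α) (hα : α ≤ a) : Real.sin ((α - θ) / 2) ≤ -(c / 20) := by
  obtain ⟨hc, hca, ha⟩ := h
  rw [← neg_sub θ α, neg_div, Real.sin_neg]
  linarith [hθ.1, mul_le_sin_of_le_pi_div_two (x := (θ - α) / 2) (by linarith [hθ.1])
    (by linarith [hθ.2, Real.pi_gt_three])]

theorem sq_le_sin_mul_sin (h : IsShortArc a c) {θ₁ θ₂ : ℝ} (h₁ : θ₁ ∈ arcMiddle a c)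
    (h₂ : θ₂ ∈ arcMiddle a c) {α : ℝ} (hα : α ∈ Ico 0 (2 * Real.pi)) (hαI : α ∉ Ioo a (a + c)) :
    (c / 20) ^ 2 ≤ Real.sin ((α - θ₂) / 2) * Real.sin ((α - θ₁) / 2) := by
  have hc := h.pos
  rcases le_or_gt α a with hαa | hαa
  · nlinarith [h.sin_half_sub_le h₁ hα.1 hαa, h.sin_half_sub_le h₂ hα.1 hαa]
  · have hα' : a + c ≤ α := not_lt.1 fun hlt => hαI ⟨hαa, hlt⟩
    nlinarith [h.le_sin_half_sub h₁ hα' hα.2, h.le_sin_half_sub h₂ hα' hα.2]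

theorem abs_cot_half_sub_le (h : IsShortArc a c) {θ : ℝ} (hθ : θ ∈ arcMiddle a c) {α : ℝ}
    (hα : α ∈ Ico 0 (2 * Real.pi)) (hαI : α ∉ Ioo a (a + c)) :
    |Real.cot ((α - θ) / 2)| ≤ 20 / c := by
  have hc := h.pos
  have hsin : c / 20 ≤ |Real.sin ((α - θ) / 2)| := by
    rw [← abs_of_pos (show 0 < c / 20 by positivity), ← sq_le_sq, sq (Real.sin _)]
    exact h.sq_le_sin_mul_sin hθ hθ hα hαI
  rw [Real.cot_eq_cos_div_sin, abs_div]
  calc _ ≤ 1 / (c / 20) := div_le_div₀ zero_le_one (Real.abs_cos_le_one _) (by positivity) hsin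
    _ = 20 / c := one_div_div _ _

theorem cot_sub_cot_nonneg (h : IsShortArc a c) {θ₁ θ₂ : ℝ} (h₁ : θ₁ ∈ arcMiddle a c)
    (h₂ : θ₂ ∈ arcMiddle a c) (h₁₂ : θ₁ ≤ θ₂) {α : ℝ} (hα : α ∈ Ico 0 (2 * Real.pi))
    (hαI : α ∉ Ioo a (a + c)) : 0 ≤ Real.cot ((α - θ₂) / 2) - Real.cot ((α - θ₁) / 2) := by
  have hc := h.pos
  have hpos := (sq_pos_of_pos (show 0 < c / 20 by positivity)).trans_le
    (h.sq_le_sin_mul_sin h₁ h₂ hα hαI)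
  obtain ⟨hne₂, hne₁⟩ := mul_ne_zero_iff.1 hpos.ne'
  rw [cot_sub_cot hne₂ hne₁, show (α - θ₁) / 2 - (α - θ₂) / 2 = (θ₂ - θ₁) / 2 by ring]
  exact div_nonneg (Real.sin_nonneg_of_nonneg_of_le_pi (by linarith)
    (by linarith [h₁.1, h₂.2, h.two_mul_le, h.le_half, Real.pi_gt_three])) hpos.le

theorem cot_sub_cot_le (h : IsShortArc a c) {θ₁ θ₂ : ℝ} (h₁ : θ₁ ∈ arcMiddle a c)
    (h₂ : θ₂ ∈ arcMiddle a c) (h₁₂ : θ₁ ≤ θ₂) {α : ℝ} (hα : α ∈ Ico 0 (2 * Real.pi))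
    (hαI : α ∉ Ioo a (a + c)) :
    Real.cot ((α - θ₂) / 2) - Real.cot ((α - θ₁) / 2) ≤ 200 / c ^ 2 * (θ₂ - θ₁) := by
  have hc := h.pos
  have hprod := h.sq_le_sin_mul_sin h₁ h₂ hα hαI
  have hpos := (sq_pos_of_pos (show 0 < c / 20 by positivity)).trans_le hprod
  obtain ⟨hne₂, hne₁⟩ := mul_ne_zero_iff.1 hpos.ne'
  rw [cot_sub_cot hne₂ hne₁, show (α - θ₁) / 2 - (α - θ₂) / 2 = (θ₂ - θ₁) / 2 by ring]
  calc _ ≤ (θ₂ - θ₁) / 2 / (c / 20) ^ 2 := by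
        gcongr
        exact Real.sin_le (by linarith)
    _ = 200 / c ^ 2 * (θ₂ - θ₁) := by
        field_simp
        ring

theorem le_cot_sub_cot (h : IsShortArc a c) {α : ℝ} (hα : α ∈ Ioo (a + c) (a + 2 * c)) :
    1 / (10 * c) ≤
      Real.cot ((α - (a + 2 * c / 3)) / 2) - Real.cot ((α - (a + c / 3)) / 2) := by
  have hpi := Real.pi_gt_three
  obtain ⟨hc, hca, ha⟩ := h
  obtain ⟨hα₁, hα₂⟩ := hα
  have hsin_le {x : ℝ} (hx : 0 ≤ x) (hxc : x ≤ c) : Real.sin x ≤ c := (Real.sin_le hx).trans hxc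
  have hpos {x : ℝ} (hx : 0 < x) (hxc : x ≤ c) : 0 < Real.sin x :=
    Real.sin_pos_of_pos_of_lt_pi hx (by linarith)
  have hpos₁ := hpos (x := (α - (a + c / 3)) / 2) (by linarith) (by linarith)
  have hpos₂ := hpos (x := (α - (a + 2 * c / 3)) / 2) (by linarith) (by linarith)
  have hnum : c / 10 ≤ Real.sin (c / 6) := by
    linarith [mul_le_sin_of_le_pi_div_two (x := c / 6) (by linarith) (by linarith)]
  rw [cot_sub_cot hpos₂.ne' hpos₁.ne',
    show (α - (a + c / 3)) / 2 - (α - (a + 2 * c / 3)) / 2 = c / 6 by ring]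
  calc 1 / (10 * c) = c / 10 / (c * c) := by field_simp
    _ ≤ _ := div_le_div₀ (by linarith) hnum (mul_pos hpos₂ hpos₁)
        (mul_le_mul (hsin_le (by linarith) (by linarith)) (hsin_le (by linarith) (by linarith))
          hpos₁.le hc.le)

end IsShortArc

/-- The function `g` is constantly `R` on the short arc of angles in `(a, a + c)`, and differs from
`R` by at most `1` elsewhere. -/
structure IsConstantOnArc (g : Torus → ℝ) (R a c : ℝ) : Prop extends IsShortArc a c where
  measurable : Measurable g
  eq_of_mem : ∀ t, angle t ∈ Ioo a (a + c) → g t = R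
  abs_sub_le : ∀ t, |R - g t| ≤ 1

namespace IsConstantOnArc

variable {g : Torus → ℝ} {R : ℝ}

theorem integrable (h : IsConstantOnArc g R a c) {θ : ℝ} (hθ : θ ∈ arcMiddle a c) :
    Integrable (fun t => Real.cot ((angle t - θ) / 2) * (R - g t)) haarT := by
  have hc := h.pos
  have hm : Measurable fun t : Torus => (angle t - θ) / 2 :=
    (measurable_angle.sub_const θ).div_const 2
  simp only [Real.cot_eq_cos_div_sin]
  refine Integrable.of_bound (((Real.measurable_cos.comp hm).div
    (Real.measurable_sin.comp hm)).mul (h.measurable.const_sub R)).aestronglyMeasurable (20 / c)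
    (Eventually.of_forall fun t => ?_)
  rw [← Real.cot_eq_cos_div_sin]
  by_cases ht : angle t ∈ Ioo a (a + c)
  · rw [h.eq_of_mem t ht, sub_self, mul_zero, norm_zero]
    positivity
  · rw [norm_mul, ← mul_one (20 / c)]
    exact mul_le_mul (h.abs_cot_half_sub_le hθ ⟨angle_nonneg t, angle_lt t⟩ ht) (h.abs_sub_le t)
      (abs_nonneg _) (by positivity)

theorem conjugateIntegral_sub (h : IsConstantOnArc g R a c) {θ₁ θ₂ : ℝ} (h₁ : θ₁ ∈ arcMiddle a c)
    (h₂ : θ₂ ∈ arcMiddle a c) : conjugateIntegral g R θ₂ - conjugateIntegral g R θ₁ =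
      ∫ t, (Real.cot ((angle t - θ₂) / 2) - Real.cot ((angle t - θ₁) / 2)) * (R - g t) ∂haarT := by
  rw [conjugateIntegral, conjugateIntegral, ← integral_sub (h.integrable h₂) (h.integrable h₁)]
  simp only [sub_mul]

theorem integrable_cot_sub_cot (h : IsConstantOnArc g R a c) {θ₁ θ₂ : ℝ}
    (h₁ : θ₁ ∈ arcMiddle a c) (h₂ : θ₂ ∈ arcMiddle a c) : Integrable (fun t =>
      (Real.cot ((angle t - θ₂) / 2) - Real.cot ((angle t - θ₁) / 2)) * (R - g t)) haarT := by
  simp only [sub_mul]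
  exact (h.integrable h₂).sub (h.integrable h₁)

theorem abs_conjugateIntegral_sub_le (h : IsConstantOnArc g R a c) {θ₁ θ₂ : ℝ}
    (h₁ : θ₁ ∈ arcMiddle a c) (h₂ : θ₂ ∈ arcMiddle a c) (h₁₂ : θ₁ ≤ θ₂) :
    |conjugateIntegral g R θ₂ - conjugateIntegral g R θ₁| ≤ 200 / c ^ 2 * (θ₂ - θ₁) := by
  have hbound (t : Torus) : ‖(Real.cot ((angle t - θ₂) / 2) - Real.cot ((angle t - θ₁) / 2)) *
      (R - g t)‖ ≤ 200 / c ^ 2 * (θ₂ - θ₁) := by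
    by_cases ht : angle t ∈ Ioo a (a + c)
    · rw [h.eq_of_mem t ht, sub_self, mul_zero, norm_zero]
      exact mul_nonneg (by positivity) (sub_nonneg.2 h₁₂)
    · have hα : angle t ∈ Ico 0 (2 * Real.pi) := ⟨angle_nonneg t, angle_lt t⟩
      have hnonneg := h.cot_sub_cot_nonneg h₁ h₂ h₁₂ hα ht
      rw [norm_mul, Real.norm_of_nonneg hnonneg]
      exact (mul_le_of_le_one_right hnonneg (h.abs_sub_le t)).trans
        (h.cot_sub_cot_le h₁ h₂ h₁₂ hα ht)
  rw [h.conjugateIntegral_sub h₁ h₂]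
  simpa using norm_integral_le_of_norm_le_const (μ := haarT) (Eventually.of_forall hbound)

theorem lipschitzOnWith_conjugateIntegral (h : IsConstantOnArc g R a c) :
    LipschitzOnWith (200 / c ^ 2).toNNReal (conjugateIntegral g R) (arcMiddle a c) := by
  refine LipschitzOnWith.of_dist_le_mul fun θ₁ h₁ θ₂ h₂ => ?_
  rw [Real.coe_toNNReal _ (by positivity)]
  wlog h₁₂ : θ₁ ≤ θ₂ generalizing θ₁ θ₂
  · rw [dist_comm, dist_comm θ₁]
    exact this _ h₂ _ h₁ (le_of_not_ge h₁₂)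
  rw [dist_comm, dist_comm θ₁, Real.dist_eq, Real.dist_eq, abs_of_nonneg (sub_nonneg.2 h₁₂)]
  exact h.abs_conjugateIntegral_sub_le h₁ h₂ h₁₂

theorem indicator_sub_indicator_le (h : IsConstantOnArc g R a c) {δ : ℝ} (hδ0 : 0 ≤ δ)
    (hδ : ∀ t, angle t ∈ Ioo (a + c) (a + 2 * c) → δ ≤ R - g t) {Q : Set Torus}
    (hQ : ∀ t, t ∉ Q → 0 ≤ R - g t) (t : Torus) :
    (angle ⁻¹' Ioo (a + c) (a + 2 * c)).indicator (fun _ => δ / (10 * c)) t -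
        Q.indicator (fun _ => 67 / c) t ≤
      (Real.cot ((angle t - (a + 2 * c / 3)) / 2) - Real.cot ((angle t - (a + c / 3)) / 2)) *
        (R - g t) := by
  have hc := h.pos
  have hQ0 : 0 ≤ Q.indicator (fun _ => 67 / c) t := indicator_nonneg (fun _ _ => by positivity) t
  by_cases htI : angle t ∈ Ioo a (a + c)
  · have htA : t ∉ angle ⁻¹' Ioo (a + c) (a + 2 * c) := fun htA => htA.1.not_gt htI.2
    rw [h.eq_of_mem t htI, sub_self, mul_zero, indicator_of_notMem htA]
    linarith
  have hα : angle t ∈ Ico 0 (2 * Real.pi) := ⟨angle_nonneg t, angle_lt t⟩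
  have h₁₂ : a + c / 3 ≤ a + 2 * c / 3 := by linarith
  have hnonneg := h.cot_sub_cot_nonneg h.third_mem_arcMiddle h.two_thirds_mem_arcMiddle h₁₂ hα htI
  by_cases htA : t ∈ angle ⁻¹' Ioo (a + c) (a + 2 * c)
  · rw [indicator_of_mem htA]
    calc _ ≤ δ / (10 * c) := sub_le_self _ hQ0
      _ = 1 / (10 * c) * δ := by ring
      _ ≤ _ := mul_le_mul (h.le_cot_sub_cot htA) (hδ t htA) hδ0 hnonneg
  rw [indicator_of_notMem htA, zero_sub]
  by_cases htQ : t ∈ Q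
  · rw [indicator_of_mem htQ]
    have hle : 200 / c ^ 2 * (a + 2 * c / 3 - (a + c / 3)) ≤ 67 / c := by
      rw [show a + 2 * c / 3 - (a + c / 3) = c / 3 by ring, div_mul_eq_mul_div,
        div_le_div_iff₀ (by positivity) hc]
      nlinarith [mul_pos hc hc]
    have hub := (h.cot_sub_cot_le h.third_mem_arcMiddle h.two_thirds_mem_arcMiddle h₁₂ hα
      htI).trans hle
    nlinarith [neg_le_of_abs_le (h.abs_sub_le t)]
  · rw [indicator_of_notMem htQ, neg_zero]
    exact mul_nonneg hnonneg (hQ t htQ)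

theorem le_conjugateIntegral_sub (h : IsConstantOnArc g R a c) {δ : ℝ} (hδ0 : 0 ≤ δ)
    (hδ : ∀ t, angle t ∈ Ioo (a + c) (a + 2 * c) → δ ≤ R - g t) {Q : Set Torus}
    (hQm : MeasurableSet Q) (hQ : ∀ t, t ∉ Q → 0 ≤ R - g t) :
    δ / (20 * Real.pi) - 67 / c * haarT.real Q ≤
      conjugateIntegral g R (a + 2 * c / 3) - conjugateIntegral g R (a + c / 3) := by
  obtain ⟨hc, hca, ha⟩ := h.toIsShortArc
  set A : Set Torus := angle ⁻¹' Ioo (a + c) (a + 2 * c) with hA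
  have hAm : MeasurableSet A := measurable_angle measurableSet_Ioo
  have hAmeas : haarT.real A = c / (2 * Real.pi) := by
    rw [measureReal_def, hA, haarT_preimage_Ioo (by linarith) (by linarith [Real.pi_gt_three]),
      ENNReal.toReal_ofReal (div_nonneg (by linarith) (by positivity))]
    congr 1
    ring
  have hint {S : Set Torus} (hS : MeasurableSet S) (r : ℝ) :
      Integrable (S.indicator fun _ => r) haarT := (integrable_const r).indicator hS
  calc δ / (20 * Real.pi) - 67 / c * haarT.real Q
      = ∫ t, (A.indicator (fun _ => δ / (10 * c)) t - Q.indicator (fun _ => 67 / c) t) ∂haarT := by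
        rw [integral_sub (hint hAm _) (hint hQm _), integral_indicator_const _ hAm,
          integral_indicator_const _ hQm, hAmeas, smul_eq_mul, smul_eq_mul]
        field_simp
        ring
    _ ≤ _ := integral_mono ((hint hAm _).sub (hint hQm _))
        (h.integrable_cot_sub_cot h.third_mem_arcMiddle h.two_thirds_mem_arcMiddle)
        (h.indicator_sub_indicator_le hδ0 hδ hQ)
    _ = _ := (h.conjugateIntegral_sub h.third_mem_arcMiddle h.two_thirds_mem_arcMiddle).symm

end IsConstantOnArc

end ConjugateIntegral

section ArcIndex

/-- The angles of the `n`-th arc, of length `c n` and starting at `2⁻ⁿ`. -/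
def arc (c : ℕ → ℝ) (n : ℕ) : Set ℝ := Ioo ((1 / 2) ^ n) ((1 / 2) ^ n + c n)

/-- The index `n ≥ 1` of the arc that contains the angle `θ`, and `0` if there is none. -/
def arcIndex (c : ℕ → ℝ) (θ : ℝ) : ℕ := sInf {n | 1 ≤ n ∧ θ ∈ arc c n}

theorem two_mul_half_pow_le {m n : ℕ} (h : m < n) : 2 * (1 / 2 : ℝ) ^ n ≤ (1 / 2) ^ m := by
  have := pow_le_pow_of_le_one (by norm_num) (by norm_num : (1 / 2 : ℝ) ≤ 1) (Nat.succ_le_of_lt h)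
  rw [pow_succ] at this
  linarith

variable {c : ℕ → ℝ} {θ : ℝ} {m n : ℕ}

theorem eq_of_mem_arc (hc : ∀ n, 2 * c n ≤ (1 / 2) ^ n) (hm : θ ∈ arc c m)
    (hn : θ ∈ Ioo ((1 / 2) ^ n) ((1 / 2) ^ n + 2 * c n)) : m = n := by
  obtain ⟨hm₁, hm₂⟩ := hm
  obtain ⟨hn₁, hn₂⟩ := hn
  have hcm := hc m
  have hcn := hc n
  rcases lt_trichotomy m n with h | h | h
  · linarith [two_mul_half_pow_le h]
  · exact h
  · linarith [two_mul_half_pow_le h]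

theorem mem_arc_of_arcIndex_eq (hn : n ≠ 0) (h : arcIndex c θ = n) : θ ∈ arc c n := by
  subst h
  exact (Nat.sInf_mem (Nat.nonempty_of_pos_sInf (Nat.pos_of_ne_zero hn))).2

theorem arcIndex_eq_of_mem (hc : ∀ n, 2 * c n ≤ (1 / 2) ^ n) (hn : 1 ≤ n) (hθ : θ ∈ arc c n) :
    arcIndex c θ = n := by
  have hc0 : 0 < c n := pos_of_lt_add_right (hθ.1.trans hθ.2)
  have hsingle : {m | 1 ≤ m ∧ θ ∈ arc c m} = {n} := by
    refine eq_singleton_iff_unique_mem.2 ⟨⟨hn, hθ⟩, fun m hm => eq_of_mem_arc hc hm.2 ?_⟩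
    exact ⟨hθ.1, hθ.2.trans (by linarith)⟩
  rw [arcIndex, hsingle, csInf_singleton]

theorem arcIndex_eq_zero_of_mem (hc : ∀ n, 2 * c n ≤ (1 / 2) ^ n) (hc0 : 0 ≤ c n)
    (hθ : θ ∈ Ioo ((1 / 2) ^ n + c n) ((1 / 2) ^ n + 2 * c n)) : arcIndex c θ = 0 := by
  by_contra hne
  have hmem := mem_arc_of_arcIndex_eq hne rfl
  rw [eq_of_mem_arc hc hmem ⟨by linarith [hθ.1], hθ.2⟩] at hmem
  exact hθ.1.not_gt hmem.2

theorem preimage_arcIndex_singleton (hc : ∀ n, 2 * c n ≤ (1 / 2) ^ n) (hn : n ≠ 0) :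
    arcIndex c ⁻¹' {n} = arc c n :=
  Subset.antisymm (fun _ h => mem_arc_of_arcIndex_eq hn h)
    fun _ h => arcIndex_eq_of_mem hc (Nat.one_le_iff_ne_zero.2 hn) h

theorem measurable_arcIndex (hc : ∀ n, 2 * c n ≤ (1 / 2) ^ n) : Measurable (arcIndex c) := by
  have hne (n : ℕ) (hn : n ≠ 0) : MeasurableSet (arcIndex c ⁻¹' {n}) := by
    rw [preimage_arcIndex_singleton hc hn]
    exact measurableSet_Ioo
  refine measurable_to_countable' fun n => ?_
  rcases eq_or_ne n 0 with rfl | hn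
  · have hzero : arcIndex c ⁻¹' {0} = (⋃ n : ℕ, arcIndex c ⁻¹' {n + 1})ᶜ := by
      ext θ
      simp only [mem_preimage, mem_singleton_iff, mem_compl_iff, mem_iUnion, not_exists]
      exact ⟨fun h n => by omega, fun h => by_contra fun h0 => h (arcIndex c θ - 1) (by omega)⟩
    rw [hzero]
    exact (MeasurableSet.iUnion fun n => hne (n + 1) n.succ_ne_zero).compl
  · exact hne n hn

theorem eventually_mem_Ioo_iff {a b : ℝ} (ha : θ ≠ a) (hb : θ ≠ b) :
    ∀ᶠ θ' in 𝓝 θ, (θ' ∈ Ioo a b ↔ θ ∈ Ioo a b) := by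
  by_cases hmem : θ ∈ Ioo a b
  · filter_upwards [isOpen_Ioo.mem_nhds hmem] with θ' hθ'
    exact iff_of_true hθ' hmem
  · have hout : θ ∈ (Icc a b)ᶜ := fun h => hmem ⟨h.1.lt_of_ne ha.symm, h.2.lt_of_ne hb⟩
    filter_upwards [isClosed_Icc.isOpen_compl.mem_nhds hout] with θ' hθ'
    exact iff_of_false (fun h => hθ' (Ioo_subset_Icc_self h)) hmem

theorem eventually_forall_le_notMem_arc (hc : ∀ n, 2 * c n ≤ (1 / 2) ^ n) (hθ : 0 < θ) :
    ∃ N, ∀ᶠ θ' in 𝓝 θ, ∀ n, N ≤ n → θ' ∉ arc c n := by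
  obtain ⟨N, hN⟩ := exists_pow_lt_of_lt_one (half_pos (half_pos hθ))
    (by norm_num : (1 / 2 : ℝ) < 1)
  refine ⟨N, ?_⟩
  filter_upwards [lt_mem_nhds (half_lt_self hθ)] with θ' hθ' n hn hmem
  linarith [hmem.2, hc n,
    pow_le_pow_of_le_one (by norm_num) (by norm_num : (1 / 2 : ℝ) ≤ 1) hn]

theorem eventually_arcIndex_eq (hc : ∀ n, 2 * c n ≤ (1 / 2) ^ n) (hθ : 0 < θ)
    (hleft : ∀ n : ℕ, θ ≠ (1 / 2) ^ n) (hright : ∀ n : ℕ, θ ≠ (1 / 2) ^ n + c n) :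
    ∀ᶠ θ' in 𝓝 θ, arcIndex c θ' = arcIndex c θ := by
  obtain ⟨N, hN⟩ := eventually_forall_le_notMem_arc hc hθ
  have hlt : ∀ᶠ θ' in 𝓝 θ, ∀ n ∈ Finset.range N, (θ' ∈ arc c n ↔ θ ∈ arc c n) :=
    (Filter.eventually_all_finset _).2 fun n _ => eventually_mem_Ioo_iff (hleft n) (hright n)
  filter_upwards [hlt, hN] with θ' hiff hnot
  unfold arcIndex
  congr 1
  ext n
  refine and_congr_right fun _ => ?_
  rcases lt_or_ge n N with hn | hn
  · exact hiff n (Finset.mem_range.2 hn)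
  · exact iff_of_false (hnot n hn) (hN.self_of_nhds n hn)

end ArcIndex

section SquaringGrowth

theorem mul_self_le_two_pow {n : ℕ} (hn : 4 ≤ n) : n * n ≤ 2 ^ n := by
  induction n, hn using Nat.le_induction with
  | base => norm_num
  | succ k hk ih =>
    rw [pow_succ]
    nlinarith

variable {P : ℕ → ℝ}

theorem two_le_of_sq_le_succ (h0 : 2 ≤ P 0) (hP : ∀ n, P n ^ 2 ≤ P (n + 1)) (n : ℕ) :
    2 ≤ P n := by
  induction n with
  | zero => exact h0
  | succ n ih => nlinarith [hP n]

theorem two_pow_mul_le_of_sq_le_succ (h0 : 2 ≤ P 0) (hP : ∀ n, P n ^ 2 ≤ P (n + 1)) (n k : ℕ) :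
    2 ^ k * P n ≤ P (n + k) := by
  induction k with
  | zero => simp
  | succ k ih =>
    rw [← add_assoc, pow_succ]
    nlinarith [two_le_of_sq_le_succ h0 hP (n + k), hP (n + k)]

theorem monotone_of_sq_le_succ (h0 : 2 ≤ P 0) (hP : ∀ n, P n ^ 2 ≤ P (n + 1)) : Monotone P :=
  monotone_nat_of_le_succ fun n => by nlinarith [hP n, two_le_of_sq_le_succ h0 hP n]

theorem two_pow_two_pow_le_of_sq_le_succ (h0 : 2 ≤ P 0) (hP : ∀ n, P n ^ 2 ≤ P (n + 1)) (n : ℕ) :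
    2 ^ 2 ^ n ≤ P n := by
  induction n with
  | zero => simpa using h0
  | succ n ih =>
    rw [pow_succ 2 n, pow_mul]
    exact (pow_le_pow_left₀ (by positivity) ih 2).trans (hP n)

theorem tendsto_div_pow_of_sq_le_succ (h0 : 2 ≤ P 0) (hP : ∀ n, P n ^ 2 ≤ P (n + 1)) {B : ℝ}
    (hB : 0 < B) : Tendsto (fun n => P n / B ^ n) atTop atTop := by
  have htwo : Tendsto (fun n : ℕ => (2 : ℝ) ^ n) atTop atTop :=
    tendsto_pow_atTop_atTop_of_one_lt one_lt_two
  refine tendsto_atTop_mono' atTop ?_ htwo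
  filter_upwards [htwo.eventually_ge_atTop (2 * B), eventually_ge_atTop 4] with n hn hn4
  rw [le_div_iff₀ (by positivity), ← mul_pow]
  calc (2 * B) ^ n ≤ ((2 : ℝ) ^ n) ^ n := pow_le_pow_left₀ (by positivity) hn n
    _ = (2 : ℝ) ^ (n * n) := (pow_mul _ _ _).symm
    _ ≤ (2 : ℝ) ^ (2 ^ n) := pow_le_pow_right₀ one_le_two (mul_self_le_two_pow hn4)
    _ ≤ P n := two_pow_two_pow_le_of_sq_le_succ h0 hP n

end SquaringGrowth

section LevelSequence

theorem modular_comp_nat {Ω : Type*} [MeasurableSpace Ω] (Ψ : OrliczFunction) (μ : Measure Ω)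
    {k : Ω → ℕ} (hk : Measurable k) (y : ℕ → ℂ) (C : ℝ) :
    modular Ψ μ (fun t => y (k t)) C =
      ∑' n, ENNReal.ofReal (Ψ (‖y n‖ / C)) * μ (k ⁻¹' {n}) := by
  rw [modular, ← lintegral_map (f := fun n => ENNReal.ofReal (Ψ (‖y n‖ / C))) measurable_from_nat
    hk, lintegral_countable']
  exact tsum_congr fun n => by rw [Measure.map_apply hk (measurableSet_singleton n)]

/-- A geometric sequence along which `Ψ` grows at least like an iterated square; the initial value
only has to be large. -/
structure IsLevelSequence (Ψ : OrliczFunction) (α : ℝ) (s : ℕ → ℝ) : Prop where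
  one_lt : 1 < α
  pos_zero : 0 < s 0
  succ : ∀ n, s (n + 1) = α * s n
  base : 2000 ≤ Ψ (s 0)
  sq_le : ∀ n, Ψ (s n) ^ 2 ≤ Ψ (s (n + 1))

theorem OrliczFunction.DeltaSupTwo.exists_isLevelSequence {Ψ : OrliczFunction}
    (hΨ : Ψ.DeltaSupTwo) : ∃ (α : ℝ) (s : ℕ → ℝ), IsLevelSequence Ψ α s := by
  obtain ⟨α, hα, h⟩ := hΨ
  obtain ⟨x, hx⟩ := eventually_atTop.1
    (h.and ((Ψ.tendsto_atTop.eventually_ge_atTop 2000).and (eventually_gt_atTop 0)))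
  obtain ⟨-, hbase, hx0⟩ := hx x le_rfl
  have hsucc (n : ℕ) : x * α ^ (n + 1) = α * (x * α ^ n) := by ring
  refine ⟨α, fun n => x * α ^ n, hα, by simpa using hx0, hsucc, by simpa using hbase, fun n => ?_⟩
  rw [hsucc]
  exact (hx (x * α ^ n) (le_mul_of_one_le_right hx0.le (one_le_pow₀ hα.le))).1

/-- The length of the `n`-th arc. -/
def arcLength (Ψ : OrliczFunction) (s : ℕ → ℝ) (n : ℕ) : ℝ := 1 / Ψ (s (2 * n))

/-- The modulus of the symbol on the `n`-th arc, and off the arcs for `n = 0`. -/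
def modulusValue (Ψ : OrliczFunction) (s : ℕ → ℝ) (n : ℕ) : ℝ := 1 - 2 / Ψ (s n)

/-- The index of the arc that contains a point of the circle. -/
def levelIndex (Ψ : OrliczFunction) (s : ℕ → ℝ) (t : Torus) : ℕ :=
  arcIndex (arcLength Ψ s) (angle t)

/-- The logarithm of the modulus of the symbol on the circle. -/
def logModulus (Ψ : OrliczFunction) (s : ℕ → ℝ) (t : Torus) : ℝ :=
  Real.log (modulusValue Ψ s (levelIndex Ψ s t))

/-- The boundary values of the symbol, at almost every point. -/
def symbolBoundary (Ψ : OrliczFunction) (s : ℕ → ℝ) (t : Torus) : ℂ :=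
  Complex.exp (herglotzBoundary (logModulus Ψ s) t)

/-- The argument of the symbol on the `n`-th arc. -/
def symbolArg (Ψ : OrliczFunction) (s : ℕ → ℝ) (n : ℕ) (θ : ℝ) : ℝ :=
  conjugateIntegral (logModulus Ψ s) (Real.log (modulusValue Ψ s n)) θ

namespace IsLevelSequence

variable {Ψ : OrliczFunction} {α : ℝ} {s : ℕ → ℝ}

theorem pos (H : IsLevelSequence Ψ α s) (n : ℕ) : 0 < s n := by
  induction n with
  | zero => exact H.pos_zero
  | succ n ih =>
    rw [H.succ]
    exact mul_pos (one_pos.trans H.one_lt) ih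

theorem monotone (H : IsLevelSequence Ψ α s) : Monotone s := monotone_nat_of_le_succ fun n => by
  rw [H.succ]
  exact le_mul_of_one_le_left (H.pos n).le H.one_lt.le

theorem apply_add (H : IsLevelSequence Ψ α s) (n k : ℕ) : s (n + k) = α ^ k * s n := by
  induction k with
  | zero => simp
  | succ k ih =>
    rw [← add_assoc, H.succ, ih]
    ring

theorem two_le_base (H : IsLevelSequence Ψ α s) : 2 ≤ Ψ (s 0) := by linarith [H.base]

theorem two_pow_mul_le (H : IsLevelSequence Ψ α s) (n k : ℕ) : 2 ^ k * Ψ (s n) ≤ Ψ (s (n + k)) :=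
  two_pow_mul_le_of_sq_le_succ (P := fun n => Ψ (s n)) H.two_le_base H.sq_le n k

theorem monotone_apply (H : IsLevelSequence Ψ α s) : Monotone fun n => Ψ (s n) :=
  monotone_of_sq_le_succ H.two_le_base H.sq_le

theorem le_apply (H : IsLevelSequence Ψ α s) (n : ℕ) : 2000 ≤ Ψ (s n) :=
  H.base.trans (H.monotone_apply (Nat.zero_le n))

theorem tendsto_div_pow (H : IsLevelSequence Ψ α s) {B : ℝ} (hB : 0 < B) :
    Tendsto (fun n => Ψ (s n) / B ^ n) atTop atTop :=
  tendsto_div_pow_of_sq_le_succ H.two_le_base H.sq_le hB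

theorem tendsto (H : IsLevelSequence Ψ α s) : Tendsto (fun n => Ψ (s n)) atTop atTop := by
  simpa using H.tendsto_div_pow one_pos

theorem tendsto_div_rpow (H : IsLevelSequence Ψ α s) (p : ℝ) :
    Tendsto (fun n => Ψ (s n) / s (2 * n + 2) ^ p) atTop atTop := by
  have hα : 0 < α := one_pos.trans H.one_lt
  have hs := H.pos 2
  refine ((H.tendsto_div_pow (B := (α ^ 2) ^ p) (by positivity)).atTop_div_const
    (Real.rpow_pos_of_pos hs p)).congr fun n => ?_
  rw [add_comm, H.apply_add, Real.mul_rpow (by positivity) hs.le, pow_mul,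
    Real.rpow_pow_comm (by positivity), div_div]

theorem arcLength_pos (H : IsLevelSequence Ψ α s) (n : ℕ) : 0 < arcLength Ψ s n :=
  one_div_pos.2 (by linarith [H.le_apply (2 * n)])

theorem two_mul_arcLength_le (H : IsLevelSequence Ψ α s) (n : ℕ) :
    2 * arcLength Ψ s n ≤ (1 / 2) ^ n := by
  have h2n := H.two_pow_mul_le n n
  rw [← two_mul] at h2n
  have hpow : (1 : ℝ) ≤ 2 ^ n := one_le_pow₀ one_le_two
  rw [arcLength, mul_one_div, one_div_pow,
    div_le_div_iff₀ (by linarith [H.le_apply (2 * n)]) (by positivity)]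
  nlinarith [H.le_apply n]

theorem isShortArc (H : IsLevelSequence Ψ α s) {n : ℕ} (hn : 1 ≤ n) :
    IsShortArc ((1 / 2) ^ n) (arcLength Ψ s n) where
  pos := H.arcLength_pos n
  two_mul_le := H.two_mul_arcLength_le n
  le_half := pow_le_of_le_one (by norm_num) (by norm_num) (Nat.one_le_iff_ne_zero.1 hn)

theorem half_le_modulusValue (H : IsLevelSequence Ψ α s) (n : ℕ) :
    1 / 2 ≤ modulusValue Ψ s n := by
  have hle : 2 / Ψ (s n) ≤ 1 / 2 :=
    (div_le_div_iff₀ (by linarith [H.le_apply n]) two_pos).2 (by linarith [H.le_apply n])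
  rw [modulusValue]
  linarith

theorem modulusValue_pos (H : IsLevelSequence Ψ α s) (n : ℕ) : 0 < modulusValue Ψ s n :=
  one_half_pos.trans_le (H.half_le_modulusValue n)

theorem modulusValue_lt_one (H : IsLevelSequence Ψ α s) (n : ℕ) : modulusValue Ψ s n < 1 :=
  sub_lt_self _ (div_pos two_pos (by linarith [H.le_apply n]))

theorem half_le_modulusValue_pow (H : IsLevelSequence Ψ α s) {n N : ℕ} (hN : 4 * N ≤ Ψ (s n)) :
    1 / 2 ≤ modulusValue Ψ s n ^ N := by
  have hΨ := H.le_apply n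
  have hle : N * (2 / Ψ (s n)) ≤ 1 / 2 := by
    rw [mul_div_assoc', div_le_div_iff₀ (by linarith) two_pos]
    linarith
  have hbernoulli := one_add_mul_le_pow (a := -(2 / Ψ (s n)))
    (by linarith [(div_le_one (by linarith)).2 (show 2 ≤ Ψ (s n) by linarith)]) N
  rw [← sub_eq_add_neg] at hbernoulli
  rw [modulusValue]
  linarith

theorem log_modulusValue_neg (H : IsLevelSequence Ψ α s) (n : ℕ) :
    Real.log (modulusValue Ψ s n) < 0 :=
  Real.log_neg (H.modulusValue_pos n) (H.modulusValue_lt_one n)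

theorem neg_one_le_log_modulusValue (H : IsLevelSequence Ψ α s) (n : ℕ) :
    -1 ≤ Real.log (modulusValue Ψ s n) := by
  have hinv : (modulusValue Ψ s n)⁻¹ ≤ 2 := by
    rw [inv_le_comm₀ (H.modulusValue_pos n) two_pos, inv_eq_one_div]
    exact H.half_le_modulusValue n
  linarith [Real.one_sub_inv_le_log_of_pos (H.modulusValue_pos n)]

theorem log_modulusValue_mono (H : IsLevelSequence Ψ α s) :
    Monotone fun n => Real.log (modulusValue Ψ s n) := fun m n hmn => by
  refine Real.log_le_log (H.modulusValue_pos m) ?_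
  have hm := H.le_apply m
  have hle : Ψ (s m) ≤ Ψ (s n) := H.monotone_apply hmn
  unfold modulusValue
  gcongr

theorem log_modulusValue_zero_lt_one (H : IsLevelSequence Ψ α s) :
    Real.log (modulusValue Ψ s 0) < Real.log (modulusValue Ψ s 1) := by
  have hlt : Ψ (s 0) < Ψ (s 1) := by nlinarith [H.sq_le 0, H.base]
  exact Real.log_lt_log (H.modulusValue_pos 0)
    (sub_lt_sub_left (div_lt_div_of_pos_left two_pos (by linarith [H.base]) hlt) 1)

theorem measurable_levelIndex (H : IsLevelSequence Ψ α s) : Measurable (levelIndex Ψ s) :=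
  (measurable_arcIndex H.two_mul_arcLength_le).comp measurable_angle

theorem measurable_logModulus (H : IsLevelSequence Ψ α s) : Measurable (logModulus Ψ s) :=
  (measurable_from_nat (f := fun n => Real.log (modulusValue Ψ s n))).comp H.measurable_levelIndex

theorem integrable_logModulus (H : IsLevelSequence Ψ α s) : Integrable (logModulus Ψ s) haarT :=
  Integrable.of_bound H.measurable_logModulus.aestronglyMeasurable 1 <|
    Eventually.of_forall fun _ => abs_le.2 ⟨H.neg_one_le_log_modulusValue _,
      (H.log_modulusValue_neg _).le.trans zero_le_one⟩

theorem ae_eventually_logModulus_eq (H : IsLevelSequence Ψ α s) :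
    ∀ᵐ t₀ ∂haarT, ∀ᶠ t in 𝓝 t₀, logModulus Ψ s t = logModulus Ψ s t₀ := by
  have hZ : ({0} ∪ range (fun n : ℕ => (1 / 2 : ℝ) ^ n) ∪
      range fun n : ℕ => (1 / 2 : ℝ) ^ n + arcLength Ψ s n).Countable :=
    ((countable_singleton _).union (countable_range _)).union (countable_range _)
  filter_upwards [ae_angle_notMem hZ] with t₀ ht₀
  simp only [mem_union, mem_singleton_iff, mem_range, not_or, not_exists] at ht₀
  obtain ⟨⟨hzero, hleft⟩, hright⟩ := ht₀
  filter_upwards [(continuousAt_angle hzero).eventually (eventually_arcIndex_eq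
    H.two_mul_arcLength_le ((angle_nonneg t₀).lt_of_ne' hzero) (fun n => Ne.symm (hleft n))
    fun n => Ne.symm (hright n))] with t ht
  rw [logModulus, levelIndex, ht]
  rfl

theorem norm_symbolBoundary (H : IsLevelSequence Ψ α s) (t : Torus) :
    ‖symbolBoundary Ψ s t‖ = modulusValue Ψ s (levelIndex Ψ s t) := by
  rw [symbolBoundary, Complex.norm_exp, re_herglotzBoundary, logModulus,
    Real.exp_log (H.modulusValue_pos _)]

theorem haarT_levelIndex_preimage_le (H : IsLevelSequence Ψ α s) {n : ℕ} (hn : 1 ≤ n) :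
    haarT (levelIndex Ψ s ⁻¹' {n}) ≤ ENNReal.ofReal (arcLength Ψ s n) := by
  obtain ⟨hpos, hle, hhalf⟩ := H.isShortArc hn
  have hset : levelIndex Ψ s ⁻¹' {n} = angle ⁻¹' arc (arcLength Ψ s) n := by
    rw [← preimage_arcIndex_singleton H.two_mul_arcLength_le (Nat.one_le_iff_ne_zero.1 hn)]
    rfl
  rw [hset, arc, haarT_preimage_Ioo (by positivity) (by linarith [Real.pi_gt_three]),
    add_sub_cancel_left]
  exact ENNReal.ofReal_le_ofReal (div_le_self hpos.le (by linarith [Real.pi_gt_three]))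

theorem apply_mul_arcLength_le (H : IsLevelSequence Ψ α s) {n : ℕ} (hn : 1 ≤ n) {x : ℝ}
    (hx0 : 0 ≤ x) (hx : x ≤ s (2 * n - 1)) : Ψ x * arcLength Ψ s n ≤ (1 / 2) ^ n := by
  have hsq := H.sq_le (2 * n - 1)
  rw [show 2 * n - 1 + 1 = 2 * n by omega] at hsq
  have hpow : 2 ^ n ≤ Ψ (s (2 * n - 1)) := by
    have h := H.two_pow_mul_le (n - 1) n
    rw [show n - 1 + n = 2 * n - 1 by omega] at h
    nlinarith [H.le_apply (n - 1), one_le_pow₀ one_le_two (M₀ := ℝ) (n := n)]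
  rw [arcLength, mul_one_div, one_div_pow,
    div_le_div_iff₀ (by linarith [H.le_apply (2 * n)]) (by positivity), one_mul]
  calc _ ≤ Ψ (s (2 * n - 1)) * Ψ (s (2 * n - 1)) :=
        mul_le_mul (Ψ.mono hx0 hx) hpow (by positivity) (by linarith [H.le_apply (2 * n - 1)])
    _ ≤ _ := by rwa [← sq]

theorem modular_lt_top (H : IsLevelSequence Ψ α s) {C : ℝ} (hC : 0 < C) :
    modular Ψ haarT (fun t => (s (levelIndex Ψ s t) : ℂ)) C < ⊤ := by
  obtain ⟨j, hj⟩ := pow_unbounded_of_one_lt (1 / C) H.one_lt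
  have hle {n : ℕ} (hn : j < n) : s n / C ≤ s (2 * n - 1) := by
    refine le_trans ?_ (H.monotone (show n + j ≤ 2 * n - 1 by omega))
    rw [H.apply_add, div_eq_mul_one_div, mul_comm]
    exact mul_le_mul_of_nonneg_right hj.le (H.pos n).le
  have hsum : Summable fun n => if n ≤ j then Ψ (s n / C) else (1 / 2 : ℝ) ^ n := by
    refine (summable_congr_cofinite ?_).2 summable_geometric_two
    rw [Nat.cofinite_eq_atTop]
    filter_upwards [eventually_gt_atTop j] with n hn
    rw [if_neg hn.not_ge]
  rw [modular_comp_nat Ψ haarT H.measurable_levelIndex fun n => (s n : ℂ)]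
  refine lt_of_le_of_lt (ENNReal.tsum_le_tsum fun n => ?_) hsum.tsum_ofReal_lt_top
  rw [Complex.norm_real, Real.norm_of_nonneg (H.pos n).le]
  split_ifs with hn
  · exact mul_le_of_le_one_right zero_le prob_le_one
  · have hn1 : 1 ≤ n := by omega
    have hx0 : 0 ≤ s n / C := div_nonneg (H.pos n).le hC.le
    calc _ ≤ ENNReal.ofReal (Ψ (s n / C)) * ENNReal.ofReal (arcLength Ψ s n) := by
          gcongr
          exact H.haarT_levelIndex_preimage_le hn1
      _ = ENNReal.ofReal (Ψ (s n / C) * arcLength Ψ s n) :=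
          (ENNReal.ofReal_mul (Ψ.nonneg hx0)).symm
      _ ≤ _ := ENNReal.ofReal_le_ofReal (H.apply_mul_arcLength_le hn1 hx0 (hle (not_le.1 hn)))

theorem controlledSymbol (H : IsLevelSequence Ψ α s) :
    ControlledSymbol Ψ (fun z => Complex.exp (herglotz (logModulus Ψ s) z)) (symbolBoundary Ψ s)
      fun t => s (levelIndex Ψ s t) where
  differentiableOn := (differentiableOn_herglotz H.integrable_logModulus).cexp
  mapsTo := fun z hz => by
    rw [mem_ball_zero_iff, Complex.norm_exp, Real.exp_lt_one_iff]
    exact re_herglotz_neg H.integrable_logModulus (fun t => H.log_modulusValue_neg _) hz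
  tendsto := by
    filter_upwards [H.ae_eventually_logModulus_eq] with t ht
    exact (Complex.continuous_exp.tendsto _).comp
      ((tendsto_herglotz H.integrable_logModulus ht).comp (tendsto_nhdsWithin_iff.2
        ⟨tendsto_radius_mul _, Eventually.of_forall fun j =>
          radius_mul_mem_disk j (norm_circlePoint t).le⟩))
  measurable := measurable_from_nat.comp H.measurable_levelIndex
  pos := fun t => H.pos _
  norm_le := Eventually.of_forall fun t => (H.norm_symbolBoundary t).le
  modular_lt_top := fun _ hC => H.modular_lt_top hC

theorem isPiecewiseConstant (H : IsLevelSequence Ψ α s) :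
    IsPiecewiseConstant fun t => modulusValue Ψ s (levelIndex Ψ s t) :=
  ⟨modulusValue Ψ s, fun n => levelIndex Ψ s ⁻¹' {n},
    fun n => ⟨H.modulusValue_pos n, H.modulusValue_lt_one n⟩,
    fun n => H.measurable_levelIndex (measurableSet_singleton n),
    fun _ _ hmn => Disjoint.preimage _ (disjoint_singleton.2 hmn),
    eq_univ_of_forall fun _ => mem_iUnion.2 ⟨_, rfl⟩,
    fun _ _ ht => congrArg (modulusValue Ψ s) ht⟩

end IsLevelSequence

end LevelSequence

section Winding

namespace IsLevelSequence

variable {Ψ : OrliczFunction} {α : ℝ} {s : ℕ → ℝ}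

theorem levelIndex_eq (H : IsLevelSequence Ψ α s) {n : ℕ} (hn : 1 ≤ n) {t : Torus}
    (ht : angle t ∈ arc (arcLength Ψ s) n) : levelIndex Ψ s t = n :=
  arcIndex_eq_of_mem H.two_mul_arcLength_le hn ht

theorem isConstantOnArc (H : IsLevelSequence Ψ α s) {n : ℕ} (hn : 1 ≤ n) :
    IsConstantOnArc (logModulus Ψ s) (Real.log (modulusValue Ψ s n)) ((1 / 2) ^ n)
      (arcLength Ψ s n) where
  toIsShortArc := H.isShortArc hn
  measurable := H.measurable_logModulus
  eq_of_mem t ht := by rw [logModulus, H.levelIndex_eq hn ht]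
  abs_sub_le t := by
    have hneg := H.log_modulusValue_neg
    have hge := H.neg_one_le_log_modulusValue
    rw [logModulus, abs_le]
    constructor <;> linarith [hneg n, hge n, hneg (levelIndex Ψ s t), hge (levelIndex Ψ s t)]

theorem symbolBoundary_eq (H : IsLevelSequence Ψ α s) {n : ℕ} (hn : 1 ≤ n) {t : Torus}
    (ht : angle t ∈ arc (arcLength Ψ s) n) : symbolBoundary Ψ s t =
      modulusValue Ψ s n * Complex.exp (symbolArg Ψ s n (angle t) * Complex.I) := by
  rw [symbolBoundary, herglotzBoundary_eq, (H.isConstantOnArc hn).eq_of_mem t ht, Complex.exp_add,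
    ← Complex.ofReal_exp, Real.exp_log (H.modulusValue_pos n), symbolArg]

theorem haarT_real_lt_levelIndex_le (H : IsLevelSequence Ψ α s) (n : ℕ) :
    haarT.real {t | n < levelIndex Ψ s t} ≤ 2 * arcLength Ψ s n / Ψ (s (2 * n)) := by
  have hset : {t | n < levelIndex Ψ s t} = ⋃ k : ℕ, levelIndex Ψ s ⁻¹' {n + 1 + k} := by
    ext t
    simp only [mem_ofPred_eq, mem_iUnion, mem_preimage, mem_singleton_iff]
    exact ⟨fun h => ⟨levelIndex Ψ s t - (n + 1), by omega⟩, fun ⟨k, hk⟩ => by omega⟩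
  have h2n := H.le_apply (2 * n)
  have hlen (k : ℕ) : arcLength Ψ s (n + 1 + k) ≤
      arcLength Ψ s n / Ψ (s (2 * n)) * (1 / 2) ^ k := by
    rw [arcLength, arcLength, div_div, ← sq, one_div_pow, div_mul_div_comm, one_mul,
      show 2 * (n + 1 + k) = 2 * n + 1 + (2 * k + 1) by ring]
    refine one_div_le_one_div_of_le (by positivity) (le_trans ?_ (H.two_pow_mul_le _ _))
    rw [mul_comm]
    exact mul_le_mul (pow_le_pow_right₀ one_le_two (by omega)) (H.sq_le _) (by positivity)
      (by positivity)
  have hnonneg : 0 ≤ arcLength Ψ s n / Ψ (s (2 * n)) :=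
    div_nonneg (H.arcLength_pos n).le (by linarith)
  rw [measureReal_def, hset, mul_div_assoc]
  refine ENNReal.toReal_le_of_le_ofReal (by positivity) ?_
  calc _ ≤ ∑' k : ℕ, haarT (levelIndex Ψ s ⁻¹' {n + 1 + k}) := measure_iUnion_le _
    _ ≤ ∑' k : ℕ, ENNReal.ofReal (arcLength Ψ s n / Ψ (s (2 * n)) * (1 / 2) ^ k) :=
        ENNReal.tsum_le_tsum fun k => (H.haarT_levelIndex_preimage_le (by omega)).trans
          (ENNReal.ofReal_le_ofReal (hlen k))
    _ = ENNReal.ofReal (∑' k : ℕ, arcLength Ψ s n / Ψ (s (2 * n)) * (1 / 2) ^ k) :=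
        (ENNReal.ofReal_tsum_of_nonneg (fun k => by positivity)
          (summable_geometric_two.mul_left _)).symm
    _ = _ := by rw [tsum_mul_left, tsum_geometric_two, mul_comm]

theorem le_symbolArg_sub (H : IsLevelSequence Ψ α s) {n : ℕ} (hn : 1 ≤ n) :
    (Real.log (modulusValue Ψ s 1) - Real.log (modulusValue Ψ s 0)) / (20 * Real.pi) -
        134 / Ψ (s (2 * n)) ≤
      symbolArg Ψ s n ((1 / 2) ^ n + 2 * arcLength Ψ s n / 3) -
        symbolArg Ψ s n ((1 / 2) ^ n + arcLength Ψ s n / 3) := by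
  have hc := H.arcLength_pos n
  have hlater : 67 / arcLength Ψ s n * haarT.real {t | n < levelIndex Ψ s t} ≤
      134 / Ψ (s (2 * n)) := by
    calc _ ≤ 67 / arcLength Ψ s n * (2 * arcLength Ψ s n / Ψ (s (2 * n))) := by
          gcongr
          exact H.haarT_real_lt_levelIndex_le n
      _ = _ := by
          field_simp
          norm_num
  refine le_trans (sub_le_sub_left hlater _) ((H.isConstantOnArc hn).le_conjugateIntegral_sub
    (sub_nonneg.2 H.log_modulusValue_zero_lt_one.le) (fun t ht => ?_)
    (H.measurable_levelIndex measurableSet_Ioi) fun t ht => ?_)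
  · have hzero : levelIndex Ψ s t = 0 := arcIndex_eq_zero_of_mem H.two_mul_arcLength_le hc.le ht
    rw [logModulus, hzero]
    exact sub_le_sub_right (H.log_modulusValue_mono hn) _
  · exact sub_nonneg.2 (H.log_modulusValue_mono (not_lt.1 ht))

theorem exists_winding (H : IsLevelSequence Ψ α s) : ∃ δ : ℝ, 0 < δ ∧ δ ≤ 1 ∧ ∀ᶠ n in atTop,
    δ ≤ symbolArg Ψ s n ((1 / 2) ^ n + 2 * arcLength Ψ s n / 3) -
      symbolArg Ψ s n ((1 / 2) ^ n + arcLength Ψ s n / 3) := by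
  set d : ℝ := Real.log (modulusValue Ψ s 1) - Real.log (modulusValue Ψ s 0)
  have hd0 : 0 < d := sub_pos.2 H.log_modulusValue_zero_lt_one
  have hd1 : d ≤ 1 := by linarith [H.log_modulusValue_neg 1, H.neg_one_le_log_modulusValue 0]
  have hδ0 : 0 < d / (40 * Real.pi) := by positivity
  refine ⟨d / (40 * Real.pi), hδ0,
    (div_le_one (by positivity)).2 (by linarith [Real.pi_gt_three]), ?_⟩
  have hlim : Tendsto (fun n => Ψ (s (2 * n))) atTop atTop :=
    H.tendsto.comp (tendsto_id.const_mul_atTop' two_pos)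
  filter_upwards [hlim.eventually_ge_atTop (134 / (d / (40 * Real.pi))), eventually_ge_atTop 1]
    with n hn hn1
  have hsmall : 134 / Ψ (s (2 * n)) ≤ d / (40 * Real.pi) := by
    rwa [div_le_comm₀ (by linarith [H.le_apply (2 * n)]) hδ0]
  have hsplit : d / (20 * Real.pi) = d / (40 * Real.pi) + d / (40 * Real.pi) := by
    field_simp
    norm_num
  linarith [H.le_symbolArg_sub hn1]

theorem le_norm_fejerPeak_symbolBoundary (H : IsLevelSequence Ψ α s) {n N : ℕ} (hn : 1 ≤ n)
    (hN : N ≠ 0) (hNn : 4 * N ≤ Ψ (s n)) {θ : ℝ}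
    (hθ : θ ∈ arcMiddle ((1 / 2) ^ n) (arcLength Ψ s n)) {t : Torus}
    (ht : angle t ∈ arcMiddle ((1 / 2) ^ n) (arcLength Ψ s n))
    (hdist : dist (angle t) θ ≤ arcLength Ψ s n ^ 2 / (400 * N)) :
    1 / 16 ≤ ‖fejerPeak N (symbolArg Ψ s n θ) (symbolBoundary Ψ s t)‖ := by
  have hc := H.arcLength_pos n
  have htI : angle t ∈ arc (arcLength Ψ s) n := ⟨by linarith [ht.1], by linarith [ht.2]⟩
  rw [H.symbolBoundary_eq hn htI]
  refine le_norm_fejerPeak hN (H.modulusValue_pos n).le (H.modulusValue_lt_one n).le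
    (H.half_le_modulusValue_pow hNn) ?_
  have hlip := (H.isConstantOnArc hn).lipschitzOnWith_conjugateIntegral.dist_le_mul _ ht _ hθ
  rw [Real.coe_toNNReal _ (by positivity)] at hlip
  calc N * dist (symbolArg Ψ s n (angle t)) (symbolArg Ψ s n θ)
      ≤ N * (200 / arcLength Ψ s n ^ 2 * (arcLength Ψ s n ^ 2 / (400 * N))) := by
        gcongr
        exact hlip.trans (by gcongr)
    _ = 1 / 2 := by
        field_simp
        norm_num

theorem lt_haarT_preimage_ball (H : IsLevelSequence Ψ α s) {n N : ℕ} (hN : N ≠ 0)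
    (hNn : 4 * N ≤ Ψ (s n)) {θ : ℝ} (hθ : 0 ≤ θ - arcLength Ψ s n ^ 2 / (400 * N))
    (hθ' : θ + arcLength Ψ s n ^ 2 / (400 * N) ≤ 2 * Real.pi) :
    ENNReal.ofReal (1 / Ψ (s (2 * n + 2))) <
      haarT (angle ⁻¹' Metric.ball θ (arcLength Ψ s n ^ 2 / (400 * N))) := by
  have hP := H.le_apply (2 * n)
  have : (0 : ℝ) < N := Nat.cast_pos.2 (Nat.pos_of_ne_zero hN)
  have hNP : N ≤ Ψ (s (2 * n)) := by
    linarith [H.monotone_apply (show n ≤ 2 * n by omega)]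
  rw [Real.ball_eq_Ioo, haarT_preimage_Ioo hθ hθ', arcLength]
  set P : ℝ := Ψ (s (2 * n))
  have hlength : (θ + (1 / P) ^ 2 / (400 * N) - (θ - (1 / P) ^ 2 / (400 * N))) / (2 * Real.pi) =
      1 / (400 * Real.pi * N * P ^ 2) := by
    field_simp
    ring
  rw [hlength]
  refine (ENNReal.ofReal_lt_ofReal_iff (by positivity)).2
    (one_div_lt_one_div_of_lt (by positivity) ?_)
  calc 400 * Real.pi * N * P ^ 2 ≤ 400 * 3.15 * P * P ^ 2 := by
        gcongr
        exact Real.pi_lt_d2.le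
    _ < P * P * P ^ 2 := by
        gcongr
        linarith
    _ = (P ^ 2) ^ 2 := by ring
    _ ≤ Ψ (s (2 * n + 1)) ^ 2 := by
        gcongr
        exact H.sq_le _
    _ ≤ _ := H.sq_le _

theorem exists_large_peaks (H : IsLevelSequence Ψ α s) {n N : ℕ} (hn : 1 ≤ n) (hN : N ≠ 0)
    (hNn : 4 * N ≤ Ψ (s n)) {δ : ℝ}
    (hδ : δ ≤ symbolArg Ψ s n ((1 / 2) ^ n + 2 * arcLength Ψ s n / 3) -
      symbolArg Ψ s n ((1 / 2) ^ n + arcLength Ψ s n / 3)) :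
    ∃ v : ℝ, ∀ x : ℝ, 0 ≤ x → x ≤ δ → ENNReal.ofReal (1 / Ψ (s (2 * n + 2))) <
      haarT {t | 1 / 16 ≤ ‖fejerPeak N (v + x) (symbolBoundary Ψ s t)‖} := by
  obtain ⟨hc, hca, ha⟩ := H.isShortArc hn
  set a : ℝ := (1 / 2) ^ n
  set c : ℝ := arcLength Ψ s n
  have hsub : Icc (a + c / 3) (a + 2 * c / 3) ⊆ arcMiddle a c :=
    Icc_subset_Icc (by linarith) (by linarith)
  have hcont : ContinuousOn (symbolArg Ψ s n) (Icc (a + c / 3) (a + 2 * c / 3)) :=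
    (H.isConstantOnArc hn).lipschitzOnWith_conjugateIntegral.continuousOn.mono hsub
  refine ⟨symbolArg Ψ s n (a + c / 3), fun x hx0 hxδ => ?_⟩
  obtain ⟨θ, hθ, hargθ⟩ : symbolArg Ψ s n (a + c / 3) + x ∈
      symbolArg Ψ s n '' Icc (a + c / 3) (a + 2 * c / 3) :=
    intermediate_value_Icc (by linarith) hcont ⟨by linarith, by linarith⟩
  have hw : c ^ 2 / (400 * N) ≤ c / 6 := by
    have hNr : (1 : ℝ) ≤ N := Nat.one_le_cast.2 (Nat.one_le_iff_ne_zero.2 hN)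
    rw [div_le_div_iff₀ (by positivity) (by norm_num)]
    nlinarith
  refine (H.lt_haarT_preimage_ball hN hNn (θ := θ) (by linarith [hθ.1])
    (by linarith [hθ.2, Real.pi_gt_three])).trans_le (measure_mono fun t ht => ?_)
  have hball : angle t ∈ Metric.ball θ (c ^ 2 / (400 * N)) := ht
  have hmid : angle t ∈ arcMiddle a c := by
    rw [Real.ball_eq_Ioo] at hball
    exact ⟨by linarith [hball.1, hθ.1], by linarith [hball.2, hθ.2]⟩
  rw [mem_ofPred_eq, ← hargθ]
  exact H.le_norm_fejerPeak_symbolBoundary hn hN hNn (hsub hθ) hmid (Metric.mem_ball.1 hball).le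

end IsLevelSequence

end Winding

section Summing

theorem exists_peak_counts {δ P : ℝ} (hδ0 : 0 < δ) (hδ1 : δ ≤ 1) (hP : 32 * Real.pi / δ ≤ P) :
    ∃ M N : ℕ, N ≠ 0 ∧ M ≤ N ∧ 4 * N ≤ P ∧ 2 * Real.pi * M / N ≤ δ ∧
      δ / (32 * Real.pi) * P ≤ M := by
  have hPδ : 32 * Real.pi ≤ P * δ := (div_le_iff₀ hδ0).1 hP
  have hP8 : 8 ≤ P := by nlinarith [Real.pi_gt_three]
  have hNle := Nat.floor_le (show 0 ≤ P / 4 by linarith)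
  have hNlt := Nat.lt_floor_add_one (P / 4)
  set N : ℕ := ⌊P / 4⌋₊
  have hN8 : P / 8 ≤ N := by linarith
  have hN0 : (0 : ℝ) < N := by linarith
  have hMle := Nat.floor_le (show 0 ≤ δ * N / (2 * Real.pi) by positivity)
  have hMlt := Nat.lt_floor_add_one (δ * N / (2 * Real.pi))
  set M : ℕ := ⌊δ * N / (2 * Real.pi)⌋₊
  rw [le_div_iff₀ (by positivity), mul_comm] at hMle
  refine ⟨M, N, by exact_mod_cast hN0.ne', ?_, by linarith, (div_le_iff₀ hN0).2 hMle, ?_⟩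
  · have hMN : (M : ℝ) ≤ N := by nlinarith [Real.pi_gt_three]
    exact_mod_cast hMN
  · have hone : 1 ≤ δ / (32 * Real.pi) * P := by
      rw [div_mul_eq_mul_div, le_div_iff₀ (by positivity)]
      linarith
    have htwice : 2 * (δ / (32 * Real.pi) * P) ≤ δ * N / (2 * Real.pi) :=
      calc _ = δ * (P / 8) / (2 * Real.pi) := by
            field_simp
            norm_num
        _ ≤ _ := by gcongr
    linarith

variable {Ψ : OrliczFunction} {α : ℝ} {s : ℕ → ℝ}

theorem norm_sum_smul_fejerPeak_le {M N : ℕ} (hMN : M ≤ N) (hN : N ≠ 0) (v : ℝ) {u : Fin M → ℂ}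
    (hu : ∀ k, ‖u k‖ = 1) :
    ‖∑ k, u k • entireElement Ψ (differentiable_fejerPeak N (v + 2 * Real.pi * k / N))‖ ≤
      max 1 (Ψ 1) := by
  refine norm_sum_smul_le ?_ hu
  filter_upwards [ae_all_iff.2 fun k : Fin M => boundary_entireElement (Ψ := Ψ)
    (differentiable_fejerPeak N (v + 2 * Real.pi * k / N))] with t ht
  simp only [ht]
  exact sum_norm_fejerPeak_le hMN hN v (norm_circlePoint t).le

namespace IsLevelSequence

theorem le_norm_compositionOperator_fejerPeak (H : IsLevelSequence Ψ α s) {N : ℕ} {x y : ℝ}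
    (hy : 0 < y) (hx : ENNReal.ofReal (1 / Ψ y) <
      haarT {t | 1 / 16 ≤ ‖fejerPeak N x (symbolBoundary Ψ s t)‖}) :
    1 / 16 / y ≤ ‖H.controlledSymbol.compositionOperator
      (entireElement Ψ (differentiable_fejerPeak N x))‖ := by
  refine div_le_norm_of_le_on (f := (H.controlledSymbol.compositionOperator _).1) (by norm_num) hy
    hx ?_
  filter_upwards [H.controlledSymbol.boundary_compositionOperator
    (entireElement Ψ (differentiable_fejerPeak N x)), H.controlledSymbol.mem_disk]
    with t hbd hdisk hpeak
  rw [diskExt_entireElement _ hdisk] at hbd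
  exact hpeak.trans_eq (congrArg norm hbd).symm

theorem exists_eventually_le_of_isPSumming (H : IsLevelSequence Ψ α s) {p : ℝ} (hp : 1 ≤ p)
    (hT : IsPSumming p H.controlledSymbol.compositionOperator) :
    ∃ D : ℝ, ∀ᶠ n in atTop, Ψ (s n) ≤ D * s (2 * n + 2) ^ p := by
  obtain ⟨D, hD⟩ := hT.exists_card_mul_le hp (max 1 (Ψ 1))
  obtain ⟨δ, hδ0, hδ1, hwinding⟩ := H.exists_winding
  refine ⟨32 * Real.pi / δ * (D * 16 ^ p), ?_⟩
  filter_upwards [eventually_ge_atTop 1, hwinding,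
    H.tendsto.eventually_ge_atTop (32 * Real.pi / δ)] with n hn hδn hP
  obtain ⟨M, N, hN, hMN, hNP, hMδ, hPM⟩ := exists_peak_counts hδ0 hδ1 hP
  obtain ⟨v, hv⟩ := H.exists_large_peaks hn hN hNP hδn
  have hs := H.pos (2 * n + 2)
  have hlower (k : Fin M) := H.le_norm_compositionOperator_fejerPeak hs
    (hv (2 * Real.pi * k / N) (by positivity) (le_trans (by gcongr; exact k.2.le) hMδ))
  have hcard := hD M _ (1 / 16 / s (2 * n + 2))
    (fun u hu => norm_sum_smul_fejerPeak_le hMN hN v hu) (by positivity) hlower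
  rw [div_div, Real.div_rpow zero_le_one (by positivity), Real.one_rpow,
    Real.mul_rpow (by norm_num) hs.le, mul_one_div, div_le_iff₀ (by positivity)] at hcard
  calc Ψ (s n) = 32 * Real.pi / δ * (δ / (32 * Real.pi) * Ψ (s n)) := by field_simp
    _ ≤ 32 * Real.pi / δ * (D * (16 ^ p * s (2 * n + 2) ^ p)) :=
        mul_le_mul_of_nonneg_left (hPM.trans hcard) (by positivity)
    _ = _ := by ring

theorem not_isPSumming (H : IsLevelSequence Ψ α s) {p : ℝ} (hp : 1 ≤ p) :
    ¬ IsPSumming p H.controlledSymbol.compositionOperator := by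
  intro hT
  obtain ⟨D, hD⟩ := H.exists_eventually_le_of_isPSumming hp hT
  obtain ⟨n, hle, hlt⟩ := (hD.and ((H.tendsto_div_rpow p).eventually_gt_atTop D)).exists
  exact hle.not_gt ((lt_div_iff₀ (Real.rpow_pos_of_pos (H.pos _) p)).1 hlt)

end IsLevelSequence

end Summing

end HardyOrlicz

end

theorem mainTheorem2 (Ψ : HardyOrlicz.OrliczFunction) (hΨ : Ψ.DeltaSupTwo) :
    ∃ φ : ℂ → ℂ, DifferentiableOn ℂ φ HardyOrlicz.disk ∧
      Set.MapsTo φ HardyOrlicz.disk HardyOrlicz.disk ∧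
      (∃ h : HardyOrlicz.Torus → ℝ,
        HardyOrlicz.IsPiecewiseConstant h ∧ HardyOrlicz.IsOuterWithModulus φ h) ∧
      ∃ T : HardyOrlicz.hardyOrlicz Ψ →L[ℂ] HardyOrlicz.hardyOrlicz Ψ,
        HardyOrlicz.IsCompositionOperator φ T ∧
        HardyOrlicz.IsOrderBoundedIntoMorseTransue T ∧
        IsCompactOperator T ∧
        ∀ p : ℝ, 1 ≤ p → ¬ HardyOrlicz.IsPSumming p T := by
  obtain ⟨α, s, H⟩ := hΨ.exists_isLevelSequence
  exact ⟨_, H.controlledSymbol.differentiableOn, H.controlledSymbol.mapsTo,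
    ⟨_, H.isPiecewiseConstant, H.integrable_logModulus, fun z _ => rfl⟩,
    H.controlledSymbol.compositionOperator, H.controlledSymbol.isCompositionOperator,
    H.controlledSymbol.isOrderBoundedIntoMorseTransue, H.controlledSymbol.isCompactOperator,
    fun _ hp => H.not_isPSumming hp⟩
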